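/- **Setting.** Let $x\in\mathbb R$, let $y$ range over $\mathbb R$ or over a circle of length $L>0$, and let $C$ be the domain of $(x,y)$. The phase space consists of the smooth $u(x,y)\in\mathbb C$ on $C$ all of whose derivatives decay rapidly as $|x|\to\infty$ (and as $|y|\to\infty$ if $y\in\mathbb R$). For real $f$ put $(D_x^{-1}f)(x,y)=\tfrac12\big(\int_{-\infty}^x f\,dx-\int_x^{\infty} f\,dx\big)$, the skew-adjoint antiderivative. Define $$\mathcal H f=f_x-iu\,D_x^{-1}\mathrm{Im}(u\bar f),\quad \mathcal I=-i,\quad \mathcal R=\mathcal H\mathcal I^{-1}=i\big(D_x+uD_x^{-1}\mathrm{Re}(u\,\bar{\ \cdot\ })\big),\quad \mathcal R^*=\mathcal I^{-1}\mathcal H .$$ For $m\ge 0$ let $\varpi^{(m)}=\mathcal R^{*m}(iu_y)$, $\mathfrak H^{(m)}=\iint_C H^{(m)}dx\,dy$ with $H^{(m)}=\frac{2}{1+m}D_x^{-1}\mathrm{Re}(\bar u\,\mathcal R^{m+1}u_y)$ (the 2+1 Hamiltonians), and let $\varpi_1^{(m)}=\mathcal R^{*m}(u)$, $\mathfrak H_1^{(m)}=\iint_C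 H_1^{(m)}dx\,dy$ with $H_1^{(m)}=\frac{2}{1+m}D_x^{-1}\mathrm{Im}(\bar u\,(i\mathcal H)^{m+1}u)$ (the 1+1 Hamiltonians extended to two space dimensions); the $y$-integration is carried out first. The variational derivative $\delta\mathfrak H/\delta\bar u$ is defined by $\frac{d}{d\epsilon}\mathfrak H[u+\epsilon v]\big|_{\epsilon=0}=2\,\mathrm{Re}\iint_C v\,\overline{\delta\mathfrak H/\delta\bar u}\;dx\,dy$. For $n\ge1$ the $+n$ flow is $u_t=\mathcal H(\varpi^{(n-1)})$. A solution means a smooth $u(t,x,y)$, $t$ in an open set, whose space derivatives decay rapidly as above, locally uniformly in $t$. Put $\nu_0=D_x^{-1}\big(\tfrac12(|u|^2)_y\big)$, so that $\nu_{0x}=|u||u|_y$. **Proposition.** Let $n\ge 1$. 0. All objects above are well defined on the phase space (the vector fields preserve it and the integrals converge), $\varpi^{(m)}=\delta\mathfrak H^{(m)}/\delta\bar u$ and $\varpi_1^{(m)}=\delta\mathfrak H_1^{(m)}/\delta\bar u$ for all $m\ge0$, and the $+n$ flow is bi-Hamiltonian: $u_t=\mathcal H(\delta\mathfrak H^{(n-1)}/\delta\bar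 u)=\mathcal I(\delta\mathfrak H^{(n)}/\delta\bar u)$. 1. ($U(1)$-invariance.) The flow and all densities $H^{(m)}$ are invariant under $u\to e^{i\phi}u$, $\phi\in\mathbb R$; in particular solutions go to solutions. 2. (Scaling homogeneity.) Under $x\to\lambda x$, $y\to\lambda y$, $u\to\lambda^{-1}u$ with $\lambda>0$ (where $L\to\lambda L$ for a circle), the density $H^{(m)}$ has weight $-3-m$, and the right-hand side of the $+n$ flow has weight $-2-n$; with $t\to\lambda^{1+n}t$, solutions of the $+n$ flow go to solutions. 3. (Constants of motion.) For every $m\ge0$ both $\mathfrak H^{(m)}$ and $\mathfrak H_1^{(m)}$ are constants of motion of the $+n$ flow: their derivative along the vector field of the flow vanishes on the whole phase space, and $D_t\mathfrak H^{(m)}=D_t\mathfrak H_1^{(m)}=0$ on every solution. Here $$\mathfrak H^{(0)}=\iint_C i\bar uu_y,\quad \mathfrak H^{(1)}=\iint_C\big(\bar u_xu_y-\tfrac12\nu_0|u|^2\big),\quad \mathfrak H_1^{(0)}=\iint_C|u|^2,\quad \mathfrak H_1^{(1)}=\iint_C i\bar uu_x,\quad \mathfrak H_1^{(2)}=\iint_C\big(|u_x|^2-\tfrac14|u|^4\big).$$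 4. (Symmetries.) For every $m\ge0$ the Hamiltonian vector fields $i\varpi^{(m)}\partial/\partial u$ and $i\varpi_1^{(m)}\partial/\partial u$ are symmetries of the $+n$ flow: they commute with its vector field on the phase space, and on every solution they satisfy the linearised flow equation. The first ones are $-u_y\,\partial/\partial u$, $-i(u_{xy}+\nu_0u)\,\partial/\partial u$, and $iu\,\partial/\partial u$, $-u_x\,\partial/\partial u$, $-i(u_{xx}+\tfrac12|u|^2u)\,\partial/\partial u$. -/

import Mathlib

open scoped ContDiff ComplexConjugate

noncomputable section

namespace NLSHierarchy

/-- A complex field `u(x, y)`; the first argument is `x`, the second is `y`. -/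
abbrev Field2 : Type := ℝ → ℝ → ℂ

/-- The range of the transverse coordinate `y`: the real line, or a circle of length `L`
(fields on the circle are `L`-periodic functions of `y`). The coordinate `x` runs over `ℝ`. -/
inductive YDomain : Type
  | line : YDomain
  | circle (L : ℝ) (hL : 0 < L) : YDomain

namespace YDomain

/-- A set of representatives of the `y`-domain, over which `y`-integrals are taken. -/
def ySet : YDomain → Set ℝ
  | line => Set.univ
  | circle L _ => Set.Ioc 0 L

/-- The weight in `y` used to express rapid decay: `|y|` on the line, `1` on the circle. -/
def yWeight : YDomain → ℝ → ℝ
  | line, y => |y|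
  | circle _ _, _ => 1

/-- Periodicity in `y` (no condition on the line). -/
def Periodic : YDomain → Field2 → Prop
  | line, _ => True
  | circle L _, u => ∀ x y, u x (y + L) = u x y

/-- The image of the `y`-domain under the dilation `y ↦ c y`. -/
def dilate (c : ℝ) (hc : 0 < c) : YDomain → YDomain
  | line => line
  | circle L hL => circle (c * L) (mul_pos hc hL)

/-- The integral `∬ f dx dy` over the coordinate domain, with the `y`-integration first. -/
def integral {E : Type*} [NormedAddCommGroup E] [NormedSpace ℝ E] (C : YDomain)
    (f : ℝ → ℝ → E) : E :=
  ∫ x : ℝ, ∫ y in C.ySet, f x y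

/-- All integrals occurring in `C.integral f` converge absolutely. -/
def IterIntegrable (C : YDomain) (f : ℝ → ℝ → ℝ) : Prop :=
  (∀ x, MeasureTheory.IntegrableOn (f x) C.ySet) ∧
    MeasureTheory.Integrable (fun x : ℝ => ∫ y in C.ySet, f x y)

end YDomain

/-- The partial derivative `u_x`. -/
def dx (u : Field2) : Field2 := fun x y => deriv (fun s => u s y) x

/-- The partial derivative `u_y`. -/
def dy (u : Field2) : Field2 := fun x y => deriv (fun s => u x s) y

/-- `|x|^j w(y)^k |∂_x^a ∂_y^b u| ≤ M` everywhere, with `w` the `y`-weight of the domain. -/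
def DecayBound (C : YDomain) (u : Field2) (j k a b : ℕ) (M : ℝ) : Prop :=
  ∀ x y : ℝ, |x| ^ j * C.yWeight y ^ k * ‖(dx^[a] (dy^[b] u)) x y‖ ≤ M

/-- The phase space: smooth fields on the coordinate domain all of whose derivatives decay
rapidly as `|x| → ∞`, and as `|y| → ∞` when `y` ranges over the line. -/
structure Admissible (C : YDomain) (u : Field2) : Prop where
  smooth : ContDiff ℝ ∞ (fun p : ℝ × ℝ => u p.1 p.2)
  periodic : C.Periodic u
  decay : ∀ j k a b : ℕ, ∃ M : ℝ, DecayBound C u j k a b M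

/-- The formal inverse `D_x⁻¹` of `∂_x` on real functions, realised as the skew-adjoint
antiderivative `(D_x⁻¹ f)(x) = ½ (∫_{-∞}^x f - ∫_x^∞ f)`, that is, the antiderivative whose
limits at `x = ±∞` are opposite. -/
def dxInv (f : ℝ → ℝ → ℝ) : ℝ → ℝ → ℝ := fun x y =>
  ((∫ s in Set.Iic x, f s y) - ∫ s in Set.Ioi x, f s y) / 2

/-- The Hamiltonian operator `𝓗 = D_x - i u D_x⁻¹ Im(u 𝓒)`, with `𝓒` complex conjugation. -/
def opH (u f : Field2) : Field2 := fun x y =>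
  dx f x y - Complex.I * u x y * (dxInv (fun x y => (u x y * conj (f x y)).im) x y : ℝ)

/-- The Hamiltonian operator `𝓘 = -i`. -/
def opI (f : Field2) : Field2 := fun x y => -Complex.I * f x y

/-- The inverse `𝓘⁻¹ = i`. -/
def opIinv (f : Field2) : Field2 := fun x y => Complex.I * f x y

/-- The recursion operator `𝓡 = 𝓗 𝓘⁻¹`. -/
def opR (u f : Field2) : Field2 := opH u (opIinv f)

/-- The adjoint recursion operator `𝓡* = 𝓘⁻¹ 𝓗`. -/
def opRstar (u f : Field2) : Field2 := opIinv (opH u f)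

/-- The 1+1 Hamiltonian covectors `ϖ⁽ᵐ⁾ = 𝓡*ᵐ(u)`, at a field with two space variables. -/
def covector1 (m : ℕ) (u : Field2) : Field2 := (opRstar u)^[m] u

/-- The 2+1 Hamiltonian covectors `ϖ⁽ᵐ⁾ = 𝓡*ᵐ(i u_y)`. -/
def covector2 (m : ℕ) (u : Field2) : Field2 :=
  (opRstar u)^[m] (fun x y => Complex.I * dy u x y)

/-- The 1+1 Hamiltonian densities `H⁽ᵐ⁾ = 2/(1+m) D_x⁻¹ Im(ū (i𝓗)^{m+1} u)`. -/
def density1 (m : ℕ) (u : Field2) : ℝ → ℝ → ℝ := fun x y =>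
  2 / (1 + (m : ℝ)) *
    dxInv (fun x y => (conj (u x y) * ((fun f => opIinv (opH u f))^[m + 1] u) x y).im) x y

/-- The 2+1 Hamiltonian densities `H⁽ᵐ⁾ = 2/(1+m) D_x⁻¹ Re(ū 𝓡^{m+1} u_y)`. -/
def density2 (m : ℕ) (u : Field2) : ℝ → ℝ → ℝ := fun x y =>
  2 / (1 + (m : ℝ)) *
    dxInv (fun x y => (conj (u x y) * ((opR u)^[m + 1] (dy u)) x y).re) x y

/-- The 1+1 Hamiltonians extended to two space dimensions. -/
def ham1 (C : YDomain) (m : ℕ) (u : Field2) : ℝ := C.integral (density1 m u)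

/-- The 2+1 Hamiltonians. -/
def ham2 (C : YDomain) (m : ℕ) (u : Field2) : ℝ := C.integral (density2 m u)

/-- `w u` is the variational derivative `δh/δū` of the real functional `h` at every `u` in the
phase space: `d/dε h(u + ε v) = 2 Re ∬ v (w u)‾ dx dy` at `ε = 0`. -/
def IsVariationalDerivative (C : YDomain) (h : Field2 → ℝ) (w : Field2 → Field2) : Prop :=
  ∀ u, Admissible C u → Admissible C (w u) ∧
    ∀ v, Admissible C v →
      HasDerivAt (fun ε : ℝ => h (u + ε • v))
        (2 * C.integral (fun x y => (v x y * conj (w u x y)).re)) 0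

/-- The right-hand side `𝓗(ϖ⁽ⁿ⁻¹⁾)` of the 2+1 `+n` flow; it is used for `n ≥ 1`. -/
def flow (n : ℕ) (u : Field2) : Field2 := opH u (covector2 (n - 1) u)

/-- `u(t, x, y)` is a smooth solution of the `+n` flow `u_t = 𝓗(ϖ⁽ⁿ⁻¹⁾)` for `t` in the open
set `T`, rapidly decaying locally uniformly in time. -/
structure IsSolution (C : YDomain) (n : ℕ) (T : Set ℝ) (u : ℝ → Field2) : Prop where
  smooth : ContDiffOn ℝ ∞ (fun q : ℝ × ℝ × ℝ => u q.1 q.2.1 q.2.2) (T ×ˢ Set.univ)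
  periodic : ∀ t ∈ T, C.Periodic (u t)
  decay : ∀ K ⊆ T, IsCompact K → ∀ j k a b : ℕ, ∃ M : ℝ, ∀ t ∈ K, DecayBound C (u t) j k a b M
  evolution : ∀ t ∈ T, ∀ x y, HasDerivAt (fun s => u s x y) (flow n (u t) x y) t

/-- `h` is a constant of motion of the `+n` flow: its derivative vanishes along the vector field
of the flow at every field of the phase space, and `D_t h(u) = 0` on every solution. -/
def IsConstantOfMotion (C : YDomain) (n : ℕ) (h : Field2 → ℝ) : Prop :=
  (∀ u, Admissible C u → HasDerivAt (fun ε : ℝ => h (u + ε • flow n u)) 0 0) ∧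
    ∀ (T : Set ℝ) (u : ℝ → Field2), IsOpen T → IsSolution C n T u →
      ∀ t ∈ T, HasDerivAt (fun s => h (u s)) 0 t

/-- The evolutionary vector field `Q ∂/∂u` is a symmetry of the `+n` flow `u_t = F(u)`: the
vector fields commute, `F'(u)[Q(u)] = Q'(u)[F(u)]` on the phase space, and on every
solution `Q(u)` satisfies the linearised equation `D_t Q(u) = F'(u)[Q(u)]`. -/
def IsSymmetry (C : YDomain) (n : ℕ) (Q : Field2 → Field2) : Prop :=
  (∀ u, Admissible C u → Admissible C (Q u) ∧
    ∀ x y, ∃ d : ℂ, HasDerivAt (fun ε : ℝ => flow n (u + ε • Q u) x y) d 0 ∧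
      HasDerivAt (fun ε : ℝ => Q (u + ε • flow n u) x y) d 0) ∧
  ∀ (T : Set ℝ) (u : ℝ → Field2), IsOpen T → IsSolution C n T u →
    ∀ t ∈ T, ∀ x y, ∃ d : ℂ, HasDerivAt (fun s => Q (u s) x y) d t ∧
      HasDerivAt (fun ε : ℝ => flow n (u t + ε • Q (u t)) x y) d 0

/-- The 1+1 Hamiltonian vector fields `i ϖ⁽ᵐ⁾ ∂/∂u`, with `ϖ⁽ᵐ⁾ = 𝓡*ᵐ(u)`. -/
def symmetry1 (m : ℕ) (u : Field2) : Field2 := fun x y => Complex.I * covector1 m u x y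

/-- The 2+1 Hamiltonian vector fields `i ϖ⁽ᵐ⁾ ∂/∂u`, with `ϖ⁽ᵐ⁾ = 𝓡*ᵐ(i u_y)`. -/
def symmetry2 (m : ℕ) (u : Field2) : Field2 := fun x y => Complex.I * covector2 m u x y

/-- The phase rotation `u ↦ e^{iφ} u`. -/
def rotate (φ : ℝ) (u : Field2) : Field2 := fun x y => Complex.exp (Complex.I * φ) * u x y

/-- The action on fields of the scaling `x → c x`, `y → c y`, `u → c⁻¹ u`. -/
def rescale (c : ℝ) (u : Field2) : Field2 := fun x y => (c : ℂ)⁻¹ * u (x / c) (y / c)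

/-- The nonlocal variable `ν₀`, with `∂_x ν₀ = |u| |u|_y = ½ (|u|²)_y`. -/
def nu0 (u : Field2) : ℝ → ℝ → ℝ :=
  dxInv (fun x y => deriv (fun s => ‖u x s‖ ^ 2) y / 2)

end NLSHierarchy

end

/-! Everything is governed by one operator, 𝓡 f = i (f_x + u D_x⁻¹ Re(u f̄)), and by two root vector
fields, i u and -u_y. Write X_m for 𝓡ᵐ applied to either root (`hierField`). The covectors are -i
X_m, the symmetries are X_m, and for n ≥ 1 the `+n` flow is -X_n of the transverse hierarchy. The
proof has an algebraic core and an analytic frame.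

Commutation. 𝓡 is hereditary (`recOp_hereditary`), and both roots preserve it: the first because
phase rotation fixes Re(u f̄), the second because ∂_y commutes with D_x⁻¹. By heredity, every X_m
then preserves 𝓡 (`recOp_lie_hierField`), and preservation of 𝓡 lets commutation climb from the
roots to all pairs of indices (`hierDeriv_comm`). This gives the symmetries.

Hamiltonian structure. 𝓡 is symmetric for the symplectic form ω(f, g) = ∬ Re(i f ḡ)
(`pairing_I_smul_recOp`). With preservation of 𝓡, this makes the one-forms given by -i X_m closed
(`pairing_hierDeriv_symm`). A closed one-form homogeneous under a scaling has an explicit potential,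
obtained by contraction with the scaling field. The scaling used acts on x and u only, with
generator S = (x u)_x and X_m'[S] = (1 + m) X_m + x ∂_x X_m (`hierDeriv_scaling`). So `hamValue`,
which is 2/(1+m) ω(S, X_m), has variational derivative -i X_m (`C1Tame.hasDerivAt_hamValue`).

The densities. S equals 𝓡(-i x u), so symmetry of 𝓡 turns ω(S, X_m) into ∬ x Re(u X̄_{m+1}).
Integration by parts in x turns this into minus the integral of D_x⁻¹ Re(u X̄_{m+1}), the stated
density up to a factor (`integral_antiDx_rePair_hierField`). The boundary terms vanish only because
∬ Re(u X̄_{m+1}) = 0. That orthogonality is `pairing_self_hierField`: closedness and phase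
equivariance show that the pairing is constant along the ray s u, and it vanishes at s = 0.

Conservation. Moving 𝓡 across ω makes ω(X_m, X_n) depend on m + n only; inside one hierarchy it is
also antisymmetric, hence zero. Across the hierarchies it reduces to the orthogonality just
described (`pairing_I_smul_hierField`). The explicit Hamiltonians come from integrating their
covectors along rays (`hamValue_eq_of_ray`).

Analysis. The frame is a calculus of families of fields with decay bounds uniform in a parameter
(`Tame`, `C1Tame`), closed under every operation in 𝓡. Lines in phase space, rays and solutions are
all such families, so derivatives in direction and in time are treated alike. D_x⁻¹ destroys decay
in x but keeps decay in y; multiplication by u restores the former. -/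

noncomputable section

namespace NLSHierarchy

open MeasureTheory Set Filter Topology

/-! ### Calculus of smooth fields -/

/-- Mixed directional derivatives of a smooth function commute. -/
theorem fderiv_fderiv_apply_comm {E : Type*} [NormedAddCommGroup E] [NormedSpace ℝ E]
    {W : E → ℂ} {p : E} (hW : ContDiffAt ℝ ∞ W p) (v w : E) :
    fderiv ℝ (fun q => fderiv ℝ W q v) p w = fderiv ℝ (fun q => fderiv ℝ W q w) p v := by
  have hd : DifferentiableAt ℝ (fderiv ℝ W) p :=
    (hW.fderiv_right (m := 1) (by norm_cast)).differentiableAt (by norm_num)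
  have key : ∀ a b : E, fderiv ℝ (fun q => fderiv ℝ W q a) p b = fderiv ℝ (fderiv ℝ W) p b a := by
    intro a b
    have := (hd.hasFDerivAt.clm_apply (hasFDerivAt_const a p)).fderiv
    rw [this]
    simp
  rw [key, key]
  have h2 : minSmoothness ℝ 2 ≤ ∞ := by
    rw [minSmoothness_of_isRCLikeNormedField]
    exact ENat.LEInfty.out
  exact (hW.isSymmSndFDerivAt h2).eq w v

/-- The field is a smooth function of `(x, y)`. -/
def SmoothField (w : Field2) : Prop := ContDiff ℝ ∞ (fun p : ℝ × ℝ => w p.1 p.2)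

/-- The complex conjugate of a field. -/
def conjField (f : Field2) : Field2 := fun x y => conj (f x y)

/-- The field `Re (u f̄)`, regarded as complex valued. -/
def rePair (u f : Field2) : Field2 := fun x y => ((u x y * conj (f x y)).re : ℂ)

/-- The field `x f`. -/
def mulX (f : Field2) : Field2 := fun x y => (x : ℂ) * f x y

/-- Written with products and conjugates, the real pairing inherits its Leibniz rules, decay bounds
and parameter derivatives from those two operations. -/
theorem rePair_eq (u f : Field2) :
    rePair u f = (1 / 2 : ℂ) • (u * conjField f + conjField u * f) := by
  funext x y
  simp only [rePair, conjField, Pi.smul_apply, Pi.add_apply, Pi.mul_apply, smul_eq_mul]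
  rw [Complex.re_eq_add_conj]
  simp only [map_mul, Complex.conj_conj]
  ring

namespace SmoothField

variable {u v w f g : Field2}

theorem hasDerivAt_dx (h : SmoothField w) (x y : ℝ) :
    HasDerivAt (fun s => w s y) (dx w x y) x := by
  have h1 : Differentiable ℝ (fun p : ℝ × ℝ => w p.1 p.2) := h.differentiable (by simp)
  have : DifferentiableAt ℝ (fun s => w s y) x :=
    (h1 (x, y)).comp x (f := fun s : ℝ => (s, y)) (by fun_prop)
  exact this.hasDerivAt

theorem hasDerivAt_dy (h : SmoothField w) (x y : ℝ) :
    HasDerivAt (fun s => w x s) (dy w x y) y := by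
  have h1 : Differentiable ℝ (fun p : ℝ × ℝ => w p.1 p.2) := h.differentiable (by simp)
  have : DifferentiableAt ℝ (fun s => w x s) y :=
    (h1 (x, y)).comp y (f := fun s : ℝ => (x, s)) (by fun_prop)
  exact this.hasDerivAt

theorem dx_eq_fderiv (h : SmoothField w) (x y : ℝ) :
    dx w x y = fderiv ℝ (fun p : ℝ × ℝ => w p.1 p.2) (x, y) (1, 0) := by
  have h1 := (h.differentiable (by simp) (x, y)).hasFDerivAt
  have h2 : HasDerivAt (fun s : ℝ => (s, y)) ((1 : ℝ), (0 : ℝ)) x :=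
    (hasDerivAt_id x).prodMk (hasDerivAt_const x y)
  exact (h1.comp_hasDerivAt (f := fun s : ℝ => (s, y)) x h2).deriv

theorem dy_eq_fderiv (h : SmoothField w) (x y : ℝ) :
    dy w x y = fderiv ℝ (fun p : ℝ × ℝ => w p.1 p.2) (x, y) (0, 1) := by
  have h1 := (h.differentiable (by simp) (x, y)).hasFDerivAt
  have h2 : HasDerivAt (fun s : ℝ => (x, s)) ((0 : ℝ), (1 : ℝ)) y :=
    (hasDerivAt_const y x).prodMk (hasDerivAt_id y)
  exact (h1.comp_hasDerivAt (f := fun s : ℝ => (x, s)) y h2).deriv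

theorem dx (h : SmoothField w) : SmoothField (dx w) := by
  have : (fun p : ℝ × ℝ => NLSHierarchy.dx w p.1 p.2)
      = fun p => fderiv ℝ (fun p : ℝ × ℝ => w p.1 p.2) p (1, 0) := by
    funext p; exact h.dx_eq_fderiv p.1 p.2
  unfold SmoothField
  rw [this]
  exact (ContDiff.fderiv_right h (m := ∞) (by simp)).clm_apply contDiff_const

theorem dy (h : SmoothField w) : SmoothField (dy w) := by
  have : (fun p : ℝ × ℝ => NLSHierarchy.dy w p.1 p.2)
      = fun p => fderiv ℝ (fun p : ℝ × ℝ => w p.1 p.2) p (0, 1) := by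
    funext p; exact h.dy_eq_fderiv p.1 p.2
  unfold SmoothField
  rw [this]
  exact (ContDiff.fderiv_right h (m := ∞) (by simp)).clm_apply contDiff_const

theorem dx_dy_comm (h : SmoothField w) :
    NLSHierarchy.dx (NLSHierarchy.dy w) = NLSHierarchy.dy (NLSHierarchy.dx w) := by
  funext x y
  rw [h.dy.dx_eq_fderiv, h.dx.dy_eq_fderiv]
  have e1 : (fun p : ℝ × ℝ => NLSHierarchy.dx w p.1 p.2)
      = fun p => fderiv ℝ (fun p : ℝ × ℝ => w p.1 p.2) p (1, 0) := by
    funext p; exact h.dx_eq_fderiv p.1 p.2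
  have e2 : (fun p : ℝ × ℝ => NLSHierarchy.dy w p.1 p.2)
      = fun p => fderiv ℝ (fun p : ℝ × ℝ => w p.1 p.2) p (0, 1) := by
    funext p; exact h.dy_eq_fderiv p.1 p.2
  rw [e1, e2]
  exact fderiv_fderiv_apply_comm (ContDiff.contDiffAt h) _ _

theorem add (hf : SmoothField f) (hg : SmoothField g) : SmoothField (f + g) :=
  ContDiff.add hf hg

theorem mul (hf : SmoothField f) (hg : SmoothField g) : SmoothField (f * g) :=
  ContDiff.mul hf hg

theorem smul (c : ℂ) (hf : SmoothField f) : SmoothField (c • f) :=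
  contDiff_const.mul hf

theorem conjField (hf : SmoothField f) : SmoothField (conjField f) :=
  Complex.conjCLE.contDiff.comp hf

theorem mulX (hf : SmoothField f) : SmoothField (mulX f) :=
  (Complex.ofRealCLM.contDiff.comp contDiff_fst).mul hf

theorem continuous (hf : SmoothField f) : Continuous (fun p : ℝ × ℝ => f p.1 p.2) :=
  ContDiff.continuous hf

end SmoothField

section

variable {u v w f g : Field2}

theorem dx_add (hf : SmoothField f) (hg : SmoothField g) : dx (f + g) = dx f + dx g := by
  funext x y
  exact ((hf.hasDerivAt_dx x y).add (hg.hasDerivAt_dx x y)).deriv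

theorem dy_add (hf : SmoothField f) (hg : SmoothField g) : dy (f + g) = dy f + dy g := by
  funext x y
  exact ((hf.hasDerivAt_dy x y).add (hg.hasDerivAt_dy x y)).deriv

theorem dx_mul (hf : SmoothField f) (hg : SmoothField g) : dx (f * g) = dx f * g + f * dx g := by
  funext x y
  exact ((hf.hasDerivAt_dx x y).mul (hg.hasDerivAt_dx x y)).deriv

theorem dy_mul (hf : SmoothField f) (hg : SmoothField g) : dy (f * g) = dy f * g + f * dy g := by
  funext x y
  exact ((hf.hasDerivAt_dy x y).mul (hg.hasDerivAt_dy x y)).deriv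

theorem dx_smul (c : ℂ) (f : Field2) : dx (c • f) = c • dx f := by
  funext x y
  exact deriv_const_mul_field c

theorem dy_smul (c : ℂ) (f : Field2) : dy (c • f) = c • dy f := by
  funext x y
  exact deriv_const_mul_field c

theorem dx_conjField (hf : SmoothField f) : dx (conjField f) = conjField (dx f) := by
  funext x y
  exact (Complex.conjCLE.hasFDerivAt.comp_hasDerivAt x (hf.hasDerivAt_dx x y)).deriv

theorem dy_conjField (hf : SmoothField f) : dy (conjField f) = conjField (dy f) := by
  funext x y
  exact (Complex.conjCLE.hasFDerivAt.comp_hasDerivAt y (hf.hasDerivAt_dy x y)).deriv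

theorem dx_mulX (hf : SmoothField f) : dx (mulX f) = f + mulX (dx f) := by
  funext x y
  have h : HasDerivAt (fun s : ℝ => (s : ℂ)) 1 x := Complex.ofRealCLM.hasDerivAt
  refine (h.mul (hf.hasDerivAt_dx x y)).deriv.trans ?_
  simp [mulX]

theorem dy_mulX (f : Field2) : dy (mulX f) = mulX (dy f) := by
  funext x y
  exact deriv_const_mul_field _

theorem dx_rePair (hu : SmoothField u) (hf : SmoothField f) :
    dx (rePair u f) = rePair (dx u) f + rePair u (dx f) := by
  simp only [rePair_eq]
  rw [dx_smul, dx_add (hu.mul hf.conjField) (hu.conjField.mul hf), dx_mul hu hf.conjField,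
    dx_mul hu.conjField hf, dx_conjField hu, dx_conjField hf, ← smul_add]
  congr 1
  ring

theorem dy_rePair (hu : SmoothField u) (hf : SmoothField f) :
    dy (rePair u f) = rePair (dy u) f + rePair u (dy f) := by
  simp only [rePair_eq]
  rw [dy_smul, dy_add (hu.mul hf.conjField) (hu.conjField.mul hf), dy_mul hu hf.conjField,
    dy_mul hu.conjField hf, dy_conjField hu, dy_conjField hf, ← smul_add]
  congr 1
  ring

/-- The mixed derivative `∂_x^a ∂_y^b w`. -/
def dxy (a b : ℕ) (w : Field2) : Field2 := dx^[a] (dy^[b] w)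

theorem dxy_succ_right (a b : ℕ) (w : Field2) : dxy a (b + 1) w = dxy a b (dy w) := rfl

theorem dxy_succ_zero (a : ℕ) (w : Field2) : dxy (a + 1) 0 w = dxy a 0 (dx w) := rfl

/-- In ∂_x^a ∂_y^b the y-derivatives act first, so an extra ∂_x on the inside has to be carried
across ∂_y^b. Smoothness is proved in the same induction, since both claims pass from w to w_y. -/
theorem SmoothField.dy_iterate_dx (hw : SmoothField w) (b : ℕ) :
    NLSHierarchy.dy^[b] (NLSHierarchy.dx w) = NLSHierarchy.dx (NLSHierarchy.dy^[b] w) ∧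
      SmoothField (NLSHierarchy.dy^[b] w) := by
  induction b generalizing w with
  | zero => exact ⟨rfl, hw⟩
  | succ b ih =>
    refine ⟨?_, (ih hw.dy).2⟩
    rw [Function.iterate_succ_apply, Function.iterate_succ_apply, ← hw.dx_dy_comm, (ih hw.dy).1]

theorem SmoothField.dxy_dx (hw : SmoothField w) (a b : ℕ) :
    dxy a b (NLSHierarchy.dx w) = dxy (a + 1) b w := by
  rw [dxy, (hw.dy_iterate_dx b).1, dxy, Function.iterate_succ_apply]

theorem dxy_smul (a b : ℕ) (c : ℂ) (w : Field2) : dxy a b (c • w) = c • dxy a b w := by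
  induction b generalizing w with
  | zero =>
    induction a generalizing w with
    | zero => rfl
    | succ a ih => rw [dxy_succ_zero, dx_smul, ih, ← dxy_succ_zero]
  | succ b ih => rw [dxy_succ_right, dy_smul, ih, ← dxy_succ_right]

theorem dxy_add (a b : ℕ) (hf : SmoothField f) (hg : SmoothField g) :
    dxy a b (f + g) = dxy a b f + dxy a b g := by
  induction b generalizing f g with
  | zero =>
    induction a generalizing f g with
    | zero => rfl
    | succ a ih =>
      rw [dxy_succ_zero, dx_add hf hg, ih hf.dx hg.dx, ← dxy_succ_zero, ← dxy_succ_zero]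
  | succ b ih =>
    rw [dxy_succ_right, dy_add hf hg, ih hf.dy hg.dy, ← dxy_succ_right, ← dxy_succ_right]

theorem dxy_conjField (a b : ℕ) (hf : SmoothField f) :
    dxy a b (conjField f) = conjField (dxy a b f) := by
  induction b generalizing f with
  | zero =>
    induction a generalizing f with
    | zero => rfl
    | succ a ih => rw [dxy_succ_zero, dx_conjField hf, ih hf.dx, ← dxy_succ_zero]
  | succ b ih => rw [dxy_succ_right, dy_conjField hf, ih hf.dy, ← dxy_succ_right]

end

/-! ### Families of fields with uniform decay -/

theorem YDomain.yWeight_nonneg (C : YDomain) (y : ℝ) : 0 ≤ C.yWeight y := by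
  cases C with
  | line => exact abs_nonneg y
  | circle L hL => exact zero_le_one

theorem YDomain.Periodic.dx {C : YDomain} {u : Field2} (h : C.Periodic u) :
    C.Periodic (dx u) := by
  cases C with
  | line => trivial
  | circle L hL =>
    intro x y
    exact congrArg (fun g => deriv g x) (funext fun s => h s y)

theorem YDomain.Periodic.dy {C : YDomain} {u : Field2} (h : C.Periodic u) :
    C.Periodic (dy u) := by
  cases C with
  | line => trivial
  | circle L hL =>
    intro x y
    change deriv (fun s => u x s) (y + L) = deriv (fun s => u x s) y
    rw [← deriv_comp_add_const]
    exact congrArg (fun g => deriv g y) (funext fun s => h x s)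

/-- The operation may depend on x but not on y; this covers multiplication by x. -/
theorem YDomain.Periodic.map₂ {C : YDomain} {u v w : Field2} (hu : C.Periodic u)
    (hv : C.Periodic v) (F : ℝ → ℂ → ℂ → ℂ) (h : ∀ x y, w x y = F x (u x y) (v x y)) :
    C.Periodic w := by
  cases C with
  | line => trivial
  | circle L hL =>
    intro x y
    rw [h, h, hu x y, hv x y]

/-- A family of smooth fields `w s`, `s ∈ K`, all of whose derivatives satisfy, uniformly in `s`,
the decay bounds with the powers of `|x|` in `J` and all powers of the `y`-weight. -/
structure Tame (C : YDomain) (J : Set ℕ) (K : Set ℝ) (w : ℝ → Field2) : Prop where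
  smooth : ∀ s ∈ K, SmoothField (w s)
  periodic : ∀ s ∈ K, C.Periodic (w s)
  bound : ∀ j ∈ J, ∀ k a b : ℕ, ∃ M : ℝ, ∀ s ∈ K, DecayBound C (w s) j k a b M

/-- A tame family `w` whose space derivatives are differentiable in the parameter, the derivative
being given by the tame family `w'`. -/
structure C1Tame (C : YDomain) (J : Set ℕ) (K : Set ℝ) (w w' : ℝ → Field2) : Prop where
  tame : Tame C J K w
  tame' : Tame C J K w'
  deriv : ∀ s ∈ K, ∀ (a b : ℕ) (x y : ℝ),
    HasDerivAt (fun σ => dxy a b (w σ) x y) (dxy a b (w' s) x y) s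

section

variable {C : YDomain} {J : Set ℕ} {K : Set ℝ} {f g f' g' w w' : ℝ → Field2}

theorem DecayBound.nonneg {u : Field2} {j k a b : ℕ} {M : ℝ} (h : DecayBound C u j k a b M) :
    0 ≤ M :=
  le_trans (mul_nonneg (mul_nonneg (by positivity) (pow_nonneg (C.yWeight_nonneg 0) k))
    (norm_nonneg _)) (h 0 0)

theorem DecayBound.add {u v : Field2} (hu : SmoothField u) (hv : SmoothField v) {j k a b : ℕ}
    {M N : ℝ} (h : DecayBound C u j k a b M) (h' : DecayBound C v j k a b N) :
    DecayBound C (u + v) j k a b (M + N) := by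
  intro x y
  have e : (dx^[a] (dy^[b] (u + v))) x y = dxy a b u x y + dxy a b v x y := by
    change dxy a b (u + v) x y = _
    rw [dxy_add a b hu hv]; rfl
  rw [e]
  have hw : 0 ≤ |x| ^ j * C.yWeight y ^ k :=
    mul_nonneg (by positivity) (pow_nonneg (C.yWeight_nonneg y) k)
  calc _ ≤ |x| ^ j * C.yWeight y ^ k * (‖dxy a b u x y‖ + ‖dxy a b v x y‖) :=
        mul_le_mul_of_nonneg_left (norm_add_le _ _) hw
    _ ≤ M + N := by rw [mul_add]; exact add_le_add (h x y) (h' x y)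

theorem DecayBound.smul {u : Field2} {j k a b : ℕ} {M : ℝ} (c : ℂ) (h : DecayBound C u j k a b M) :
    DecayBound C (c • u) j k a b (‖c‖ * M) := by
  intro x y
  have e : (dx^[a] (dy^[b] (c • u))) x y = c * dxy a b u x y := by
    change dxy a b (c • u) x y = _
    rw [dxy_smul]; rfl
  rw [e, norm_mul]
  calc _ = ‖c‖ * (|x| ^ j * C.yWeight y ^ k * ‖dxy a b u x y‖) := by ring
    _ ≤ _ := mul_le_mul_of_nonneg_left (h x y) (norm_nonneg c)

/-! ### Closure of uniformly decaying families under the field operations. -/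

namespace Tame

theorem mono {J' : Set ℕ} {K' : Set ℝ} (hJ : J' ⊆ J) (hK : K' ⊆ K) (h : Tame C J K f) :
    Tame C J' K' f :=
  ⟨fun s hs => h.smooth s (hK hs), fun s hs => h.periodic s (hK hs), fun j hj k a b =>
    (h.bound j (hJ hj) k a b).imp fun _ hM s hs => hM s (hK hs)⟩

theorem congr (h : Tame C J K f) (e : ∀ s ∈ K, g s = f s) : Tame C J K g :=
  ⟨fun s hs => by rw [e s hs]; exact h.smooth s hs,
    fun s hs => by rw [e s hs]; exact h.periodic s hs, fun j hj k a b =>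
    (h.bound j hj k a b).imp fun _ hM s hs => by rw [e s hs]; exact hM s hs⟩

theorem add (hf : Tame C J K f) (hg : Tame C J K g) : Tame C J K (fun s => f s + g s) := by
  refine ⟨fun s hs => (hf.smooth s hs).add (hg.smooth s hs), fun s hs =>
    (hf.periodic s hs).map₂ (hg.periodic s hs) (fun _ a b => a + b) fun _ _ => rfl,
    fun j hj k a b => ?_⟩
  obtain ⟨M, hM⟩ := hf.bound j hj k a b
  obtain ⟨N, hN⟩ := hg.bound j hj k a b
  exact ⟨M + N, fun s hs => (hM s hs).add (hf.smooth s hs) (hg.smooth s hs) (hN s hs)⟩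

theorem smul (c : ℂ) (hf : Tame C J K f) : Tame C J K (fun s => c • f s) := by
  refine ⟨fun s hs => (hf.smooth s hs).smul c, fun s hs =>
    (hf.periodic s hs).map₂ (hf.periodic s hs) (fun _ a _ => c * a) fun _ _ => rfl,
    fun j hj k a b => ?_⟩
  obtain ⟨M, hM⟩ := hf.bound j hj k a b
  exact ⟨‖c‖ * M, fun s hs => (hM s hs).smul c⟩

theorem conjField (hf : Tame C J K f) : Tame C J K (fun s => conjField (f s)) := by
  refine ⟨fun s hs => (hf.smooth s hs).conjField, fun s hs =>
    (hf.periodic s hs).map₂ (hf.periodic s hs) (fun _ a _ => conj a) fun _ _ => rfl,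
    fun j hj k a b => ?_⟩
  obtain ⟨M, hM⟩ := hf.bound j hj k a b
  refine ⟨M, fun s hs x y => ?_⟩
  have e : (NLSHierarchy.dx^[a] (NLSHierarchy.dy^[b] (NLSHierarchy.conjField (f s)))) x y
      = conj (dxy a b (f s) x y) := by
    change dxy a b (NLSHierarchy.conjField (f s)) x y = _
    rw [dxy_conjField a b (hf.smooth s hs)]; rfl
  rw [e, RCLike.norm_conj]
  exact hM s hs x y

theorem dx (hf : Tame C J K f) : Tame C J K (fun s => dx (f s)) := by
  refine ⟨fun s hs => (hf.smooth s hs).dx, fun s hs => (hf.periodic s hs).dx,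
    fun j hj k a b => ?_⟩
  obtain ⟨M, hM⟩ := hf.bound j hj k (a + 1) b
  refine ⟨M, fun s hs x y => ?_⟩
  have e := (hf.smooth s hs).dxy_dx a b
  change _ * ‖dxy a b _ x y‖ ≤ _
  rw [e]
  exact hM s hs x y

theorem dy (hf : Tame C J K f) : Tame C J K (fun s => dy (f s)) := by
  refine ⟨fun s hs => (hf.smooth s hs).dy, fun s hs => (hf.periodic s hs).dy,
    fun j hj k a b => ?_⟩
  obtain ⟨M, hM⟩ := hf.bound j hj k a (b + 1)
  exact ⟨M, fun s hs x y => hM s hs x y⟩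

/-- All weights are charged to the first factor, so the second needs only bounded derivatives in x.
This asymmetry is what allows u D_x⁻¹(⋯) to decay although D_x⁻¹(⋯) does not. -/
theorem mul (hf : Tame C J K f) (hg : Tame C {0} K g) : Tame C J K (fun s => f s * g s) := by
  refine ⟨fun s hs => (hf.smooth s hs).mul (hg.smooth s hs), fun s hs =>
    (hf.periodic s hs).map₂ (hg.periodic s hs) (fun _ a b => a * b) fun _ _ => rfl,
    fun j hj k a b => ?_⟩
  induction b generalizing f g with
  | zero =>
    induction a generalizing f g with
    | zero =>
      obtain ⟨M, hM⟩ := hf.bound j hj k 0 0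
      obtain ⟨N, hN⟩ := hg.bound 0 rfl 0 0 0
      refine ⟨M * N, fun s hs x y => ?_⟩
      have h1 := hM s hs x y
      have h2 := hN s hs x y
      simp only [pow_zero, one_mul, Function.iterate_zero, id_eq, Pi.mul_apply, norm_mul]
        at h1 h2 ⊢
      rw [← mul_assoc]
      exact mul_le_mul h1 h2 (norm_nonneg _) (hM s hs).nonneg
    | succ a ih =>
      obtain ⟨M, hM⟩ := ih hf.dx hg
      obtain ⟨N, hN⟩ := ih hf hg.dx
      refine ⟨M + N, fun s hs x y => ?_⟩
      have := (hM s hs).add ((hf.smooth s hs).dx.mul (hg.smooth s hs))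
        ((hf.smooth s hs).mul (hg.smooth s hs).dx) (hN s hs) x y
      rwa [← dx_mul (hf.smooth s hs) (hg.smooth s hs)] at this
  | succ b ih =>
    obtain ⟨M, hM⟩ := ih hf.dy hg
    obtain ⟨N, hN⟩ := ih hf hg.dy
    refine ⟨M + N, fun s hs x y => ?_⟩
    have := (hM s hs).add ((hf.smooth s hs).dy.mul (hg.smooth s hs))
      ((hf.smooth s hs).mul (hg.smooth s hs).dy) (hN s hs) x y
    rwa [← dy_mul (hf.smooth s hs) (hg.smooth s hs)] at this

/-- Multiplication by x costs one power of |x|, hence the demand for all powers. -/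
theorem mulX (hf : Tame C univ K f) : Tame C univ K (fun s => mulX (f s)) := by
  refine ⟨fun s hs => (hf.smooth s hs).mulX, fun s hs =>
    (hf.periodic s hs).map₂ (hf.periodic s hs) (fun x a _ => x * a) fun _ _ => rfl,
    fun j hj k a b => ?_⟩
  induction b generalizing f with
  | zero =>
    induction a generalizing f with
    | zero =>
      obtain ⟨M, hM⟩ := hf.bound (j + 1) trivial k 0 0
      refine ⟨M, fun s hs x y => ?_⟩
      have h1 := hM s hs x y
      simp only [Function.iterate_zero, id_eq, NLSHierarchy.mulX, norm_mul, Complex.norm_real,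
        Real.norm_eq_abs, pow_succ] at h1 ⊢
      linarith
    | succ a ih =>
      obtain ⟨M, hM⟩ := ih hf.dx
      obtain ⟨N, hN⟩ := hf.bound j hj k a 0
      refine ⟨N + M, fun s hs x y => ?_⟩
      have := (hN s hs).add (hf.smooth s hs) (hf.smooth s hs).dx.mulX (hM s hs) x y
      rwa [← dx_mulX (hf.smooth s hs)] at this
  | succ b ih =>
    obtain ⟨M, hM⟩ := ih hf.dy
    refine ⟨M, fun s hs x y => ?_⟩
    have := hM s hs x y
    rwa [← dy_mulX] at this

theorem rePair (hf : Tame C J K f) (hg : Tame C J K g) (h0 : 0 ∈ J) :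
    Tame C J K (fun s => rePair (f s) (g s)) := by
  simp only [rePair_eq]
  have h : ({0} : Set ℕ) ⊆ J := singleton_subset_iff.2 h0
  exact ((hf.mul (hg.conjField.mono h Subset.rfl)).add
    (hf.conjField.mul (hg.mono h Subset.rfl))).smul _

end Tame

/-! ### Differentiation of tame families in the parameter. -/

namespace C1Tame

theorem mono {J' : Set ℕ} {K' : Set ℝ} (hJ : J' ⊆ J) (hK : K' ⊆ K) (h : C1Tame C J K f f') :
    C1Tame C J' K' f f' :=
  ⟨h.tame.mono hJ hK, h.tame'.mono hJ hK, fun s hs => h.deriv s (hK hs)⟩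

theorem hasDerivAt (h : C1Tame C J K f f') {s : ℝ} (hs : s ∈ K) (x y : ℝ) :
    HasDerivAt (fun σ => f σ x y) (f' s x y) s :=
  h.deriv s hs 0 0 x y

theorem add (hK : IsOpen K) (hf : C1Tame C J K f f') (hg : C1Tame C J K g g') :
    C1Tame C J K (fun s => f s + g s) (fun s => f' s + g' s) := by
  refine ⟨hf.tame.add hg.tame, hf.tame'.add hg.tame', fun s hs a b x y => ?_⟩
  rw [dxy_add a b (hf.tame'.smooth s hs) (hg.tame'.smooth s hs)]
  refine ((hf.deriv s hs a b x y).add (hg.deriv s hs a b x y)).congr_of_eventuallyEq ?_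
  filter_upwards [hK.mem_nhds hs] with σ hσ
  rw [dxy_add a b (hf.tame.smooth σ hσ) (hg.tame.smooth σ hσ)]
  rfl

theorem smul (c : ℂ) (hf : C1Tame C J K f f') :
    C1Tame C J K (fun s => c • f s) (fun s => c • f' s) := by
  refine ⟨hf.tame.smul c, hf.tame'.smul c, fun s hs a b x y => ?_⟩
  simp only [dxy_smul]
  exact (hf.deriv s hs a b x y).const_mul c

theorem conjField (hK : IsOpen K) (hf : C1Tame C J K f f') :
    C1Tame C J K (fun s => conjField (f s)) (fun s => conjField (f' s)) := by
  refine ⟨hf.tame.conjField, hf.tame'.conjField, fun s hs a b x y => ?_⟩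
  rw [dxy_conjField a b (hf.tame'.smooth s hs)]
  refine (Complex.conjCLE.hasFDerivAt.comp_hasDerivAt s
    (hf.deriv s hs a b x y)).congr_of_eventuallyEq ?_
  filter_upwards [hK.mem_nhds hs] with σ hσ
  rw [dxy_conjField a b (hf.tame.smooth σ hσ)]
  rfl

theorem dx (hK : IsOpen K) (hf : C1Tame C J K f f') :
    C1Tame C J K (fun s => dx (f s)) (fun s => dx (f' s)) := by
  refine ⟨hf.tame.dx, hf.tame'.dx, fun s hs a b x y => ?_⟩
  rw [(hf.tame'.smooth s hs).dxy_dx]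
  refine (hf.deriv s hs (a + 1) b x y).congr_of_eventuallyEq ?_
  filter_upwards [hK.mem_nhds hs] with σ hσ
  rw [(hf.tame.smooth σ hσ).dxy_dx]

theorem dy (hf : C1Tame C J K f f') : C1Tame C J K (fun s => dy (f s)) (fun s => dy (f' s)) :=
  ⟨hf.tame.dy, hf.tame'.dy, fun s hs a b x y => hf.deriv s hs a (b + 1) x y⟩

/-- To check parameter differentiability of all space derivatives it is enough to have a class of
families that is stable under `∂_x` and `∂_y` and to check it for the fields themselves. -/
theorem hasDerivAt_dxy_of_closed (hK : IsOpen K) (S : (ℝ → Field2) → (ℝ → Field2) → Prop)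
    (hx : ∀ w w', S w w' → ∃ v v', S v v' ∧
      ∀ s ∈ K, NLSHierarchy.dx (w s) = v s ∧ NLSHierarchy.dx (w' s) = v' s)
    (hy : ∀ w w', S w w' → ∃ v v', S v v' ∧
      ∀ s ∈ K, NLSHierarchy.dy (w s) = v s ∧ NLSHierarchy.dy (w' s) = v' s)
    (h0 : ∀ w w', S w w' → ∀ s ∈ K, ∀ x y, HasDerivAt (fun σ => w σ x y) (w' s x y) s)
    (h : S w w') {s : ℝ} (hs : s ∈ K) (a b : ℕ) (x y : ℝ) :
    HasDerivAt (fun σ => dxy a b (w σ) x y) (dxy a b (w' s) x y) s := by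
  induction b generalizing w w' with
  | zero =>
    induction a generalizing w w' with
    | zero => exact h0 w w' h s hs x y
    | succ a ih =>
      obtain ⟨v, v', hv, e⟩ := hx w w' h
      simp only [dxy_succ_zero]
      rw [(e s hs).2]
      refine (ih hv).congr_of_eventuallyEq ?_
      filter_upwards [hK.mem_nhds hs] with σ hσ
      rw [(e σ hσ).1]
  | succ b ih =>
    obtain ⟨v, v', hv, e⟩ := hy w w' h
    simp only [dxy_succ_right]
    rw [(e s hs).2]
    refine (ih hv).congr_of_eventuallyEq ?_
    filter_upwards [hK.mem_nhds hs] with σ hσ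
    rw [(e σ hσ).1]

theorem mul (hK : IsOpen K) (hf : C1Tame C J K f f') (hg : C1Tame C {0} K g g') :
    C1Tame C J K (fun s => f s * g s) (fun s => f' s * g s + f s * g' s) := by
  refine ⟨hf.tame.mul hg.tame, (hf.tame'.mul hg.tame).add (hf.tame.mul hg.tame'),
    fun s hs a b x y => ?_⟩
  induction b generalizing f g f' g' with
  | zero =>
    induction a generalizing f g f' g' with
    | zero => exact (hf.hasDerivAt hs x y).mul (hg.hasDerivAt hs x y)
    | succ a ih =>
      have h1 := (ih (hf.dx hK) hg).add (ih hf (hg.dx hK))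
      have sf := fun σ hσ => hf.tame.smooth σ hσ
      have sg := fun σ hσ => hg.tame.smooth σ hσ
      have sf' := hf.tame'.smooth s hs
      have sg' := hg.tame'.smooth s hs
      have e : dxy (a + 1) 0 (f' s * g s + f s * g' s)
          = dxy a 0 (NLSHierarchy.dx (f' s) * g s + NLSHierarchy.dx (f s) * g' s)
            + dxy a 0 (f' s * NLSHierarchy.dx (g s) + f s * NLSHierarchy.dx (g' s)) := by
        rw [← dxy_add, dxy_succ_zero, dx_add, dx_mul, dx_mul]
        · congr 1; ring
        all_goals first
          | exact sf s hs | exact sg s hs | exact sf' | exact sg'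
          | exact sf'.mul (sg s hs) | exact (sf s hs).mul sg'
          | exact (sf'.dx.mul (sg s hs)).add ((sf s hs).dx.mul sg')
          | exact (sf'.mul (sg s hs).dx).add ((sf s hs).mul sg'.dx)
      rw [e]
      refine h1.congr_of_eventuallyEq ?_
      filter_upwards [hK.mem_nhds hs] with σ hσ
      rw [dxy_succ_zero, dx_mul (sf σ hσ) (sg σ hσ),
        dxy_add a 0 ((sf σ hσ).dx.mul (sg σ hσ)) ((sf σ hσ).mul (sg σ hσ).dx)]
      rfl
  | succ b ih =>
    have h1 := (ih hf.dy hg).add (ih hf hg.dy)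
    have sf := fun σ hσ => hf.tame.smooth σ hσ
    have sg := fun σ hσ => hg.tame.smooth σ hσ
    have sf' := hf.tame'.smooth s hs
    have sg' := hg.tame'.smooth s hs
    have e : dxy a (b + 1) (f' s * g s + f s * g' s)
        = dxy a b (NLSHierarchy.dy (f' s) * g s + NLSHierarchy.dy (f s) * g' s)
          + dxy a b (f' s * NLSHierarchy.dy (g s) + f s * NLSHierarchy.dy (g' s)) := by
      rw [← dxy_add, dxy_succ_right, dy_add, dy_mul, dy_mul]
      · congr 1; ring
      all_goals first
        | exact sf s hs | exact sg s hs | exact sf' | exact sg'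
        | exact sf'.mul (sg s hs) | exact (sf s hs).mul sg'
        | exact (sf'.dy.mul (sg s hs)).add ((sf s hs).dy.mul sg')
        | exact (sf'.mul (sg s hs).dy).add ((sf s hs).mul sg'.dy)
    rw [e]
    refine h1.congr_of_eventuallyEq ?_
    filter_upwards [hK.mem_nhds hs] with σ hσ
    rw [dxy_succ_right, dy_mul (sf σ hσ) (sg σ hσ),
      dxy_add a b ((sf σ hσ).dy.mul (sg σ hσ)) ((sf σ hσ).mul (sg σ hσ).dy)]
    rfl

theorem mulX (hK : IsOpen K) (hf : C1Tame C univ K f f') :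
    C1Tame C univ K (fun s => mulX (f s)) (fun s => mulX (f' s)) := by
  refine ⟨hf.tame.mulX, hf.tame'.mulX, fun s hs a b x y => ?_⟩
  induction b generalizing f f' with
  | zero =>
    induction a generalizing f f' with
    | zero => exact (hf.hasDerivAt hs x y).const_mul _
    | succ a ih =>
      have h1 := (hf.deriv s hs a 0 x y).add (ih (hf.dx hK))
      have sf' := hf.tame'.smooth s hs
      have e : dxy (a + 1) 0 (NLSHierarchy.mulX (f' s))
          = dxy a 0 (f' s) + dxy a 0 (NLSHierarchy.mulX (NLSHierarchy.dx (f' s))) := by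
        rw [← dxy_add a 0 sf' sf'.dx.mulX, dxy_succ_zero, dx_mulX sf']
      rw [e]
      refine h1.congr_of_eventuallyEq ?_
      filter_upwards [hK.mem_nhds hs] with σ hσ
      have sf := hf.tame.smooth σ hσ
      rw [dxy_succ_zero, dx_mulX sf, dxy_add a 0 sf sf.dx.mulX]
      rfl
  | succ b ih =>
    have h1 := ih hf.dy
    simp only [dxy_succ_right, dy_mulX]
    exact h1

theorem rePair (hK : IsOpen K) (hf : C1Tame C univ K f f') (hg : C1Tame C univ K g g') :
    C1Tame C univ K (fun s => rePair (f s) (g s))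
      (fun s => rePair (f' s) (g s) + rePair (f s) (g' s)) := by
  have h : ({0} : Set ℕ) ⊆ univ := subset_univ _
  have := ((hf.mul hK ((hg.conjField hK).mono h Subset.rfl)).add hK
    ((hf.conjField hK).mul hK (hg.mono h Subset.rfl))).smul (1 / 2)
  simp only [rePair_eq]
  convert this using 2 with s
  rw [← smul_add]
  congr 1
  ring

end C1Tame

end

/-! ### The skew-adjoint antiderivative -/

/-- The skew-adjoint antiderivative of a function on the line. -/
def antideriv (f : ℝ → ℂ) (x : ℝ) : ℂ := ((∫ s in Iic x, f s) - ∫ s in Ioi x, f s) / 2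

/-- The skew-adjoint antiderivative `D_x⁻¹` on complex fields. -/
def antiDx (g : Field2) : Field2 := fun x y => antideriv (fun s => g s y) x

section Line

variable {f g : ℝ → ℂ}

/-- Fixing the base point 0 puts the x-dependence in an interval integral, to which the fundamental
theorem of calculus applies. -/
theorem antideriv_eq_add_intervalIntegral (hf : Integrable f) (x : ℝ) :
    antideriv f x = antideriv f 0 + ∫ s in (0 : ℝ)..x, f s := by
  have h1 := intervalIntegral.integral_Iic_sub_Iic (a := 0) (b := x) hf.integrableOn hf.integrableOn
  have h2 := intervalIntegral.integral_Iic_add_Ioi (b := x) hf.integrableOn hf.integrableOn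
  have h3 := intervalIntegral.integral_Iic_add_Ioi (b := 0) hf.integrableOn hf.integrableOn
  rw [← h1, antideriv, antideriv]
  linear_combination (h3 - h2) / 2

theorem hasDerivAt_antideriv (hf : Integrable f) (hc : Continuous f) (x : ℝ) :
    HasDerivAt (antideriv f) (f x) x := by
  have h : antideriv f = fun x => antideriv f 0 + ∫ s in (0 : ℝ)..x, f s :=
    funext (antideriv_eq_add_intervalIntegral hf)
  rw [h]
  exact (intervalIntegral.integral_hasDerivAt_right (hf.intervalIntegrable)
    hc.stronglyMeasurable.stronglyMeasurableAtFilter hc.continuousAt).const_add _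

theorem tendsto_antideriv_atTop (hf : Integrable f) :
    Tendsto (antideriv f) atTop (𝓝 ((∫ s, f s) / 2)) := by
  have h3 := intervalIntegral.integral_Iic_add_Ioi (b := 0) hf.integrableOn hf.integrableOn
  have h4 : (∫ s, f s) / 2 = antideriv f 0 + ∫ s in Ioi (0 : ℝ), f s := by
    rw [← h3, antideriv]; ring
  rw [h4]
  exact ((intervalIntegral_tendsto_integral_Ioi 0 hf.integrableOn tendsto_id).const_add _).congr
    fun x => (antideriv_eq_add_intervalIntegral hf x).symm

theorem tendsto_antideriv_atBot (hf : Integrable f) :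
    Tendsto (antideriv f) atBot (𝓝 (-((∫ s, f s) / 2))) := by
  have h3 := intervalIntegral.integral_Iic_add_Ioi (b := 0) hf.integrableOn hf.integrableOn
  have h4 : -((∫ s, f s) / 2) = antideriv f 0 + -∫ s in Iic (0 : ℝ), f s := by
    rw [← h3, antideriv]; ring
  rw [h4]
  refine ((intervalIntegral_tendsto_integral_Iic 0 hf.integrableOn
    tendsto_id).neg.const_add _).congr fun x => ?_
  rw [antideriv_eq_add_intervalIntegral hf x, intervalIntegral.integral_symm, id_eq, neg_neg]

/-- A function that is integrable together with its derivative tends to zero at both ends, so it is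
already the antiderivative with opposite limits. Thus D_x⁻¹ is also a left inverse of ∂_x on
decaying fields. -/
theorem antideriv_of_hasDerivAt (hf : Integrable f) (hd : ∀ x, HasDerivAt g (f x) x)
    (hg : Integrable g) (x : ℝ) : antideriv f x = g x := by
  have A : Tendsto g atBot (𝓝 0) := tendsto_zero_of_hasDerivAt_of_integrableOn_Iic (a := 0)
    (fun x _ => hd x) hf.integrableOn hg.integrableOn
  have B : Tendsto g atTop (𝓝 0) := tendsto_zero_of_hasDerivAt_of_integrableOn_Ioi (a := 0)
    (fun x _ => hd x) hf.integrableOn hg.integrableOn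
  rw [antideriv, integral_Iic_of_hasDerivAt_of_tendsto' (fun x _ => hd x) hf.integrableOn A,
    integral_Ioi_of_hasDerivAt_of_tendsto' (fun x _ => hd x) hf.integrableOn B]
  ring

theorem antideriv_add (hf : Integrable f) (hg : Integrable g) (x : ℝ) :
    antideriv (fun s => f s + g s) x = antideriv f x + antideriv g x := by
  simp only [antideriv]
  rw [integral_add hf.integrableOn hg.integrableOn, integral_add hf.integrableOn hg.integrableOn]
  ring

theorem antideriv_const_mul (c : ℂ) (f : ℝ → ℂ) (x : ℝ) :
    antideriv (fun s => c * f s) x = c * antideriv f x := by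
  simp only [antideriv, integral_const_mul]
  ring

theorem norm_antideriv_le (hf : Integrable f) (x : ℝ) : ‖antideriv f x‖ ≤ ∫ s, ‖f s‖ := by
  have h1 : ‖∫ s in Iic x, f s‖ ≤ ∫ s, ‖f s‖ := (norm_integral_le_integral_norm _).trans
    (setIntegral_le_integral hf.norm (Eventually.of_forall fun _ => norm_nonneg _))
  have h2 : ‖∫ s in Ioi x, f s‖ ≤ ∫ s, ‖f s‖ := (norm_integral_le_integral_norm _).trans
    (setIntegral_le_integral hf.norm (Eventually.of_forall fun _ => norm_nonneg _))
  rw [antideriv, norm_div, Complex.norm_ofNat]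
  linarith [norm_sub_le (∫ s in Iic x, f s) (∫ s in Ioi x, f s)]

/-- Skew-adjointness of the antiderivative. -/
theorem integral_mul_antideriv_add (hf : Integrable f) (hg : Integrable g) (cf : Continuous f)
    (cg : Continuous g) : ∫ x, (f x * antideriv g x + g x * antideriv f x) = 0 := by
  have bdd : ∀ {h : ℝ → ℂ}, Integrable h → Continuous h → ∀ {k : ℝ → ℂ}, Integrable k →
      Integrable (fun x => k x * antideriv h x) := by
    intro h hh ch k hk
    refine hk.mul_bdd (c := ∫ s, ‖h s‖) ?_ (Eventually.of_forall fun x => norm_antideriv_le hh x)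
    have : Continuous (antideriv h) :=
      continuous_iff_continuousAt.2 fun x => (hasDerivAt_antideriv hh ch x).continuousAt
    exact this.aestronglyMeasurable
  have hd : ∀ x, HasDerivAt (fun x => antideriv f x * antideriv g x)
      (f x * antideriv g x + g x * antideriv f x) x := by
    intro x
    have := (hasDerivAt_antideriv hf cf x).mul (hasDerivAt_antideriv hg cg x)
    rwa [mul_comm (antideriv f x) (g x)] at this
  -- Each antiderivative has opposite limits at ±∞, so the product has equal limits and the boundary
  -- terms cancel.
  rw [integral_of_hasDerivAt_of_tendsto hd ((bdd hg cg hf).add (bdd hf cf hg))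
    ((tendsto_antideriv_atBot hf).mul (tendsto_antideriv_atBot hg))
    ((tendsto_antideriv_atTop hf).mul (tendsto_antideriv_atTop hg))]
  ring

theorem integrable_of_norm_le_inv {M : ℝ} (hc : Continuous f)
    (hM : ∀ x, ‖f x‖ ≤ M * (1 + x ^ 2)⁻¹) : Integrable f :=
  (integrable_inv_one_add_sq.const_mul M).mono' hc.aestronglyMeasurable (Eventually.of_forall hM)

/-- Dominated differentiation on each half-line. It serves both for ∂_y of D_x⁻¹, with y as the
parameter, and for derivatives along families of fields. -/
theorem hasDerivAt_antideriv_param {F F' : ℝ → ℝ → ℂ} {K : Set ℝ} {t M N : ℝ} (hK : K ∈ 𝓝 t)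
    (hc : ∀ s ∈ K, Continuous (F s)) (hc' : ∀ s ∈ K, Continuous (F' s))
    (hM : ∀ s ∈ K, ∀ x, ‖F s x‖ ≤ M * (1 + x ^ 2)⁻¹)
    (hN : ∀ s ∈ K, ∀ x, ‖F' s x‖ ≤ N * (1 + x ^ 2)⁻¹)
    (hd : ∀ s ∈ K, ∀ x, HasDerivAt (fun s => F s x) (F' s x) s) (x : ℝ) :
    HasDerivAt (fun s => antideriv (F s) x) (antideriv (F' t) x) t := by
  have ht : t ∈ K := mem_of_mem_nhds hK
  have key : ∀ A : Set ℝ, HasDerivAt (fun s => ∫ x in A, F s x) (∫ x in A, F' t x) t := fun A =>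
    (hasDerivAt_integral_of_dominated_loc_of_deriv_le (μ := volume.restrict A) hK
      (by filter_upwards [hK] with s hs using (hc s hs).aestronglyMeasurable)
      (integrable_of_norm_le_inv (hc t ht) (hM t ht)).integrableOn
      (hc' t ht).aestronglyMeasurable
      (Eventually.of_forall fun x s hs => hN s hs x)
      (integrable_inv_one_add_sq.const_mul N).integrableOn
      (Eventually.of_forall fun x s hs => hd s hs x)).2
  exact ((key (Iic x)).sub (key (Ioi x))).div_const 2

end Line

/-- A class of fields stable under continuous partial derivatives consists of smooth fields. -/
theorem smoothField_of_closed (S : Field2 → Prop)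
    (hc : ∀ w, S w → Continuous (fun p : ℝ × ℝ => w p.1 p.2))
    (hx : ∀ w, S w → ∃ v, S v ∧ ∀ x y, HasDerivAt (fun s => w s y) (v x y) x)
    (hy : ∀ w, S w → ∃ v, S v ∧ ∀ x y, HasDerivAt (fun s => w x s) (v x y) y)
    {w : Field2} (h : S w) : SmoothField w := by
  have key : ∀ n : ℕ, ∀ w, S w → ContDiff ℝ n (fun p : ℝ × ℝ => w p.1 p.2) := by
    intro n
    induction n with
    | zero => exact fun w hw => contDiff_zero.2 (hc w hw)
    | succ n ih =>
      intro w hw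
      obtain ⟨v, hv, dv⟩ := hx w hw
      obtain ⟨z, hz, dz⟩ := hy w hw
      have L : ContDiff ℝ ∞ (fun c : ℂ => ContinuousLinearMap.toSpanSingleton ℝ c) :=
        (ContinuousLinearMap.toSpanSingletonCLE (𝕜 := ℝ) (E := ℂ)).contDiff
      refine contDiff_succ_iff_hasFDerivAt.2 ⟨fun p =>
        (ContinuousLinearMap.toSpanSingleton ℝ (v p.1 p.2)).coprod
          (ContinuousLinearMap.toSpanSingleton ℝ (z p.1 p.2)), ?_, fun p => ?_⟩
      · have L1 : ContDiff ℝ n (fun p : ℝ × ℝ => ContinuousLinearMap.toSpanSingleton ℝ (v p.1 p.2)) :=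
          (L.of_le (by exact_mod_cast le_top)).comp (ih v hv)
        have L2 : ContDiff ℝ n (fun p : ℝ × ℝ => ContinuousLinearMap.toSpanSingleton ℝ (z p.1 p.2)) :=
          (L.of_le (by exact_mod_cast le_top)).comp (ih z hz)
        have e : ∀ A B : ℝ →L[ℝ] ℂ, A.coprod B = A.comp (ContinuousLinearMap.fst ℝ ℝ ℝ)
            + B.comp (ContinuousLinearMap.snd ℝ ℝ ℝ) := fun A B => by ext <;> simp
        simp only [e]
        exact (L1.clm_comp contDiff_const).add (L2.clm_comp contDiff_const)
      · have L0 := L.continuous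
        exact (hasStrictFDerivAt_uncurry_coprod (𝕜 := ℝ) (u := p) (f := w)
          (f₁ := fun x y => ContinuousLinearMap.toSpanSingleton ℝ (v x y))
          (f₂ := fun x y => ContinuousLinearMap.toSpanSingleton ℝ (z x y))
          (Eventually.of_forall fun q => (dv q.1 q.2).hasFDerivAt)
          (Eventually.of_forall fun q => (dz q.1 q.2).hasFDerivAt)
          (L0.comp (hc v hv)).continuousAt (L0.comp (hc z hz)).continuousAt).hasFDerivAt
  exact contDiff_infty.2 fun n => key n w h

/-! ### The antiderivative acting on tame families. -/

section

variable {C : YDomain} {J : Set ℕ} {K : Set ℝ} {f g f' g' w w' : ℝ → Field2}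

theorem Tame.exists_bound_inv (hf : Tame C univ K f) (k : ℕ) :
    ∃ M, ∀ s ∈ K, ∀ x y, C.yWeight y ^ k * ‖f s x y‖ ≤ M * (1 + x ^ 2)⁻¹ := by
  obtain ⟨M, hM⟩ := hf.bound 0 trivial k 0 0
  obtain ⟨N, hN⟩ := hf.bound 2 trivial k 0 0
  refine ⟨M + N, fun s hs x y => ?_⟩
  have h1 := hM s hs x y
  have h2 := hN s hs x y
  simp only [Function.iterate_zero, id_eq, pow_zero, one_mul, sq_abs] at h1 h2
  rw [← div_eq_mul_inv, le_div_iff₀ (by positivity)]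
  linarith

theorem Tame.exists_bound_inv₀ (hf : Tame C univ K f) :
    ∃ M, ∀ s ∈ K, ∀ x y, ‖f s x y‖ ≤ M * (1 + x ^ 2)⁻¹ := by
  simpa using hf.exists_bound_inv 0

theorem SmoothField.continuous_left {u : Field2} (h : SmoothField u) (y : ℝ) :
    Continuous (fun x => u x y) :=
  h.continuous.comp (f := fun x : ℝ => (x, y)) (by fun_prop)

theorem SmoothField.continuous_right {u : Field2} (h : SmoothField u) (x : ℝ) :
    Continuous (fun y => u x y) :=
  h.continuous.comp (f := fun y : ℝ => (x, y)) (by fun_prop)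

theorem Tame.integrable_left (hf : Tame C univ K f) {s : ℝ} (hs : s ∈ K) (y : ℝ) :
    Integrable (fun x => f s x y) := by
  obtain ⟨M, hM⟩ := hf.exists_bound_inv₀
  exact integrable_of_norm_le_inv ((hf.smooth s hs).continuous_left y) fun x => hM s hs x y

theorem Tame.hasDerivAt_antiDx_x (hf : Tame C univ K f) {s : ℝ} (hs : s ∈ K) (x y : ℝ) :
    HasDerivAt (fun x => antiDx (f s) x y) (f s x y) x :=
  hasDerivAt_antideriv (hf.integrable_left hs y) ((hf.smooth s hs).continuous_left y) x

theorem Tame.hasDerivAt_antiDx_y (hf : Tame C univ K f) {s : ℝ} (hs : s ∈ K) (x y : ℝ) :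
    HasDerivAt (fun y => antiDx (f s) x y) (antiDx (NLSHierarchy.dy (f s)) x y) y := by
  obtain ⟨M, hM⟩ := hf.exists_bound_inv₀
  obtain ⟨N, hN⟩ := hf.dy.exists_bound_inv₀
  have hf0 := hf.smooth s hs
  exact hasDerivAt_antideriv_param (F := fun y x => f s x y)
    (F' := fun y x => NLSHierarchy.dy (f s) x y) (K := univ) univ_mem
    (fun y _ => hf0.continuous_left y) (fun y _ => hf0.dy.continuous_left y)
    (fun y _ x => hM s hs x y) (fun y _ x => hN s hs x y) (fun y _ x => hf0.hasDerivAt_dy x y) x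

theorem Tame.dx_antiDx (hf : Tame C univ K f) {s : ℝ} (hs : s ∈ K) :
    NLSHierarchy.dx (antiDx (f s)) = f s :=
  funext fun x => funext fun y => (hf.hasDerivAt_antiDx_x hs x y).deriv

theorem Tame.dy_antiDx (hf : Tame C univ K f) {s : ℝ} (hs : s ∈ K) :
    NLSHierarchy.dy (antiDx (f s)) = antiDx (NLSHierarchy.dy (f s)) :=
  funext fun x => funext fun y => (hf.hasDerivAt_antiDx_y hs x y).deriv

theorem Tame.antiDx_dx (hf : Tame C univ K f) {s : ℝ} (hs : s ∈ K) :
    antiDx (NLSHierarchy.dx (f s)) = f s :=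
  funext fun x => funext fun y => antideriv_of_hasDerivAt (hf.dx.integrable_left hs y)
    (fun x => (hf.smooth s hs).hasDerivAt_dx x y) (hf.integrable_left hs y) x

theorem Tame.exists_bound_antiDx (hf : Tame C univ K f) (k : ℕ) :
    ∃ M, ∀ s ∈ K, ∀ x y, C.yWeight y ^ k * ‖antiDx (f s) x y‖ ≤ M := by
  obtain ⟨M, hM⟩ := hf.exists_bound_inv k
  refine ⟨∫ x : ℝ, M * (1 + x ^ 2)⁻¹, fun s hs x y => ?_⟩
  have hw : 0 ≤ C.yWeight y ^ k := pow_nonneg (C.yWeight_nonneg y) k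
  have hi := hf.integrable_left hs y
  calc _ ≤ C.yWeight y ^ k * ∫ x, ‖f s x y‖ :=
        mul_le_mul_of_nonneg_left (norm_antideriv_le hi x) hw
    _ = ∫ x, C.yWeight y ^ k * ‖f s x y‖ := (integral_const_mul _ _).symm
    _ ≤ _ := integral_mono (hi.norm.const_mul _) (integrable_inv_one_add_sq.const_mul M)
        fun x => hM s hs x y

/-- The class of smooth fields together with the antiderivatives of decaying ones is stable: ∂_x of
an antiderivative is smooth, and ∂_y of one is another antiderivative. Only joint continuity is left
to check. -/
theorem Tame.smoothField_antiDx (hf : Tame C univ K f) {s : ℝ} (hs : s ∈ K) :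
    SmoothField (antiDx (f s)) := by
  refine smoothField_of_closed (fun w => SmoothField w ∨ ∃ g : ℝ → Field2, Tame C univ K g ∧
    w = antiDx (g s)) ?_ ?_ ?_ (Or.inr ⟨f, hf, rfl⟩)
  · rintro w (hw | ⟨g, hg, rfl⟩)
    · exact hw.continuous
    · obtain ⟨M, hM⟩ := hg.bound 0 trivial 0 0 0
      -- Continuity in y and a Lipschitz bound in x, uniform in y, give joint continuity; the
      -- Lipschitz constant is a bound for the integrand, which is the x-derivative.
      refine continuous_prod_of_continuous_lipschitzWith _ M.toNNReal (fun x =>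
        continuous_iff_continuousAt.2 fun y => (hg.hasDerivAt_antiDx_y hs x y).continuousAt)
        fun y => ?_
      refine lipschitzWith_of_nnnorm_deriv_le
        (fun x => (hg.hasDerivAt_antiDx_x hs x y).differentiableAt) fun x => ?_
      rw [(hg.hasDerivAt_antiDx_x hs x y).deriv]
      refine NNReal.le_toNNReal_of_coe_le ?_
      simpa using hM s hs x y
  · rintro w (hw | ⟨g, hg, rfl⟩)
    · exact ⟨_, Or.inl hw.dx, hw.hasDerivAt_dx⟩
    · exact ⟨_, Or.inl (hg.smooth s hs), hg.hasDerivAt_antiDx_x hs⟩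
  · rintro w (hw | ⟨g, hg, rfl⟩)
    · exact ⟨_, Or.inl hw.dy, hw.hasDerivAt_dy⟩
    · exact ⟨_, Or.inr ⟨_, hg.dy, rfl⟩, hg.hasDerivAt_antiDx_y hs⟩

/-- The limits at x = ±∞ are ±½ ∫ f dx, in general nonzero, so no power of |x| survives; all powers
of the y-weight do. -/
theorem Tame.antiDx (hf : Tame C univ K f) : Tame C {0} K (fun s => antiDx (f s)) := by
  refine ⟨fun s hs => hf.smoothField_antiDx hs, fun s hs => ?_, fun j hj k a b => ?_⟩
  · have := hf.periodic s hs
    cases C with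
    | line => trivial
    | circle L hL =>
      intro x y
      exact congrArg (fun h => antideriv h x) (funext fun s => this s y)
  · obtain rfl : j = 0 := hj
    induction b generalizing f with
    | zero =>
      cases a with
      | zero =>
        obtain ⟨M, hM⟩ := hf.exists_bound_antiDx k
        exact ⟨M, fun s hs x y => by simpa using hM s hs x y⟩
      | succ a =>
        obtain ⟨M, hM⟩ := hf.bound 0 trivial k a 0
        refine ⟨M, fun s hs x y => ?_⟩
        have := hM s hs x y
        rwa [← hf.dx_antiDx hs] at this
    | succ b ih =>
      obtain ⟨M, hM⟩ := ih hf.dy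
      refine ⟨M, fun s hs x y => ?_⟩
      have := hM s hs x y
      rwa [← hf.dy_antiDx hs] at this

/-- The closed-class argument again: ∂_x removes the antiderivative and ∂_y passes through it, so
only the undifferentiated field requires differentiation under the integral. -/
theorem C1Tame.antiDx (hK : IsOpen K) (hf : C1Tame C univ K f f') :
    C1Tame C {0} K (fun s => antiDx (f s)) (fun s => antiDx (f' s)) := by
  refine ⟨hf.tame.antiDx, hf.tame'.antiDx, fun s hs a b x y => ?_⟩
  refine C1Tame.hasDerivAt_dxy_of_closed hK (fun w w' => C1Tame C {0} K w w' ∨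
    ∃ g g', C1Tame C univ K g g' ∧ w = (fun s => NLSHierarchy.antiDx (g s)) ∧
      w' = fun s => NLSHierarchy.antiDx (g' s)) ?_ ?_ ?_ (Or.inr ⟨f, f', hf, rfl, rfl⟩) hs a b x y
  · rintro w w' (h | ⟨g, g', h, rfl, rfl⟩)
    · exact ⟨_, _, Or.inl (h.dx hK), fun s hs => ⟨rfl, rfl⟩⟩
    · exact ⟨_, _, Or.inl (h.mono (subset_univ _) Subset.rfl), fun s hs =>
        ⟨h.tame.dx_antiDx hs, h.tame'.dx_antiDx hs⟩⟩
  · rintro w w' (h | ⟨g, g', h, rfl, rfl⟩)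
    · exact ⟨_, _, Or.inl h.dy, fun s hs => ⟨rfl, rfl⟩⟩
    · exact ⟨_, _, Or.inr ⟨_, _, h.dy, rfl, rfl⟩, fun s hs =>
        ⟨h.tame.dy_antiDx hs, h.tame'.dy_antiDx hs⟩⟩
  · rintro w w' (h | ⟨g, g', h, rfl, rfl⟩) s hs x y
    · exact h.hasDerivAt hs x y
    · obtain ⟨M, hM⟩ := h.tame.exists_bound_inv₀
      obtain ⟨N, hN⟩ := h.tame'.exists_bound_inv₀
      exact hasDerivAt_antideriv_param (F := fun s x => g s x y) (F' := fun s x => g' s x y)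
        (hK.mem_nhds hs) (fun s hs => (h.tame.smooth s hs).continuous_left y)
        (fun s hs => (h.tame'.smooth s hs).continuous_left y)
        (fun s hs x => hM s hs x y) (fun s hs x => hN s hs x y)
        (fun s hs x => h.hasDerivAt hs x y) x

theorem antiDx_smul (c : ℂ) (u : Field2) : antiDx (c • u) = c • antiDx u :=
  funext fun x => funext fun _ => antideriv_const_mul c _ x

theorem Tame.antiDx_add (hf : Tame C univ K f) (hg : Tame C univ K g) {s : ℝ} (hs : s ∈ K) :
    NLSHierarchy.antiDx (f s + g s) = NLSHierarchy.antiDx (f s) + NLSHierarchy.antiDx (g s) :=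
  funext fun x => funext fun y =>
    antideriv_add (hf.integrable_left hs y) (hg.integrable_left hs y) x

end

/-! ### Integrals over the coordinate domain -/

section Line

variable {G : ℝ → ℂ} {M : ℝ}

/-- The antiderivative of a decaying function of zero mean decays. -/
theorem exists_norm_antideriv_le_inv (hc : Continuous G)
    (hM : ∀ x, ‖G x‖ ≤ M * ((1 + x ^ 2) ^ 2)⁻¹) (h0 : ∫ x, G x = 0) :
    ∃ N, ∀ x, ‖antideriv G x‖ ≤ N * (1 + x ^ 2)⁻¹ := by
  have hw : ∀ x, (1 + x ^ 2) * ‖G x‖ ≤ M * (1 + x ^ 2)⁻¹ := fun x => by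
    have hp : 0 < 1 + x ^ 2 := by positivity
    calc (1 + x ^ 2) * ‖G x‖ ≤ (1 + x ^ 2) * (M * ((1 + x ^ 2) ^ 2)⁻¹) :=
          mul_le_mul_of_nonneg_left (hM x) hp.le
      _ = M * (1 + x ^ 2)⁻¹ := by field_simp
  have hwi : Integrable (fun x => (1 + x ^ 2) * ‖G x‖) :=
    (integrable_inv_one_add_sq.const_mul M).mono' (by fun_prop)
      (Eventually.of_forall fun x => by
        rw [Real.norm_of_nonneg (by positivity)]; exact hw x)
  have hG : Integrable G := hwi.mono hc.aestronglyMeasurable (Eventually.of_forall fun x => by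
    rw [Real.norm_of_nonneg (by positivity)]
    nlinarith [norm_nonneg (G x), sq_nonneg x])
  -- On a tail with |s| ≥ |x| the weight 1 + x² may be moved under the integral and replaced by 1 +
  -- s².
  have key : ∀ (A : Set ℝ) (x : ℝ), MeasurableSet A → (∀ s ∈ A, x ^ 2 ≤ s ^ 2) →
      ‖∫ s in A, G s‖ ≤ (∫ s, (1 + s ^ 2) * ‖G s‖) * (1 + x ^ 2)⁻¹ := by
    intro A x hA h
    rw [← div_eq_mul_inv, le_div_iff₀ (by positivity), mul_comm]
    calc (1 + x ^ 2) * ‖∫ s in A, G s‖ ≤ (1 + x ^ 2) * ∫ s in A, ‖G s‖ :=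
          mul_le_mul_of_nonneg_left (norm_integral_le_integral_norm _) (by positivity)
      _ = ∫ s in A, (1 + x ^ 2) * ‖G s‖ := (integral_const_mul _ _).symm
      _ ≤ ∫ s in A, (1 + s ^ 2) * ‖G s‖ :=
          setIntegral_mono_on (hG.norm.const_mul _).integrableOn hwi.integrableOn hA
            fun s hs => mul_le_mul_of_nonneg_right (by linarith [h s hs]) (norm_nonneg _)
      _ ≤ _ := setIntegral_le_integral hwi (Eventually.of_forall fun s => by positivity)
  refine ⟨∫ s, (1 + s ^ 2) * ‖G s‖, fun x => ?_⟩
  have hsum := intervalIntegral.integral_Iic_add_Ioi (b := x) hG.integrableOn hG.integrableOn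
  rw [h0] at hsum
  -- Zero mean turns the antiderivative into the left tail, or equivalently minus the right tail;
  -- the tail lying away from the origin is chosen.
  rcases le_total x 0 with hx | hx
  · have e : antideriv G x = ∫ s in Iic x, G s := by
      rw [antideriv]; linear_combination -hsum / 2
    rw [e]
    exact key _ x measurableSet_Iic fun s hs => by
      have : s ≤ x := hs
      nlinarith
  · have e : antideriv G x = -∫ s in Ioi x, G s := by
      rw [antideriv]; linear_combination hsum / 2
    rw [e, norm_neg]
    exact key _ x measurableSet_Ioi fun s hs => by
      have : x < s := hs
      nlinarith

/-- Integration by parts: with A the antiderivative of G, (x A)' = A + x G. Zero mean gives A = O((1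
+ x²)⁻¹), so A is integrable and x A vanishes at both ends. -/
theorem integrable_antideriv_of_integral_eq_zero (hc : Continuous G)
    (hM : ∀ x, ‖G x‖ ≤ M * ((1 + x ^ 2) ^ 2)⁻¹) (h0 : ∫ x, G x = 0) :
    Integrable G ∧ Integrable (antideriv G) ∧ ∫ x, antideriv G x = -∫ x : ℝ, (x : ℂ) * G x := by
  have hM0 : 0 ≤ M := by
    have := (norm_nonneg _).trans (hM 0)
    simpa using this
  have hi : Integrable G := integrable_of_norm_le_inv (M := M) hc fun x => by
    refine (hM x).trans (mul_le_mul_of_nonneg_left (inv_anti₀ (by positivity) ?_) hM0)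
    nlinarith [sq_nonneg x]
  obtain ⟨N, hN⟩ := exists_norm_antideriv_le_inv hc hM h0
  have hd := hasDerivAt_antideriv hi hc
  have hAc : Continuous (antideriv G) :=
    continuous_iff_continuousAt.2 fun x => (hd x).continuousAt
  have hA : Integrable (antideriv G) := integrable_of_norm_le_inv hAc hN
  have hxG : Integrable (fun x : ℝ => (x : ℂ) * G x) :=
    integrable_of_norm_le_inv (M := M) (by fun_prop) fun x => by
      rw [norm_mul, Complex.norm_real, Real.norm_eq_abs]
      have hp : 0 < 1 + x ^ 2 := by positivity
      have hx : |x| ≤ 1 + x ^ 2 := by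
        rw [← sq_abs]; nlinarith [sq_nonneg (|x| - 1), abs_nonneg x]
      calc |x| * ‖G x‖ ≤ (1 + x ^ 2) * (M * ((1 + x ^ 2) ^ 2)⁻¹) :=
            mul_le_mul hx (hM x) (norm_nonneg _) hp.le
        _ = M * (1 + x ^ 2)⁻¹ := by field_simp
  refine ⟨hi, hA, ?_⟩
  have hN0 : 0 ≤ N := by
    have := (norm_nonneg _).trans (hN 0)
    simpa using this
  have hbd : ∀ x : ℝ, ‖(x : ℂ) * antideriv G x‖ ≤ N * ‖x⁻¹‖ := fun x => by
    rw [norm_mul, Complex.norm_real, norm_inv]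
    rcases eq_or_ne x 0 with rfl | hx
    · simp
    · have hx' : 0 < ‖x‖ := norm_pos_iff.2 hx
      calc ‖x‖ * ‖antideriv G x‖ ≤ ‖x‖ * (N * (1 + x ^ 2)⁻¹) :=
            mul_le_mul_of_nonneg_left (hN x) hx'.le
        _ ≤ ‖x‖ * (N * (‖x‖ ^ 2)⁻¹) := by
            refine mul_le_mul_of_nonneg_left (mul_le_mul_of_nonneg_left
              (inv_anti₀ (by positivity) ?_) hN0) hx'.le
            rw [Real.norm_eq_abs, sq_abs]; linarith
        _ = N * ‖x‖⁻¹ := by field_simp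
  have top : Tendsto (fun x : ℝ => (x : ℂ) * antideriv G x) atTop (𝓝 0) :=
    squeeze_zero_norm hbd (by simpa using (tendsto_inv_atTop_zero (𝕜 := ℝ)).norm.const_mul N)
  have bot : Tendsto (fun x : ℝ => (x : ℂ) * antideriv G x) atBot (𝓝 0) :=
    squeeze_zero_norm hbd (by simpa using (tendsto_inv_atBot_zero (𝕜 := ℝ)).norm.const_mul N)
  have hd' : ∀ x : ℝ, HasDerivAt (fun x : ℝ => (x : ℂ) * antideriv G x)
      (antideriv G x + (x : ℂ) * G x) x := fun x => by
    have h1 : HasDerivAt (fun s : ℝ => (s : ℂ)) 1 x := Complex.ofRealCLM.hasDerivAt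
    have := h1.mul (hd x)
    rw [one_mul] at this
    exact this
  have := integral_of_hasDerivAt_of_tendsto hd' (hA.add hxG) bot top
  rw [integral_add hA hxG] at this
  linear_combination this

end Line

/-- Lebesgue measure on a set of representatives of the coordinate domain. -/
abbrev YDomain.yMeasure (C : YDomain) : Measure ℝ := volume.restrict C.ySet

theorem YDomain.integrable_yWeight (C : YDomain) :
    Integrable (fun y => (1 + C.yWeight y ^ 2)⁻¹) C.yMeasure := by
  cases C with
  | line => simpa [YDomain.yMeasure, YDomain.ySet, YDomain.yWeight] using integrable_inv_one_add_sq
  | circle L hL =>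
    have : IsFiniteMeasure (YDomain.circle L hL).yMeasure := by
      constructor
      simp [YDomain.yMeasure, YDomain.ySet]
    exact integrable_const (μ := (YDomain.circle L hL).yMeasure) ((1 + (1 : ℝ) ^ 2)⁻¹)

/-! ### Fubini, integration by parts and differentiation under the double integral. -/

section

variable {C : YDomain} {K : Set ℝ} {f g f' g' : ℝ → Field2} {u v w : Field2}

theorem Admissible.tame (h : Admissible C u) (K : Set ℝ) : Tame C univ K (fun _ => u) :=
  ⟨fun _ _ => h.smooth, fun _ _ => h.periodic, fun j _ k a b =>
    (h.decay j k a b).imp fun _ hM _ _ => hM⟩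

theorem Tame.admissible (h : Tame C univ K f) {s : ℝ} (hs : s ∈ K) : Admissible C (f s) :=
  ⟨h.smooth s hs, h.periodic s hs, fun j k a b =>
    (h.bound j trivial k a b).imp fun _ hM => hM s hs⟩

/-- The x-factor carries one power more than integrability needs: `exists_norm_antideriv_le_inv`
requires the y-integral to decay like (1 + x²)⁻² for its antiderivative to be integrable. -/
theorem Tame.exists_bound_prod (hf : Tame C univ K f) :
    ∃ M, 0 ≤ M ∧ ∀ s ∈ K, ∀ x y,
      ‖f s x y‖ ≤ M * (((1 + x ^ 2) ^ 2)⁻¹ * (1 + C.yWeight y ^ 2)⁻¹) := by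
  obtain ⟨M1, h1⟩ := hf.bound 0 trivial 0 0 0
  obtain ⟨M2, h2⟩ := hf.bound 0 trivial 2 0 0
  obtain ⟨M3, h3⟩ := hf.bound 4 trivial 0 0 0
  obtain ⟨M4, h4⟩ := hf.bound 4 trivial 2 0 0
  -- The factor 2 comes from (1 + x²)² ≤ 2 (1 + x⁴); the four bounds are the terms of (1 + x⁴)(1 +
  -- w(y)²). The maximum with 0 secures nonnegativity even when K is empty.
  refine ⟨max 0 (2 * (M1 + M2 + M3 + M4)), le_max_left _ _, fun s hs x y => ?_⟩
  have e1 := h1 s hs x y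
  have e2 := h2 s hs x y
  have e3 := h3 s hs x y
  have e4 := h4 s hs x y
  have e : |x| ^ 4 = x ^ 4 := by rw [← abs_pow, abs_of_nonneg (by positivity)]
  simp only [Function.iterate_zero, id_eq, pow_zero, one_mul, mul_one, e] at e1 e2 e3 e4
  rw [← mul_inv, ← div_eq_mul_inv, le_div_iff₀ (by positivity)]
  refine le_trans ?_ (le_max_right _ _)
  have hx : (1 + x ^ 2) ^ 2 ≤ 2 * (1 + x ^ 4) := by nlinarith [sq_nonneg (x ^ 2 - 1)]
  calc ‖f s x y‖ * ((1 + x ^ 2) ^ 2 * (1 + C.yWeight y ^ 2))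
      ≤ ‖f s x y‖ * (2 * (1 + x ^ 4) * (1 + C.yWeight y ^ 2)) := by gcongr
    _ ≤ _ := by nlinarith

theorem Admissible.integrable (h : Admissible C u) :
    Integrable (fun p : ℝ × ℝ => u p.1 p.2) (volume.prod C.yMeasure) := by
  obtain ⟨M, h0, hM⟩ := (h.tame univ).exists_bound_prod
  refine ((integrable_inv_one_add_sq.mul_prod C.integrable_yWeight).const_mul M).mono'
    (SmoothField.continuous h.smooth).aestronglyMeasurable (Eventually.of_forall fun p => ?_)
  refine (hM 0 trivial p.1 p.2).trans ?_
  have : ((1 + p.1 ^ 2) ^ 2)⁻¹ ≤ (1 + p.1 ^ 2)⁻¹ :=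
    inv_anti₀ (by positivity) (by nlinarith [sq_nonneg p.1])
  gcongr

theorem Admissible.integral_eq (h : Admissible C u) :
    C.integral u = ∫ p : ℝ × ℝ, u p.1 p.2 ∂(volume.prod C.yMeasure) :=
  (integral_prod _ h.integrable).symm

theorem Admissible.integral_swap (h : Admissible C u) :
    C.integral u = ∫ y in C.ySet, ∫ x, u x y :=
  integral_integral_swap h.integrable

theorem Admissible.integral_add (hu : Admissible C u) (hv : Admissible C v) :
    C.integral (u + v) = C.integral u + C.integral v := by
  have huv : Admissible C (u + v) := ((hu.tame univ).add (hv.tame univ)).admissible (mem_univ 0)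
  rw [hu.integral_eq, hv.integral_eq, huv.integral_eq]
  exact MeasureTheory.integral_add hu.integrable hv.integrable

theorem YDomain.integral_smul (C : YDomain) (c : ℂ) (u : Field2) :
    C.integral (c • u) = c * C.integral u := by
  simp [YDomain.integral, integral_const_mul]

theorem YDomain.integral_ofReal (C : YDomain) (f : ℝ → ℝ → ℝ) :
    C.integral (fun x y => (f x y : ℂ)) = ((C.integral f : ℝ) : ℂ) := by
  simp only [YDomain.integral]
  refine Eq.trans (integral_congr_ae (Eventually.of_forall fun x => ?_))
    (_root_.integral_ofReal (𝕜 := ℂ))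
  exact _root_.integral_ofReal (𝕜 := ℂ)

theorem Admissible.integral_dx (h : Admissible C u) : C.integral (dx u) = 0 := by
  have hd : Admissible C (dx u) := (h.tame univ).dx.admissible (mem_univ 0)
  rw [hd.integral_swap]
  refine (integral_congr_ae (Eventually.of_forall fun y => ?_)).trans (integral_zero _ _)
  exact integral_eq_zero_of_hasDerivAt_of_integrable
    (fun x => SmoothField.hasDerivAt_dx h.smooth x y)
    ((h.tame univ).dx.integrable_left (mem_univ 0) y)
    ((h.tame univ).integrable_left (mem_univ 0) y)

theorem Admissible.integrableOn_right (h : Admissible C u) (x : ℝ) :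
    IntegrableOn (u x) C.ySet := by
  obtain ⟨M, h0, hM⟩ := (h.tame univ).exists_bound_prod
  refine (C.integrable_yWeight.const_mul (M * ((1 + x ^ 2) ^ 2)⁻¹)).mono'
    (SmoothField.continuous_right h.smooth x).aestronglyMeasurable
    (Eventually.of_forall fun y => ?_)
  rw [mul_assoc]
  exact hM 0 trivial x y

theorem Admissible.integral_dy (h : Admissible C u) : C.integral (dy u) = 0 := by
  refine (integral_congr_ae (Eventually.of_forall fun x => ?_)).trans (integral_zero _ _)
  have hi := Admissible.integrableOn_right ((h.tame univ).dy.admissible (mem_univ 0)) x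
  have hi' := h.integrableOn_right x
  have hd := SmoothField.hasDerivAt_dy h.smooth x
  have hp := h.periodic
  cases C with
  | line =>
    simp only [YDomain.ySet, Measure.restrict_univ, integrableOn_univ] at hi hi' ⊢
    exact integral_eq_zero_of_hasDerivAt_of_integrable hd hi hi'
  | circle L hL =>
    change ∫ y in Ioc 0 L, dy u x y = 0
    rw [← intervalIntegral.integral_of_le hL.le,
      intervalIntegral.integral_eq_sub_of_hasDerivAt (f := u x) (fun y _ => hd y)
        ((intervalIntegrable_iff_integrableOn_Ioc_of_le hL.le).2 hi)]
    have := hp x 0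
    rw [zero_add] at this
    rw [this, sub_self]

/-- Skew-adjointness of `D_x⁻¹`. -/
theorem Admissible.integral_mul_antiDx (hu : Admissible C u) (hv : Admissible C v) :
    C.integral (u * antiDx v) = -C.integral (v * antiDx u) := by
  have h1 : Admissible C (u * antiDx v) :=
    ((hu.tame univ).mul (hv.tame univ).antiDx).admissible (mem_univ 0)
  have h2 : Admissible C (v * antiDx u) :=
    ((hv.tame univ).mul (hu.tame univ).antiDx).admissible (mem_univ 0)
  rw [eq_neg_iff_add_eq_zero, ← h1.integral_add h2]
  have h3 : Admissible C (u * antiDx v + v * antiDx u) :=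
    ((h1.tame univ).add (h2.tame univ)).admissible (mem_univ 0)
  rw [h3.integral_swap]
  refine (integral_congr_ae (Eventually.of_forall fun y => ?_)).trans (integral_zero _ _)
  exact integral_mul_antideriv_add ((hu.tame univ).integrable_left (mem_univ 0) y)
    ((hv.tame univ).integrable_left (mem_univ 0) y) (SmoothField.continuous_left hu.smooth y)
    (SmoothField.continuous_left hv.smooth y)

/-- Differentiation under the integral over the coordinate domain. -/
theorem C1Tame.hasDerivAt_integral (hK : IsOpen K) (h : C1Tame C univ K f f') {s : ℝ}
    (hs : s ∈ K) : HasDerivAt (fun σ => C.integral (f σ)) (C.integral (f' s)) s := by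
  obtain ⟨M, h0, hM⟩ := h.tame'.exists_bound_prod
  rw [(h.tame'.admissible hs).integral_eq]
  have key := (hasDerivAt_integral_of_dominated_loc_of_deriv_le (μ := volume.prod C.yMeasure)
    (F := fun σ (p : ℝ × ℝ) => f σ p.1 p.2) (F' := fun σ (p : ℝ × ℝ) => f' σ p.1 p.2)
    (hK.mem_nhds hs)
    (by filter_upwards [hK.mem_nhds hs] with σ hσ using
      (h.tame.smooth σ hσ).continuous.aestronglyMeasurable)
    (h.tame.admissible hs).integrable (h.tame'.smooth s hs).continuous.aestronglyMeasurable
    (bound := fun p => M * ((1 + p.1 ^ 2)⁻¹ * (1 + C.yWeight p.2 ^ 2)⁻¹))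
    (Eventually.of_forall fun p σ hσ => (hM σ hσ p.1 p.2).trans ?_)
    ((integrable_inv_one_add_sq.mul_prod C.integrable_yWeight).const_mul M)
    (Eventually.of_forall fun p σ hσ => h.hasDerivAt hσ p.1 p.2)).2
  · refine key.congr_of_eventuallyEq ?_
    filter_upwards [hK.mem_nhds hs] with σ hσ using (h.tame.admissible hσ).integral_eq
  · have : ((1 + p.1 ^ 2) ^ 2)⁻¹ ≤ (1 + p.1 ^ 2)⁻¹ :=
      inv_anti₀ (by positivity) (by nlinarith [sq_nonneg p.1])
    gcongr

/-- Fubini on each half-strip. This is where the order of integration matters: after the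
y-integration, D_x⁻¹ acts on a function of x alone, and only the mean of that function has to
vanish. -/
theorem Admissible.integral_antiDx_right (h : Admissible C u) (x : ℝ) :
    ∫ y in C.ySet, antiDx u x y = antideriv (fun s => ∫ y in C.ySet, u s y) x := by
  have hA : ∀ A : Set ℝ,
      Integrable (fun p : ℝ × ℝ => u p.1 p.2) ((volume.restrict A).prod C.yMeasure) := by
    intro A
    have : (volume.restrict A).prod C.yMeasure = (volume.prod C.yMeasure).restrict (A ×ˢ univ) := by
      rw [← Measure.prod_restrict, Measure.restrict_univ]
    rw [this]
    exact h.integrable.restrict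
  have h1 := hA (Iic x)
  have h2 := hA (Ioi x)
  simp only [antiDx, antideriv]
  rw [integral_div, integral_sub h1.integral_prod_right h2.integral_prod_right]
  rw [integral_integral_swap (f := fun y s => u s y) h1.swap,
    integral_integral_swap (f := fun y s => u s y) h2.swap]

theorem Admissible.exists_bound_integral_right (h : Admissible C u) :
    Continuous (fun x => ∫ y in C.ySet, u x y) ∧
      ∃ M, ∀ x, ‖∫ y in C.ySet, u x y‖ ≤ M * ((1 + x ^ 2) ^ 2)⁻¹ := by
  obtain ⟨M, h0, hM⟩ := (h.tame univ).exists_bound_prod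
  constructor
  · refine continuous_of_dominated (bound := fun y => M * (1 + C.yWeight y ^ 2)⁻¹)
      (fun x => (SmoothField.continuous_right h.smooth x).aestronglyMeasurable)
      (fun x => Eventually.of_forall fun y => (hM 0 trivial x y).trans ?_)
      (C.integrable_yWeight.const_mul M)
      (Eventually.of_forall fun y => SmoothField.continuous_left h.smooth y)
    have h1 : ((1 + x ^ 2) ^ 2)⁻¹ ≤ 1 := inv_le_one_of_one_le₀ (by nlinarith [sq_nonneg x])
    have h2 : 0 ≤ (1 + C.yWeight y ^ 2)⁻¹ := by positivity
    exact mul_le_mul_of_nonneg_left (mul_le_of_le_one_left h2 h1) h0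
  · refine ⟨M * ∫ y in C.ySet, (1 + C.yWeight y ^ 2)⁻¹, fun x => ?_⟩
    calc _ ≤ ∫ y in C.ySet, M * ((1 + x ^ 2) ^ 2)⁻¹ * (1 + C.yWeight y ^ 2)⁻¹ :=
          norm_integral_le_of_norm_le (C.integrable_yWeight.const_mul _)
            (Eventually.of_forall fun y => by rw [mul_assoc]; exact hM 0 trivial x y)
      _ = _ := by rw [integral_const_mul]; ring

/-- The integral of `D_x⁻¹ u` for a field `u` of total integral zero. -/
theorem Admissible.integral_antiDx (h : Admissible C u) (h0 : C.integral u = 0) :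
    (∀ x, IntegrableOn (antiDx u x) C.ySet) ∧
      Integrable (fun x => ∫ y in C.ySet, antiDx u x y) ∧
      C.integral (antiDx u) = -C.integral (mulX u) := by
  obtain ⟨hc, M, hM⟩ := h.exists_bound_integral_right
  obtain ⟨-, h2, h3⟩ := integrable_antideriv_of_integral_eq_zero hc hM h0
  have e : (fun x => ∫ y in C.ySet, antiDx u x y)
      = antideriv (fun s => ∫ y in C.ySet, u s y) := funext h.integral_antiDx_right
  refine ⟨fun x => ?_, ?_, ?_⟩
  · obtain ⟨M1, h1⟩ := (h.tame univ).exists_bound_antiDx 0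
    obtain ⟨M2, h2⟩ := (h.tame univ).exists_bound_antiDx 2
    refine (C.integrable_yWeight.const_mul (M1 + M2)).mono'
      (((h.tame univ).smoothField_antiDx (mem_univ 0)).continuous_right x).aestronglyMeasurable
      (Eventually.of_forall fun y => ?_)
    have e1 := h1 0 trivial x y
    have e2 := h2 0 trivial x y
    rw [← div_eq_mul_inv, le_div_iff₀ (by positivity)]
    rw [pow_zero, one_mul] at e1
    linarith
  · rw [e]; exact h2
  · rw [YDomain.integral, e, h3, YDomain.integral]
    congr 1
    refine integral_congr_ae (Eventually.of_forall fun x => ?_)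
    exact (integral_const_mul _ _).symm

end

/-! ### The recursion operator and its linearisation -/

/-- The recursion operator `𝓡 f = i (f_x + u D_x⁻¹ Re (u f̄))`. -/
def recOp (u f : Field2) : Field2 := Complex.I • (dx f + u * antiDx (rePair u f))

/-- The derivative of `u ↦ 𝓡 f` in the direction `h`. -/
def recOpDeriv (u h f : Field2) : Field2 :=
  Complex.I • (h * antiDx (rePair u f) + u * antiDx (rePair h f))

/-- The root symmetries `i u` (phase rotation) and `-u_y` (transverse translation). -/
def baseField : Bool → Field2 → Field2
  | false, u => Complex.I • u
  | true, u => (-1 : ℂ) • dy u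

/-- The two hierarchies of vector fields `𝓡ᵐ(i u)` and `𝓡ᵐ(-u_y)`. -/
def hierField (b : Bool) : ℕ → Field2 → Field2
  | 0, u => baseField b u
  | m + 1, u => recOp u (hierField b m u)

/-- The derivative of `hierField b m` at `u` in the direction `h`. -/
def hierDeriv (b : Bool) : ℕ → Field2 → Field2 → Field2
  | 0, _, h => baseField b h
  | m + 1, u, h => recOpDeriv u h (hierField b m u) + recOp u (hierDeriv b m u h)

section

variable {C : YDomain} {u v w f g h X : Field2}

theorem rePair_comm (u f : Field2) : rePair u f = rePair f u := by
  rw [rePair_eq, rePair_eq]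
  congr 1
  ring

theorem rePair_apply (u f : Field2) (x y : ℝ) :
    rePair u f x y = (((u x y).re * (f x y).re + (u x y).im * (f x y).im : ℝ) : ℂ) := by
  simp [rePair]

/-- The nonlocal term is real, so it commutes with taking real parts and with conjugation. -/
theorem antiDx_rePair_apply (u f : Field2) (x y : ℝ) :
    antiDx (rePair u f) x y = (dxInv (fun x y => (u x y * conj (f x y)).re) x y : ℂ) := by
  simp only [antiDx, antideriv, dxInv, rePair]
  push_cast
  congr 2 <;> exact _root_.integral_ofReal (𝕜 := ℂ)

theorem rePair_add_left (u v f : Field2) : rePair (u + v) f = rePair u f + rePair v f := by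
  funext x y
  simp only [rePair_apply, Pi.add_apply, Complex.add_re, Complex.add_im]
  push_cast; ring

theorem rePair_add_right (u f g : Field2) : rePair u (f + g) = rePair u f + rePair u g := by
  rw [rePair_comm, rePair_add_left, rePair_comm f, rePair_comm g]

namespace Admissible

theorem smoothField (hu : Admissible C u) : SmoothField u := hu.smooth

theorem add (hf : Admissible C f) (hg : Admissible C g) : Admissible C (f + g) :=
  ((hf.tame univ).add (hg.tame univ)).admissible (mem_univ 0)

theorem smul (c : ℂ) (hf : Admissible C f) : Admissible C (c • f) :=
  ((hf.tame univ).smul c).admissible (mem_univ 0)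

theorem dx (hf : Admissible C f) : Admissible C (dx f) :=
  (hf.tame univ).dx.admissible (mem_univ 0)

theorem dy (hf : Admissible C f) : Admissible C (dy f) :=
  (hf.tame univ).dy.admissible (mem_univ 0)

theorem mulX (hf : Admissible C f) : Admissible C (mulX f) :=
  (hf.tame univ).mulX.admissible (mem_univ 0)

theorem rePair (hf : Admissible C f) (hg : Admissible C g) : Admissible C (rePair f g) :=
  ((hf.tame univ).rePair (hg.tame univ) trivial).admissible (mem_univ 0)

theorem mul_antiDx (hf : Admissible C f) (hg : Admissible C g) : Admissible C (f * antiDx g) :=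
  ((hf.tame univ).mul (hg.tame univ).antiDx).admissible (mem_univ 0)

theorem smooth_antiDx (hf : Admissible C f) : SmoothField (antiDx f) :=
  (hf.tame univ).smoothField_antiDx (mem_univ 0)

theorem dx_antiDx (hf : Admissible C f) : NLSHierarchy.dx (antiDx f) = f :=
  (hf.tame univ).dx_antiDx (mem_univ 0)

theorem dy_antiDx (hf : Admissible C f) :
    NLSHierarchy.dy (antiDx f) = antiDx (NLSHierarchy.dy f) :=
  (hf.tame univ).dy_antiDx (mem_univ 0)

theorem antiDx_dx (hf : Admissible C f) : antiDx (NLSHierarchy.dx f) = f :=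
  (hf.tame univ).antiDx_dx (mem_univ 0)

theorem antiDx_add (hf : Admissible C f) (hg : Admissible C g) :
    antiDx (f + g) = antiDx f + antiDx g :=
  (hf.tame univ).antiDx_add (hg.tame univ) (mem_univ 0)

theorem recOp (hu : Admissible C u) (hf : Admissible C f) : Admissible C (recOp u f) :=
  (hf.dx.add (hu.mul_antiDx (hu.rePair hf))).smul _

theorem recOpDeriv (hu : Admissible C u) (hh : Admissible C h) (hf : Admissible C f) :
    Admissible C (recOpDeriv u h f) :=
  ((hh.mul_antiDx (hu.rePair hf)).add (hu.mul_antiDx (hh.rePair hf))).smul _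

theorem baseField (b : Bool) (hu : Admissible C u) : Admissible C (baseField b u) := by
  cases b
  · exact hu.smul _
  · exact hu.dy.smul _

theorem hierField (b : Bool) (m : ℕ) (hu : Admissible C u) : Admissible C (hierField b m u) := by
  induction m with
  | zero => exact hu.baseField b
  | succ m ih => exact hu.recOp ih

theorem hierDeriv (b : Bool) (m : ℕ) (hu : Admissible C u) (hh : Admissible C h) :
    Admissible C (hierDeriv b m u h) := by
  induction m with
  | zero => exact hh.baseField b
  | succ m ih => exact (hu.recOpDeriv hh (hu.hierField b m)).add (hu.recOp ih)

end Admissible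

theorem recOp_add (hu : Admissible C u) (hf : Admissible C f) (hg : Admissible C g) :
    recOp u (f + g) = recOp u f + recOp u g := by
  simp only [recOp]
  rw [rePair_add_right, (hu.rePair hf).antiDx_add (hu.rePair hg), dx_add hf.smoothField
    hg.smoothField, ← smul_add]
  congr 1
  ring

/-- Real scalars only: the real part in the nonlocal term makes 𝓡 merely ℝ-linear. -/
theorem recOp_real_smul (c : ℝ) (u f : Field2) : recOp u ((c : ℂ) • f) = (c : ℂ) • recOp u f := by
  have e : rePair u ((c : ℂ) • f) = (c : ℂ) • rePair u f := by
    funext x y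
    simp only [rePair_apply, Pi.smul_apply, smul_eq_mul, Complex.re_ofReal_mul,
      Complex.im_ofReal_mul]
    push_cast; ring
  simp only [recOp]
  rw [e, antiDx_smul, dx_smul]
  funext x y
  simp only [Pi.smul_apply, Pi.add_apply, Pi.mul_apply, smul_eq_mul]
  ring

/-- The recursion operator is hereditary. -/
theorem recOp_hereditary (hu : Admissible C u) (hf : Admissible C f) (hg : Admissible C g) :
    recOpDeriv u (recOp u f) g + recOp u (recOpDeriv u g f)
      = recOpDeriv u (recOp u g) f + recOp u (recOpDeriv u f g) := by
  have hRf := hu.recOp hf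
  have hRg := hu.recOp hg
  have hfg := hu.recOpDeriv hf hg
  have hgf := hu.recOpDeriv hg hf
  -- Exchanging f and g changes the nonlocal integrands by an exact x-derivative, so after D_x⁻¹ the
  -- discrepancy is the local term Re(i f ḡ).
  have e1 : rePair (recOp u f) g + rePair u (recOpDeriv u g f)
      = (rePair (recOp u g) f + rePair u (recOpDeriv u f g)) + dx (rePair (Complex.I • f) g) := by
    rw [dx_rePair (hf.smul _).smoothField hg.smoothField, dx_smul]
    funext x y
    simp only [rePair_apply, recOp, recOpDeriv, Pi.smul_apply, Pi.add_apply, Pi.mul_apply,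
      antiDx_rePair_apply, smul_eq_mul]
    rw [← Complex.ofReal_add, ← Complex.ofReal_add, ← Complex.ofReal_add, ← Complex.ofReal_add]
    congr 1
    have e : dxInv (fun x y => (f x y * conj (g x y)).re)
        = dxInv (fun x y => (g x y * conj (f x y)).re) := by
      congr 1; funext x y; simp; ring
    rw [e]
    simp
    ring
  have e2 := congrArg antiDx e1
  rw [(hRf.rePair hg).antiDx_add (hu.rePair hgf), ((hRg.rePair hf).add
    (hu.rePair hfg)).antiDx_add ((hf.smul _).rePair hg).dx, (hRg.rePair hf).antiDx_add
    (hu.rePair hfg), ((hf.smul _).rePair hg).antiDx_dx] at e2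
  have d : ∀ {p q : Field2}, Admissible C p → Admissible C q → dx (recOpDeriv u p q)
      = Complex.I • (dx p * antiDx (rePair u q) + p * rePair u q
        + (dx u * antiDx (rePair p q) + u * rePair p q)) := by
    intro p q hp hq
    rw [recOpDeriv, dx_smul, dx_add (hp.mul_antiDx (hu.rePair hq)).smoothField
      (hu.mul_antiDx (hp.rePair hq)).smoothField, dx_mul hp.smoothField
      (hu.rePair hq).smooth_antiDx, dx_mul hu.smoothField (hp.rePair hq).smooth_antiDx,
      (hu.rePair hq).dx_antiDx, (hp.rePair hq).dx_antiDx]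
  have r : ∀ k, recOp u k = Complex.I • (dx k + u * antiDx (rePair u k)) := fun _ => rfl
  have rd : ∀ p q, recOpDeriv u p q
      = Complex.I • (p * antiDx (rePair u q) + u * antiDx (rePair p q)) := fun _ _ => rfl
  rw [r (recOpDeriv u g f), r (recOpDeriv u f g), d hg hf, d hf hg, rd (recOp u f) g,
    rd (recOp u g) f, rePair_comm g f]
  funext x y
  have e3 := congrFun (congrFun e2 x) y
  simp only [Pi.smul_apply, Pi.add_apply, Pi.mul_apply, smul_eq_mul] at e3 ⊢
  -- The linear dependence of three vectors u, f, g in the real plane; it cancels the local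
  -- discrepancy against the remaining local terms.
  have e4 : u x y * rePair (Complex.I • f) g x y
      = Complex.I * (f x y * rePair u g x y - g x y * rePair u f x y) := by
    simp only [rePair_apply, Pi.smul_apply, smul_eq_mul]
    apply Complex.ext <;> simp <;> ring
  have e5 : recOp u f x y = Complex.I * (dx f x y + u x y * antiDx (rePair u f) x y) := rfl
  have e6 : recOp u g x y = Complex.I * (dx g x y + u x y * antiDx (rePair u g) x y) := rfl
  rw [e5, e6]
  linear_combination Complex.I * u x y * e3 + Complex.I * e4

/-- The root symmetries preserve the recursion operator. -/
theorem recOp_lie_baseField (b : Bool) (hu : Admissible C u) (hf : Admissible C f) :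
    recOpDeriv u (baseField b u) f + recOp u (baseField b f) = baseField b (recOp u f) := by
  cases b
  · have e1 : rePair (Complex.I • u) f + rePair u (Complex.I • f) = (0 : ℂ) • rePair u f := by
      funext x y
      simp only [rePair_apply, Pi.smul_apply, Pi.add_apply, smul_eq_mul]
      apply Complex.ext <;> simp
    have e2 := congrArg antiDx e1
    rw [((hu.smul _).rePair hf).antiDx_add (hu.rePair (hf.smul _)), antiDx_smul] at e2
    simp only [baseField, recOp, recOpDeriv, dx_smul]
    funext x y
    have e3 := congrFun (congrFun e2 x) y
    simp only [Pi.smul_apply, Pi.add_apply, Pi.mul_apply, smul_eq_mul] at e3 ⊢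
    linear_combination Complex.I * u x y * e3
  · have hU := hu.smoothField
    have hF := hf.smoothField
    have e1 : rePair ((-1 : ℂ) • dy u) f + rePair u ((-1 : ℂ) • dy f)
        = (-1 : ℂ) • dy (rePair u f) := by
      rw [dy_rePair hU hF]
      funext x y
      simp only [rePair_apply, Pi.smul_apply, Pi.add_apply, smul_eq_mul]
      apply Complex.ext <;> simp
      ring
    have e2 := congrArg antiDx e1
    rw [((hu.dy.smul _).rePair hf).antiDx_add (hu.rePair (hf.dy.smul _)), antiDx_smul] at e2
    simp only [baseField, recOp, recOpDeriv, dx_smul, dy_smul]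
    rw [dy_add hF.dx (hu.mul_antiDx (hu.rePair hf)).smoothField,
      dy_mul hU (hu.rePair hf).smooth_antiDx, (hu.rePair hf).dy_antiDx, hF.dx_dy_comm]
    funext x y
    have e3 := congrFun (congrFun e2 x) y
    simp only [Pi.smul_apply, Pi.add_apply, Pi.mul_apply, smul_eq_mul] at e3 ⊢
    linear_combination Complex.I * u x y * e3

/-- Every vector field of the hierarchies preserves the recursion operator. -/
theorem recOp_lie_hierField (b : Bool) (m : ℕ) (hu : Admissible C u) (hf : Admissible C f) :
    recOpDeriv u (hierField b m u) f + recOp u (hierDeriv b m u f)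
      = hierDeriv b m u (recOp u f) := by
  induction m with
  | zero => exact recOp_lie_baseField b hu hf
  | succ m ih =>
    have hX := hu.hierField b m
    have hD := hu.hierDeriv b m hf
    simp only [hierDeriv, hierField]
    rw [← ih, recOp_add hu (hu.recOpDeriv hf hX) (hu.recOp hD),
      recOp_add hu (hu.recOpDeriv hX hf) (hu.recOp hD), ← add_assoc, ← add_assoc,
      recOp_hereditary hu hX hf]

/-- With X = X_m and Y the other field, (𝓡X)'[Y] = 𝓡'[Y]X + 𝓡 X'[Y]. Replacing X'[Y] by Y'[X] leaves
Y'[𝓡X], because Y preserves 𝓡. -/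
theorem hierDeriv_comm_succ {b c : Bool} {m n : ℕ} (hu : Admissible C u)
    (h : hierDeriv b m u (hierField c n u) = hierDeriv c n u (hierField b m u)) :
    hierDeriv b (m + 1) u (hierField c n u) = hierDeriv c n u (hierField b (m + 1) u) := by
  rw [hierDeriv, h]
  exact recOp_lie_hierField c n hu (hu.hierField b m)

/-- The vector fields of the two hierarchies commute. -/
theorem hierDeriv_comm (b c : Bool) (m n : ℕ) (hu : Admissible C u) :
    hierDeriv b m u (hierField c n u) = hierDeriv c n u (hierField b m u) := by
  induction n with
  | zero =>
    induction m with
    | zero => cases b <;> cases c <;> simp [hierDeriv, hierField, baseField, dy_smul]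
    | succ m ih => exact hierDeriv_comm_succ hu ih
  | succ n ih => exact (hierDeriv_comm_succ hu ih.symm).symm

/-- The vector fields of the hierarchies are equivariant under phase rotations. -/
theorem hierDeriv_I_smul (b : Bool) (m : ℕ) (hu : Admissible C u) :
    hierDeriv b m u (Complex.I • u) = Complex.I • hierField b m u :=
  hierDeriv_comm b false m 0 hu

/-- Homogeneity of the hierarchies under scalings of `x` and `u`. -/
theorem hierDeriv_scaling (b : Bool) (m : ℕ) (hu : Admissible C u) :
    hierDeriv b m u (dx (mulX u))
      = ((1 + m : ℝ) : ℂ) • hierField b m u + mulX (dx (hierField b m u)) := by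
  have hU := hu.smoothField
  induction m with
  | zero =>
    rw [dx_mulX hU]
    cases b
    · funext x y
      simp only [hierDeriv, hierField, baseField, dx_smul, mulX, Pi.smul_apply, Pi.add_apply,
        smul_eq_mul]
      push_cast; ring
    · simp only [hierDeriv, hierField, baseField, dx_smul]
      rw [dy_add hU hU.dx.mulX, dy_mulX, hU.dx_dy_comm]
      funext x y
      simp only [mulX, Pi.smul_apply, Pi.add_apply, smul_eq_mul]
      push_cast; ring
  | succ m ih =>
    have hX := hu.hierField b m
    rw [hierDeriv, ih, recOp_add hu (hX.smul _) hX.dx.mulX, recOp_real_smul]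
    change _ = _ • recOp u (hierField b m u) + mulX (dx (recOp u (hierField b m u)))
    generalize hierField b m u = X at hX ⊢
    -- The scaling variation of Re(u X̄) is the exact derivative (x Re(u X̄))_x, so D_x⁻¹ of it is x
    -- Re(u X̄).
    have e1 : rePair (dx (mulX u)) X + rePair u (mulX (dx X)) = dx (mulX (rePair u X)) := by
      rw [dx_mulX hU, dx_mulX (hu.rePair hX).smoothField, dx_rePair hU hX.smoothField]
      funext x y
      simp only [rePair_apply, mulX, Pi.add_apply]
      apply Complex.ext <;> simp
      ring
    have e2 := congrArg antiDx e1
    rw [(hu.mulX.dx.rePair hX).antiDx_add (hu.rePair hX.dx.mulX),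
      (hu.rePair hX).mulX.antiDx_dx] at e2
    have e4 : dx (recOp u X) = Complex.I • (dx (dx X) + (dx u * antiDx (rePair u X)
        + u * rePair u X)) := by
      rw [recOp, dx_smul, dx_add hX.dx.smoothField (hu.mul_antiDx (hu.rePair hX)).smoothField,
        dx_mul hU (hu.rePair hX).smooth_antiDx, (hu.rePair hX).dx_antiDx]
    rw [e4]
    have e5 := dx_mulX hX.dx.smoothField
    have e6 := dx_mulX hU
    funext x y
    have e3 := congrFun (congrFun e2 x) y
    have e5' := congrFun (congrFun e5 x) y
    have e6' := congrFun (congrFun e6 x) y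
    simp only [recOp, recOpDeriv, mulX, Pi.smul_apply, Pi.add_apply, Pi.mul_apply,
      smul_eq_mul] at e3 e5' e6' ⊢
    push_cast
    linear_combination Complex.I * u x y * e3 + Complex.I * e5'
      + Complex.I * antiDx (rePair u X) x y * e6'

/-! ### The real inner product -/

/-- The real inner product `∬ Re (f ḡ)`, as a complex number. -/
def pairing (C : YDomain) (f g : Field2) : ℂ := C.integral (rePair f g)

theorem pairing_comm (C : YDomain) (f g : Field2) : pairing C f g = pairing C g f := by
  rw [pairing, rePair_comm, pairing]

theorem pairing_add_left (hf : Admissible C f) (hg : Admissible C g) (hh : Admissible C h) :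
    pairing C (f + g) h = pairing C f h + pairing C g h := by
  rw [pairing, rePair_add_left, (hf.rePair hh).integral_add (hg.rePair hh)]; rfl

theorem pairing_add_right (hf : Admissible C f) (hg : Admissible C g) (hh : Admissible C h) :
    pairing C h (f + g) = pairing C h f + pairing C h g := by
  rw [pairing_comm, pairing_add_left hf hg hh, pairing_comm C f, pairing_comm C g]

theorem pairing_real_smul_left (C : YDomain) (c : ℝ) (f g : Field2) :
    pairing C ((c : ℂ) • f) g = c * pairing C f g := by
  have : rePair ((c : ℂ) • f) g = (c : ℂ) • rePair f g := by
    funext x y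
    simp only [rePair_apply, Pi.smul_apply, smul_eq_mul, Complex.re_ofReal_mul,
      Complex.im_ofReal_mul]
    push_cast; ring
  rw [pairing, this, C.integral_smul]; rfl

theorem pairing_neg_left (C : YDomain) (f g : Field2) :
    pairing C ((-1 : ℂ) • f) g = -pairing C f g := by
  have := pairing_real_smul_left C (-1) f g
  push_cast at this
  rw [this, neg_one_mul]

theorem pairing_I_smul_left (C : YDomain) (f g : Field2) :
    pairing C (Complex.I • f) g = -pairing C f (Complex.I • g) := by
  have : rePair (Complex.I • f) g = (-1 : ℂ) • rePair f (Complex.I • g) := by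
    funext x y
    simp only [rePair_apply, Pi.smul_apply, smul_eq_mul]
    apply Complex.ext <;> simp
  rw [pairing, this, C.integral_smul, neg_one_mul]; rfl

theorem pairing_I_smul_I_smul (C : YDomain) (f g : Field2) :
    pairing C (Complex.I • f) (Complex.I • g) = pairing C f g := by
  have : rePair (Complex.I • f) (Complex.I • g) = rePair f g := by
    funext x y
    simp only [rePair_apply, Pi.smul_apply, smul_eq_mul]
    apply Complex.ext <;> simp
    ring
  rw [pairing, this]; rfl

theorem pairing_dx_left (hf : Admissible C f) (hg : Admissible C g) :
    pairing C (dx f) g = -pairing C f (dx g) := by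
  have := (hf.rePair hg).integral_dx
  rw [dx_rePair hf.smoothField hg.smoothField, (hf.dx.rePair hg).integral_add
    (hf.rePair hg.dx)] at this
  exact eq_neg_of_add_eq_zero_left this

theorem pairing_dy_left (hf : Admissible C f) (hg : Admissible C g) :
    pairing C (dy f) g = -pairing C f (dy g) := by
  have := (hf.rePair hg).integral_dy
  rw [dy_rePair hf.smoothField hg.smoothField, (hf.dy.rePair hg).integral_add
    (hf.rePair hg.dy)] at this
  exact eq_neg_of_add_eq_zero_left this

theorem pairing_mulX_left (C : YDomain) (f g : Field2) :
    pairing C (mulX f) g = pairing C f (mulX g) := by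
  have : rePair (mulX f) g = rePair f (mulX g) := by
    funext x y
    simp only [rePair_apply, mulX]
    apply Complex.ext <;> simp
    ring
  rw [pairing, this]; rfl

theorem rePair_mul_antiDx_left (h u f g : Field2) :
    rePair (h * antiDx (rePair u f)) g = rePair h g * antiDx (rePair u f) := by
  funext x y
  simp only [rePair_apply, Pi.mul_apply, antiDx_rePair_apply]
  apply Complex.ext <;> simp
  ring

/-- `i 𝓡` is adjoint to `𝓡` with respect to the symplectic form. -/
theorem pairing_I_smul_recOp (hu : Admissible C u) (hf : Admissible C f) (hg : Admissible C g) :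
    pairing C (Complex.I • recOp u f) g = pairing C (Complex.I • f) (recOp u g) := by
  rw [pairing_I_smul_left, recOp, pairing_I_smul_I_smul, recOp, pairing_I_smul_I_smul,
    pairing_add_left hf.dx (hu.mul_antiDx (hu.rePair hf)) hg,
    pairing_add_right hg.dx (hu.mul_antiDx (hu.rePair hg)) hf, pairing_dx_left hf hg,
    pairing_comm C f (u * _)]
  simp only [pairing, rePair_mul_antiDx_left]
  rw [(hu.rePair hg).integral_mul_antiDx (hu.rePair hf)]
  ring

/-- Puts the variation of 𝓡 into trilinear form, so that the terms left over in the closedness proof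
can be matched by skew-adjointness of D_x⁻¹. -/
theorem pairing_I_smul_recOpDeriv (hu : Admissible C u) (hh : Admissible C h)
    (hf : Admissible C f) (hg : Admissible C g) :
    pairing C (Complex.I • recOpDeriv u h f) g
      = -(C.integral (rePair h g * antiDx (rePair u f))
        + C.integral (rePair u g * antiDx (rePair h f))) := by
  rw [pairing_I_smul_left, recOpDeriv, pairing_I_smul_I_smul,
    pairing_add_left (hh.mul_antiDx (hu.rePair hf)) (hu.mul_antiDx (hh.rePair hf)) hg]
  simp only [pairing, rePair_mul_antiDx_left]

/-- The covectors of the hierarchies are closed one-forms. -/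
theorem pairing_hierDeriv_symm (b : Bool) (m : ℕ) (hu : Admissible C u) (hf : Admissible C f)
    (hg : Admissible C g) :
    pairing C (Complex.I • hierDeriv b m u f) g = pairing C (Complex.I • hierDeriv b m u g) f := by
  induction m generalizing f g with
  | zero =>
    cases b
    · simp only [hierDeriv, baseField]
      rw [pairing_I_smul_left, pairing_I_smul_I_smul, pairing_I_smul_left, pairing_I_smul_I_smul,
        pairing_comm]
    · simp only [hierDeriv, baseField]
      rw [smul_comm, pairing_neg_left, smul_comm, pairing_neg_left, pairing_I_smul_left,
        pairing_dy_left hf (hg.smul _), dy_smul, pairing_comm C f]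
      ring
  | succ m ih =>
    have hX := hu.hierField b m
    have hDf := hu.hierDeriv b m hf
    have hDg := hu.hierDeriv b m hg
    simp only [hierDeriv]
    -- 𝓡 is moved onto g, the induction hypothesis exchanges the arguments, and preservation of 𝓡
    -- expands X'[𝓡g]. What remains is three variations of 𝓡, and these cancel by one use of
    -- skew-adjointness.
    rw [smul_add, smul_add, pairing_add_left ((hu.recOpDeriv hf hX).smul _)
      ((hu.recOp hDf).smul _) hg, pairing_add_left ((hu.recOpDeriv hg hX).smul _)
      ((hu.recOp hDg).smul _) hf, pairing_I_smul_recOp hu hDf hg, ih hf (hu.recOp hg),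
      ← recOp_lie_hierField b m hu hg, smul_add, pairing_add_left ((hu.recOpDeriv hX hg).smul _)
      ((hu.recOp hDg).smul _) hf, pairing_I_smul_recOpDeriv hu hf hX hg,
      pairing_I_smul_recOpDeriv hu hX hg hf, pairing_I_smul_recOpDeriv hu hg hX hf,
      (hu.rePair hg).integral_mul_antiDx (hf.rePair hX), rePair_comm g f,
      rePair_comm (hierField b m u) f, rePair_comm (hierField b m u) g]
    ring

/-- Each factor 𝓡 passes across the symplectic form by symmetry, so only the sum of the two indices
matters. -/
theorem pairing_I_smul_shift (b c : Bool) (m n : ℕ) (hu : Admissible C u) :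
    pairing C (Complex.I • hierField b m u) (hierField c n u)
      = pairing C (Complex.I • hierField b 0 u) (hierField c (m + n) u) := by
  induction m generalizing n with
  | zero => rw [zero_add]
  | succ m ih =>
    change pairing C (Complex.I • recOp u (hierField b m u)) _ = _
    rw [pairing_I_smul_recOp hu (hu.hierField b m) (hu.hierField c n)]
    refine (ih (n + 1)).trans ?_
    rw [add_right_comm, add_assoc]

/-- The vector fields of one hierarchy are in involution. -/
theorem pairing_I_smul_self_hierarchy (b : Bool) (m n : ℕ) (hu : Admissible C u) :
    pairing C (Complex.I • hierField b m u) (hierField b n u) = 0 := by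
  have h1 := pairing_I_smul_shift (C := C) b b m n hu
  have h2 := pairing_I_smul_shift (C := C) b b n m hu
  have h3 := pairing_I_smul_left C (hierField b m u) (hierField b n u)
  rw [pairing_comm C (hierField b m u)] at h3
  rw [add_comm n m] at h2
  -- The form is antisymmetric, while its value here is symmetric in m and n.
  have h4 : (2 : ℂ) * pairing C (Complex.I • hierField b m u) (hierField b n u) = 0 := by
    linear_combination h3 + h1 - h2
  simpa using h4

end

/-! ### Dependence of the hierarchies on a parameter -/

section

variable {C : YDomain} {J : Set ℕ} {K : Set ℝ} {f f' g g' u u' : ℝ → Field2} {v w X : Field2}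

theorem Tame.recOp (hu : Tame C univ K u) (hf : Tame C univ K f) :
    Tame C univ K (fun s => recOp (u s) (f s)) :=
  (hf.dx.add (hu.mul (hu.rePair hf trivial).antiDx)).smul _

theorem Tame.hierField (b : Bool) (m : ℕ) (hu : Tame C univ K u) :
    Tame C univ K (fun s => hierField b m (u s)) := by
  induction m with
  | zero =>
    cases b
    · exact hu.smul _
    · exact hu.dy.smul _
  | succ m ih => exact hu.recOp ih

theorem C1Tame.congr_deriv (h : C1Tame C J K f f') (e : ∀ s ∈ K, g' s = f' s) :
    C1Tame C J K f g' :=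
  ⟨h.tame, h.tame'.congr e, fun s hs a b x y => by rw [e s hs]; exact h.deriv s hs a b x y⟩

theorem C1Tame.recOp (hK : IsOpen K) (hu : C1Tame C univ K u u') (hf : C1Tame C univ K f f') :
    C1Tame C univ K (fun s => recOp (u s) (f s))
      (fun s => recOpDeriv (u s) (u' s) (f s) + recOp (u s) (f' s)) := by
  refine (((hf.dx hK).add hK (hu.mul hK ((hu.rePair hK hf).antiDx hK))).smul
    Complex.I).congr_deriv fun s hs => ?_
  have h1 := (hu.tame'.admissible hs).rePair (hf.tame.admissible hs)
  have h2 := (hu.tame.admissible hs).rePair (hf.tame'.admissible hs)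
  rw [NLSHierarchy.recOp, recOpDeriv, ← smul_add, h1.antiDx_add h2]
  congr 1
  ring

theorem C1Tame.hierField (hK : IsOpen K) (b : Bool) (m : ℕ) (hu : C1Tame C univ K u u') :
    C1Tame C univ K (fun s => hierField b m (u s)) (fun s => hierDeriv b m (u s) (u' s)) := by
  induction m with
  | zero =>
    cases b
    · exact hu.smul _
    · exact hu.dy.smul _
  | succ m ih => exact hu.recOp hK ih

theorem dxy_zero (a b : ℕ) : dxy a b 0 = 0 := by
  have := dxy_smul a b 0 0
  rwa [zero_smul, zero_smul] at this

theorem C1Tame.const (K : Set ℝ) (hv : Admissible C v) :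
    C1Tame C univ K (fun _ => v) (fun _ => 0) := by
  have h0 : Admissible C (0 : Field2) := by simpa using hv.smul 0
  refine ⟨hv.tame K, h0.tame K, fun s _ a b x y => ?_⟩
  rw [dxy_zero]
  exact hasDerivAt_const s _

/-- The parameter is kept in a ball because the bounds on s v must be uniform in s. -/
theorem C1Tame.ofReal_smul (r : ℝ) (hv : Admissible C v) :
    C1Tame C univ (Metric.ball 0 r) (fun s => (s : ℂ) • v) (fun _ => v) := by
  refine ⟨⟨fun s _ => hv.smoothField.smul s, fun s _ => (hv.smul s).periodic,
    fun j _ k a b => ?_⟩, hv.tame _, fun s _ a b x y => ?_⟩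
  · obtain ⟨M, hM⟩ := hv.decay j k a b
    refine ⟨r * M, fun s hs x y => ((hM.smul (s : ℂ)) x y).trans ?_⟩
    have hs' : ‖(s : ℂ)‖ ≤ r := by
      rw [Complex.norm_real]
      exact (mem_ball_zero_iff.1 hs).le
    exact mul_le_mul_of_nonneg_right hs' hM.nonneg
  · simp only [dxy_smul]
    have h : HasDerivAt (fun s : ℝ => (s : ℂ)) 1 s := Complex.ofRealCLM.hasDerivAt
    have := h.mul_const (dxy a b v x y)
    rw [one_mul] at this
    exact this

theorem C1Tame.line (r : ℝ) (hv : Admissible C v) (hw : Admissible C w) :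
    C1Tame C univ (Metric.ball 0 r) (fun s => v + (s : ℂ) • w) (fun _ => w) :=
  ((C1Tame.const _ hv).add Metric.isOpen_ball (C1Tame.ofReal_smul r hw)).congr_deriv
    fun _ _ => (zero_add w).symm

theorem C1Tame.hasDerivAt_pairing (hK : IsOpen K) (hf : C1Tame C univ K f f')
    (hg : C1Tame C univ K g g') {s : ℝ} (hs : s ∈ K) :
    HasDerivAt (fun s => pairing C (f s) (g s))
      (pairing C (f' s) (g s) + pairing C (f s) (g' s)) s := by
  have := (hf.rePair hK hg).hasDerivAt_integral hK hs
  rwa [((hf.tame'.admissible hs).rePair (hg.tame.admissible hs)).integral_add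
    ((hf.tame.admissible hs).rePair (hg.tame'.admissible hs))] at this

/-- Radius 2 makes both ends of the ray, s = 0 and s = 1, interior points. -/
theorem eq_of_hasDerivAt_zero {φ : ℝ → ℂ} (h : ∀ s ∈ Metric.ball (0 : ℝ) 2, HasDerivAt φ 0 s) :
    φ 1 = φ 0 :=
  Metric.isOpen_ball.is_const_of_deriv_eq_zero (convex_ball (0 : ℝ) 2).isPreconnected
    (fun s hs => (h s hs).differentiableAt.differentiableWithinAt) (fun s hs => (h s hs).deriv)
    (by simp) (by simp)

theorem pairing_zero_smul_left (C : YDomain) (v w : Field2) :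
    pairing C (((0 : ℝ) : ℂ) • v) w = 0 := by
  rw [pairing_real_smul_left, Complex.ofReal_zero, zero_mul]

/-- The vector fields of the hierarchies are orthogonal to `u`. -/
theorem pairing_self_hierField (b : Bool) (m : ℕ) (hv : Admissible C v) :
    pairing C v (hierField b m v) = 0 := by
  have hc := C1Tame.ofReal_smul 2 hv
  have hd : ∀ s ∈ Metric.ball (0 : ℝ) 2, HasDerivAt
      (fun s : ℝ => pairing C ((s : ℂ) • v) (hierField b m ((s : ℂ) • v))) 0 s := by
    intro s hs
    have h := hc.hasDerivAt_pairing Metric.isOpen_ball (hc.hierField Metric.isOpen_ball b m) hs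
    have hs' := hv.smul (s : ℂ)
    generalize (s : ℂ) • v = w at h hs'
    convert h using 1
    -- Closedness moves the derivative from v onto i w, where phase equivariance gives X'[i w] = i
    -- X(w); the two terms of the product rule then cancel.
    rw [pairing_comm C w, ← pairing_I_smul_I_smul C (hierDeriv b m w v),
      pairing_hierDeriv_symm b m hs' hv (hs'.smul _), hierDeriv_I_smul b m hs',
      pairing_I_smul_left, pairing_I_smul_I_smul, pairing_comm C v]
    ring
  have := eq_of_hasDerivAt_zero hd
  simpa only [pairing_zero_smul_left, Complex.ofReal_one, one_smul] using this

/-- The flows of the hierarchies are in involution with the 2+1 flows. -/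
theorem pairing_I_smul_hierField (b : Bool) (m n : ℕ) (hv : Admissible C v) :
    pairing C (Complex.I • hierField b m v) (hierField true n v) = 0 := by
  cases b
  · rw [pairing_I_smul_shift false true m n hv]
    simp only [hierField, baseField]
    rw [pairing_I_smul_left, pairing_I_smul_I_smul, pairing_self_hierField true _ hv, neg_zero]
  · exact pairing_I_smul_self_hierarchy true m n hv

/-! ### The Hamiltonians -/

/-- The Hamiltonians of the hierarchies, expressed by the scaling vector field. -/
def hamValue (C : YDomain) (b : Bool) (m : ℕ) (u : Field2) : ℂ :=
  2 / (1 + m) * pairing C (Complex.I • dx (mulX u)) (hierField b m u)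

/-- The scaling field (x v)_x is 𝓡(-i x v), since Re(v · conj(-i x v)) = 0 kills the nonlocal term;
symmetry of 𝓡 does the rest. -/
theorem pairing_mulX_recOp (hv : Admissible C v) (hX : Admissible C X) :
    pairing C (mulX v) (recOp v X) = pairing C (Complex.I • dx (mulX v)) X := by
  have e : mulX v = Complex.I • (-Complex.I) • mulX v := by
    rw [smul_smul]; simp
  have e1 : rePair v ((-Complex.I) • mulX v) = (0 : ℂ) • v := by
    funext x y
    simp only [rePair_apply, mulX, Pi.smul_apply, smul_eq_mul]
    apply Complex.ext <;> simp
    ring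
  have e2 : recOp v ((-Complex.I) • mulX v) = dx (mulX v) := by
    rw [recOp, e1, antiDx_smul, dx_smul, zero_smul, mul_zero, add_zero, smul_smul]
    simp
  nth_rewrite 1 [e]
  rw [← pairing_I_smul_recOp hv (hv.mulX.smul _) hX, e2]

/-- The densities of the hierarchies are integrable and their integrals are the Hamiltonians. -/
theorem integral_antiDx_rePair_hierField (b : Bool) (m : ℕ) (hv : Admissible C v) :
    (∀ x, IntegrableOn (antiDx (rePair v (hierField b (m + 1) v)) x) C.ySet) ∧
      Integrable (fun x => ∫ y in C.ySet, antiDx (rePair v (hierField b (m + 1) v)) x y) ∧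
      hamValue C b m v
        = -(2 / (1 + m)) * C.integral (antiDx (rePair v (hierField b (m + 1) v))) := by
  have hX := hv.hierField b m
  -- Orthogonality of v to the next field is exactly the zero-mean condition under which D_x⁻¹ is
  -- integrable.
  obtain ⟨h1, h2, h3⟩ := (hv.rePair (hv.hierField b (m + 1))).integral_antiDx
    (pairing_self_hierField b (m + 1) hv)
  refine ⟨h1, h2, ?_⟩
  have e : mulX (rePair v (hierField b (m + 1) v)) = rePair (mulX v) (hierField b (m + 1) v) := by
    funext x y
    simp only [rePair_apply, mulX]
    apply Complex.ext <;> simp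
    ring
  rw [h3, e]
  change _ = _ * -pairing C (mulX v) (recOp v (hierField b m v))
  rw [pairing_mulX_recOp hv hX, hamValue]
  ring

/-- The variational derivatives of the Hamiltonians. -/
theorem C1Tame.hasDerivAt_hamValue (hK : IsOpen K) (hu : C1Tame C univ K u u') (b : Bool) (m : ℕ)
    {s : ℝ} (hs : s ∈ K) : HasDerivAt (fun s => hamValue C b m (u s))
      (2 * pairing C (u' s) ((-Complex.I) • NLSHierarchy.hierField b m (u s))) s := by
  have h := (((((hu.mulX hK).dx hK).smul Complex.I).hasDerivAt_pairing hK
    (hu.hierField hK b m) hs)).const_mul (2 / (1 + m : ℂ))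
  refine h.congr_deriv ?_
  have hus := hu.tame.admissible hs
  have hvs := hu.tame'.admissible hs
  generalize u s = w at hus
  generalize u' s = v at hvs
  have hX := hus.hierField b m
  have hm : (1 + m : ℂ) ≠ 0 := by
    have : (0 : ℝ) < 1 + m := by positivity
    exact_mod_cast this.ne'
  -- Closedness exchanges v with the scaling field, and homogeneity supplies the factor 1 + m that
  -- the normalisation divides out. The extra x ∂_x term cancels against the variation of the
  -- scaling field itself, treated next.
  have e1 : pairing C (Complex.I • NLSHierarchy.dx (NLSHierarchy.mulX w)) (hierDeriv b m w v)
      = -((1 + m) * pairing C (Complex.I • NLSHierarchy.hierField b m w) v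
        + pairing C (Complex.I • NLSHierarchy.mulX
          (NLSHierarchy.dx (NLSHierarchy.hierField b m w))) v) := by
    rw [pairing_I_smul_left, pairing_comm, pairing_hierDeriv_symm b m hus hvs hus.mulX.dx,
      hierDeriv_scaling b m hus, smul_add, pairing_add_left ((hX.smul _).smul _)
      (hX.dx.mulX.smul _) hvs, smul_comm, pairing_real_smul_left]
    push_cast; ring
  have e2 : pairing C (Complex.I • NLSHierarchy.dx (NLSHierarchy.mulX v))
      (NLSHierarchy.hierField b m w) = pairing C (Complex.I • NLSHierarchy.mulX
          (NLSHierarchy.dx (NLSHierarchy.hierField b m w))) v := by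
    rw [pairing_I_smul_left, pairing_dx_left hvs.mulX (hX.smul _), neg_neg, dx_smul,
      pairing_mulX_left, pairing_comm]
    congr 1
    funext x y
    simp only [NLSHierarchy.mulX, Pi.smul_apply, smul_eq_mul]
    ring
  have e3 : pairing C v ((-Complex.I) • NLSHierarchy.hierField b m w)
      = -pairing C (Complex.I • NLSHierarchy.hierField b m w) v := by
    rw [← neg_one_mul Complex.I, mul_smul, pairing_comm, pairing_neg_left]
  rw [e1, e2, e3]
  field_simp
  ring

/-- A Hamiltonian is determined by its values along the ray through a field. -/
theorem hamValue_eq_of_ray (b : Bool) (m : ℕ) (hv : Admissible C v) {φ φ' : ℝ → ℂ}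
    (h0 : φ 0 = 0) (hφ : ∀ s, HasDerivAt φ (φ' s) s)
    (h : ∀ s : ℝ, 2 * pairing C v ((-Complex.I) • hierField b m ((s : ℂ) • v)) = φ' s) :
    hamValue C b m v = φ 1 := by
  have hd : ∀ s ∈ Metric.ball (0 : ℝ) 2,
      HasDerivAt (fun s : ℝ => hamValue C b m ((s : ℂ) • v) - φ s) 0 s := by
    intro s hs
    have := ((C1Tame.ofReal_smul 2 hv).hasDerivAt_hamValue Metric.isOpen_ball b m hs).sub (hφ s)
    rwa [h, sub_self] at this
  have h1 := eq_of_hasDerivAt_zero hd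
  have h2 : hamValue C b m (((0 : ℝ) : ℂ) • v) = 0 := by
    have e : Complex.I • dx (mulX (((0 : ℝ) : ℂ) • v)) = ((0 : ℝ) : ℂ) • v := by
      have : mulX (((0 : ℝ) : ℂ) • v) = (0 : ℂ) • v := by
        funext x y
        simp [mulX]
      rw [this, dx_smul]
      simp
    rw [hamValue, e, pairing_zero_smul_left, mul_zero]
  simp only [h2, h0, sub_zero, Complex.ofReal_one, one_smul] at h1
  exact sub_eq_zero.1 h1

end

/-! ### The operators of the hierarchy in terms of the recursion operator -/

theorem opH_eq_recOp (u f : Field2) : opH u f = recOp u ((-Complex.I) • f) := by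
  have e : (fun x y => (u x y * conj (f x y)).im)
      = fun x y => (u x y * conj ((Complex.I • f) x y)).re := by
    funext x y
    simp only [Pi.smul_apply, smul_eq_mul]
    simp
    ring
  have e1 : rePair u ((-Complex.I) • f) = (-1 : ℂ) • rePair u (Complex.I • f) := by
    funext x y
    simp only [rePair_apply, Pi.smul_apply, smul_eq_mul]
    apply Complex.ext <;> simp
    ring
  funext x y
  rw [opH, e, recOp, e1, antiDx_smul, dx_smul]
  simp only [Pi.smul_apply, Pi.add_apply, Pi.mul_apply, smul_eq_mul]
  rw [antiDx_rePair_apply]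
  linear_combination dx f x y * Complex.I_mul_I

theorem opIinv_eq (f : Field2) : opIinv f = Complex.I • f := rfl

theorem opR_eq_recOp (u f : Field2) : opR u f = recOp u f := by
  rw [opR, opIinv_eq, opH_eq_recOp, smul_smul]
  simp

theorem recOp_neg (u f : Field2) : recOp u ((-1 : ℂ) • f) = (-1 : ℂ) • recOp u f := by
  have := recOp_real_smul (-1) u f
  push_cast at this
  exact this

/-- Multiplication by -i intertwines 𝓡 with 𝓡*, which carries statements on covectors over to vector
fields. -/
theorem opRstar_eq (u X : Field2) :
    opRstar u ((-Complex.I) • X) = (-Complex.I) • recOp u X := by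
  rw [opRstar, opIinv_eq, opH_eq_recOp, smul_smul]
  have : -Complex.I * -Complex.I = -1 := by simp
  rw [this, recOp_neg, smul_smul]
  congr 1
  ring

theorem covector1_eq (m : ℕ) (u : Field2) :
    covector1 m u = (-Complex.I) • hierField false m u := by
  induction m with
  | zero =>
    simp only [covector1, hierField, baseField, smul_smul]
    simp
  | succ m ih =>
    rw [covector1, Function.iterate_succ_apply']
    change opRstar u (covector1 m u) = _
    rw [ih, opRstar_eq]; rfl

theorem covector2_eq (m : ℕ) (u : Field2) :
    covector2 m u = (-Complex.I) • hierField true m u := by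
  induction m with
  | zero =>
    simp only [covector2, hierField, baseField, smul_smul]
    funext x y
    simp
  | succ m ih =>
    rw [covector2, Function.iterate_succ_apply']
    change opRstar u (covector2 m u) = _
    rw [ih, opRstar_eq]; rfl

theorem symmetry1_eq (m : ℕ) (u : Field2) : symmetry1 m u = hierField false m u := by
  change Complex.I • covector1 m u = _
  rw [covector1_eq, smul_smul]
  simp

theorem symmetry2_eq (m : ℕ) (u : Field2) : symmetry2 m u = hierField true m u := by
  change Complex.I • covector2 m u = _
  rw [covector2_eq, smul_smul]
  simp

theorem flow_succ_eq (n : ℕ) (u : Field2) :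
    flow (n + 1) u = (-1 : ℂ) • hierField true (n + 1) u := by
  rw [flow, add_tsub_cancel_right, covector2_eq, opH_eq_recOp, smul_smul]
  have : -Complex.I * -Complex.I = -1 := by simp
  rw [this, recOp_neg]; rfl

/-- The index n - 1 in `flow` is a truncated subtraction, so at n = 0 the `flow` would repeat the
case n = 1. -/
theorem flow_eq {n : ℕ} (hn : 1 ≤ n) (u : Field2) :
    flow n u = (-1 : ℂ) • hierField true n u := by
  obtain ⟨k, rfl⟩ := Nat.exists_eq_add_of_le' hn
  exact flow_succ_eq k u

theorem iterate_opR (m : ℕ) (u : Field2) :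
    (opR u)^[m] (dy u) = (-1 : ℂ) • hierField true m u := by
  induction m with
  | zero => simp [hierField, baseField]
  | succ m ih =>
    rw [Function.iterate_succ_apply', ih, opR_eq_recOp, recOp_neg]; rfl

theorem dxInv_rePair_neg (u X : Field2) (x y c : ℝ) :
    ((c * dxInv (fun x y => -(u x y * conj (X x y)).re) x y : ℝ) : ℂ)
      = (-c : ℂ) * antiDx (rePair u X) x y := by
  rw [antiDx_rePair_apply]
  simp only [dxInv, integral_neg]
  push_cast
  ring

theorem density1_eq (m : ℕ) (u : Field2) (x y : ℝ) :
    (density1 m u x y : ℂ)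
      = (-(2 / (1 + m)) : ℂ) * antiDx (rePair u (hierField false (m + 1) u)) x y := by
  have e : density1 m u x y = 2 / (1 + (m : ℝ)) *
      dxInv (fun x y => -(u x y * conj (hierField false (m + 1) u x y)).re) x y := by
    have h : (fun f => opIinv (opH u f))^[m + 1] u = (-Complex.I) • hierField false (m + 1) u :=
      covector1_eq (m + 1) u
    rw [density1, h]
    congr 2
    funext x y
    simp only [Pi.smul_apply, smul_eq_mul]
    simp
  rw [e, dxInv_rePair_neg]
  push_cast; rfl

theorem density2_eq (m : ℕ) (u : Field2) (x y : ℝ) :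
    (density2 m u x y : ℂ)
      = (-(2 / (1 + m)) : ℂ) * antiDx (rePair u (hierField true (m + 1) u)) x y := by
  have e : density2 m u x y = 2 / (1 + (m : ℝ)) *
      dxInv (fun x y => -(u x y * conj (hierField true (m + 1) u x y)).re) x y := by
    rw [density2, iterate_opR]
    congr 2
    funext x y
    simp only [Pi.smul_apply, smul_eq_mul]
    simp
  rw [e, dxInv_rePair_neg]
  push_cast; rfl

section

variable {C : YDomain} {K : Set ℝ} {u v X : Field2}

theorem Admissible.iterIntegrable_of_density (b : Bool) (m : ℕ) (hv : Admissible C v)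
    {d : ℝ → ℝ → ℝ} (hd : ∀ x y, (d x y : ℂ)
      = (-(2 / (1 + m)) : ℂ) * antiDx (NLSHierarchy.rePair v (NLSHierarchy.hierField b (m + 1) v)) x y) :
    C.IterIntegrable d ∧ ((C.integral d : ℝ) : ℂ) = hamValue C b m v := by
  obtain ⟨h1, h2, h3⟩ := integral_antiDx_rePair_hierField b m hv
  have e : ∀ x, (fun y => (d x y : ℂ))
      = fun y => (-(2 / (1 + m)) : ℂ) * antiDx (NLSHierarchy.rePair v (NLSHierarchy.hierField b (m + 1) v)) x y :=
    fun x => funext (hd x)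
  refine ⟨⟨fun x => ?_, ?_⟩, ?_⟩
  · have := (h1 x).const_mul (-(2 / (1 + m)) : ℂ)
    rw [← e x] at this
    exact this.re
  · have := h2.const_mul (-(2 / (1 + m)) : ℂ)
    have e2 : (fun x => (-(2 / (1 + m)) : ℂ) *
        ∫ y in C.ySet, antiDx (NLSHierarchy.rePair v (NLSHierarchy.hierField b (m + 1) v)) x y)
        = fun x => ((∫ y in C.ySet, d x y : ℝ) : ℂ) := by
      funext x
      rw [← integral_const_mul, ← e x]
      exact _root_.integral_ofReal (𝕜 := ℂ)
    rw [e2] at this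
    exact this.re
  · rw [h3, ← YDomain.integral_ofReal, ← C.integral_smul]
    congr 1
    funext x
    exact e x

theorem Admissible.iterIntegrable_density1 (m : ℕ) (hv : Admissible C v) :
    C.IterIntegrable (density1 m v) ∧ (ham1 C m v : ℂ) = hamValue C false m v :=
  hv.iterIntegrable_of_density false m (density1_eq m v)

theorem Admissible.iterIntegrable_density2 (m : ℕ) (hv : Admissible C v) :
    C.IterIntegrable (density2 m v) ∧ (ham2 C m v : ℂ) = hamValue C true m v :=
  hv.iterIntegrable_of_density true m (density2_eq m v)

/-- A real functional that agrees with a Hamiltonian of the hierarchies is differentiable along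
tame families. -/
theorem C1Tame.hasDerivAt_ham (hK : IsOpen K) {w w' : ℝ → Field2} (hu : C1Tame C univ K w w')
    {b : Bool} {m : ℕ} {h : Field2 → ℝ}
    (hh : ∀ v, Admissible C v → (h v : ℂ) = hamValue C b m v) {s : ℝ} (hs : s ∈ K) :
    HasDerivAt (fun s => h (w s)) (2 * C.integral (fun x y =>
      (w' s x y * conj (((-Complex.I) • NLSHierarchy.hierField b m (w s)) x y)).re)) s := by
  have h1 := hu.hasDerivAt_hamValue hK b m hs
  have h2 := Complex.reCLM.hasFDerivAt.comp_hasDerivAt s h1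
  have e : Complex.reCLM (2 * pairing C (w' s) ((-Complex.I) • NLSHierarchy.hierField b m (w s)))
      = 2 * C.integral (fun x y =>
        (w' s x y * conj (((-Complex.I) • NLSHierarchy.hierField b m (w s)) x y)).re) := by
    have : pairing C (w' s) ((-Complex.I) • NLSHierarchy.hierField b m (w s)) = _ :=
      C.integral_ofReal (fun x y =>
        (w' s x y * conj (((-Complex.I) • NLSHierarchy.hierField b m (w s)) x y)).re)
    rw [this]
    simp
  rw [← e]
  refine h2.congr_of_eventuallyEq ?_
  filter_upwards [hK.mem_nhds hs] with σ hσ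
  change _ = (hamValue C b m (w σ)).re
  rw [← hh _ (hu.tame.admissible hσ), Complex.ofReal_re]

theorem real_smul_field (ε : ℝ) (v : Field2) : ε • v = (ε : ℂ) • v := rfl

theorem isVariationalDerivative_of_hamValue {b : Bool} {m : ℕ} {h : Field2 → ℝ}
    (hh : ∀ v, Admissible C v → (h v : ℂ) = hamValue C b m v) :
    IsVariationalDerivative C h (fun u => (-Complex.I) • hierField b m u) := by
  refine fun u hu => ⟨(hu.hierField b m).smul _, fun v hv => ?_⟩
  have := (C1Tame.line 1 hu hv).hasDerivAt_ham Metric.isOpen_ball hh (s := 0) (by simp)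
  simp only [Complex.ofReal_zero, zero_smul, add_zero] at this
  simpa only [real_smul_field] using this

/-! ### Invariance under phase rotations -/

theorem rotate_eq (φ : ℝ) (u : Field2) : rotate φ u = Complex.exp (Complex.I * φ) • u := rfl

theorem rePair_rotate (φ : ℝ) (u f : Field2) :
    rePair (rotate φ u) (rotate φ f) = rePair u f := by
  have h : Complex.exp (Complex.I * φ) * conj (Complex.exp (Complex.I * φ)) = 1 := by
    rw [Complex.mul_conj, Complex.normSq_eq_norm_sq, mul_comm, Complex.norm_exp_ofReal_mul_I]
    simp
  funext x y
  simp only [rePair, rotate, map_mul]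
  congr 2
  linear_combination (u x y * conj (f x y)) * h

theorem recOp_rotate (φ : ℝ) (u f : Field2) :
    recOp (rotate φ u) (rotate φ f) = rotate φ (recOp u f) := by
  rw [recOp, rePair_rotate, recOp, rotate_eq, rotate_eq, rotate_eq, dx_smul, smul_mul_assoc,
    ← smul_add, smul_comm]

theorem hierField_rotate (b : Bool) (m : ℕ) (φ : ℝ) (u : Field2) :
    hierField b m (rotate φ u) = rotate φ (hierField b m u) := by
  induction m with
  | zero =>
    cases b
    · simp only [hierField, baseField, rotate_eq]
      rw [smul_comm]
    · simp only [hierField, baseField, rotate_eq, dy_smul]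
      rw [smul_comm]
  | succ m ih => rw [hierField, ih, recOp_rotate, hierField]

theorem flow_rotate {n : ℕ} (hn : 1 ≤ n) (φ : ℝ) (u : Field2) :
    flow n (rotate φ u) = rotate φ (flow n u) := by
  rw [flow_eq hn, flow_eq hn, hierField_rotate, rotate_eq, rotate_eq, smul_comm]

theorem density2_rotate (m : ℕ) (φ : ℝ) (u : Field2) :
    density2 m (rotate φ u) = density2 m u := by
  funext x y
  apply Complex.ofReal_injective
  rw [density2_eq, density2_eq, hierField_rotate, rePair_rotate]

/-! ### Scaling homogeneity -/

/-- The scaled field `c^{-k} u(x / c, y / c)`. -/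
def scaled (c : ℝ) (k : ℕ) (u : Field2) : Field2 :=
  fun x y => ((c : ℂ) ^ k)⁻¹ * u (x / c) (y / c)

theorem rescale_eq_scaled (c : ℝ) (u : Field2) : rescale c u = scaled c 1 u := by
  funext x y
  simp [rescale, scaled]

theorem dx_scaled (c : ℝ) (k : ℕ) (u : Field2) : dx (scaled c k u) = scaled c (k + 1) (dx u) := by
  funext x y
  change deriv (fun s => ((c : ℂ) ^ k)⁻¹ * u (s / c) (y / c)) x = _
  have := deriv_comp_mul_left c⁻¹ (fun s => u s (y / c)) x
  simp only [← div_eq_inv_mul] at this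
  rw [deriv_const_mul_field, this]
  simp only [scaled, dx, Complex.real_smul, pow_succ, Complex.ofReal_inv, mul_inv]
  ring

theorem dy_scaled (c : ℝ) (k : ℕ) (u : Field2) : dy (scaled c k u) = scaled c (k + 1) (dy u) := by
  funext x y
  change deriv (fun s => ((c : ℂ) ^ k)⁻¹ * u (x / c) (s / c)) y = _
  have := deriv_comp_mul_left c⁻¹ (fun s => u (x / c) s) y
  simp only [← div_eq_inv_mul] at this
  rw [deriv_const_mul_field, this]
  simp only [scaled, dy, Complex.real_smul, pow_succ, Complex.ofReal_inv, mul_inv]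
  ring

theorem dxy_scaled (a b : ℕ) (c : ℝ) (k : ℕ) (u : Field2) :
    dxy a b (scaled c k u) = scaled c (k + (a + b)) (dxy a b u) := by
  induction b generalizing k u with
  | zero =>
    induction a generalizing k u with
    | zero => rfl
    | succ a ih =>
      rw [dxy_succ_zero, dx_scaled, ih, ← dxy_succ_zero]
      congr 1
      ring
  | succ b ih =>
    rw [dxy_succ_right, dy_scaled, ih, ← dxy_succ_right]
    congr 1
    ring

theorem antideriv_comp_div {c : ℝ} (hc : 0 < c) (g : ℝ → ℂ) (x : ℝ) :
    antideriv (fun s => g (s / c)) x = c * antideriv g (x / c) := by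
  have h1 : ∀ (g : ℝ → ℂ) (x : ℝ), ∫ s in Ioi x, g (s / c) = c * ∫ s in Ioi (x / c), g s := by
    intro g x
    have := integral_comp_mul_left_Ioi g x (inv_pos.2 hc)
    simpa only [← div_eq_inv_mul, inv_inv, Complex.real_smul] using this
  have h2 : ∫ s in Iic x, g (s / c) = c * ∫ s in Iic (x / c), g s := by
    have e1 := integral_comp_neg_Ioi (-x) (fun s => g (s / c))
    have e2 := integral_comp_neg_Ioi (-x / c) g
    have e3 := h1 (fun s => g (-s)) (-x)
    rw [neg_neg] at e1
    rw [neg_div, neg_neg] at e2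
    rw [← e1, ← e2, ← neg_div, ← e3]
    simp only [neg_div]
  rw [antideriv, antideriv, h1, h2]
  ring

/-- The Jacobian c of the substitution lowers the weight by one. Hence 𝓡 raises the weight by one,
its two terms being of equal weight. -/
theorem antiDx_scaled {c : ℝ} (hc : 0 < c) (k : ℕ) (u : Field2) :
    antiDx (scaled c (k + 1) u) = scaled c k (antiDx u) := by
  have hc' : (c : ℂ) ≠ 0 := by exact_mod_cast hc.ne'
  funext x y
  simp only [antiDx, scaled]
  rw [antideriv_const_mul, antideriv_comp_div hc (fun s => u s (y / c))]
  field_simp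
  ring

theorem rePair_scaled (c : ℝ) (j k : ℕ) (u f : Field2) :
    rePair (scaled c j u) (scaled c k f) = scaled c (j + k) (rePair u f) := by
  funext x y
  simp only [rePair, scaled, map_mul, map_inv₀, map_pow, Complex.conj_ofReal]
  have e : ((c : ℂ) ^ j)⁻¹ * u (x / c) (y / c) * (((c : ℂ) ^ k)⁻¹ * conj (f (x / c) (y / c)))
      = (((c ^ (j + k))⁻¹ : ℝ) : ℂ) * (u (x / c) (y / c) * conj (f (x / c) (y / c))) := by
    push_cast
    rw [pow_add, mul_inv]
    ring
  rw [e, Complex.re_ofReal_mul]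
  push_cast
  rfl

theorem recOp_scaled {c : ℝ} (hc : 0 < c) (k : ℕ) (u f : Field2) :
    recOp (scaled c 1 u) (scaled c k f) = scaled c (k + 1) (recOp u f) := by
  rw [recOp, rePair_scaled, add_comm 1 k, antiDx_scaled hc, dx_scaled, recOp]
  funext x y
  simp only [scaled, Pi.smul_apply, Pi.add_apply, Pi.mul_apply, smul_eq_mul, pow_succ, pow_zero,
    mul_inv, one_mul]
  ring

theorem hierField_true_scaled {c : ℝ} (hc : 0 < c) (m : ℕ) (u : Field2) :
    hierField true m (scaled c 1 u) = scaled c (m + 2) (hierField true m u) := by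
  induction m with
  | zero =>
    simp only [hierField, baseField, dy_scaled]
    funext x y
    simp only [scaled, Pi.smul_apply, smul_eq_mul]
    ring
  | succ m ih => rw [hierField, ih, recOp_scaled hc, hierField, add_right_comm]

theorem flow_scaled {c : ℝ} (hc : 0 < c) {n : ℕ} (hn : 1 ≤ n) (u : Field2) :
    flow n (rescale c u) = scaled c (n + 2) (flow n u) := by
  rw [rescale_eq_scaled, flow_eq hn, flow_eq hn, hierField_true_scaled hc]
  funext x y
  simp only [scaled, Pi.smul_apply, smul_eq_mul]
  ring

theorem density2_rescale {c : ℝ} (hc : 0 < c) (m : ℕ) (u : Field2) (x y : ℝ) :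
    density2 m (rescale c u) (c * x) (c * y) = (c ^ (m + 3))⁻¹ * density2 m u x y := by
  apply Complex.ofReal_injective
  push_cast
  rw [density2_eq, density2_eq, rescale_eq_scaled, hierField_true_scaled hc, rePair_scaled]
  have e : 1 + (m + 1 + 2) = (m + 3) + 1 := by ring
  rw [e, antiDx_scaled hc]
  simp only [scaled]
  rw [mul_div_cancel_left₀ x hc.ne', mul_div_cancel_left₀ y hc.ne']
  ring

end

/-! ### Solutions of the flows -/

section

variable {C : YDomain} {K T : Set ℝ} {u w w' : ℝ → Field2} {n : ℕ}

/-- The derivative along a curve of a directional derivative of a smooth function. -/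
theorem hasDerivAt_fderiv_apply_comp {E : Type*} [NormedAddCommGroup E] [NormedSpace ℝ E]
    {W : E → ℂ} {γ : ℝ → E} {e d : E} {s : ℝ} (hW : ContDiffAt ℝ ∞ W (γ s))
    (hγ : HasDerivAt γ e s) :
    HasDerivAt (fun σ => fderiv ℝ W (γ σ) d)
      (fderiv ℝ (fun q => fderiv ℝ W q d) (γ s) e) s := by
  have h1 : ContDiffAt ℝ ∞ (fun q => fderiv ℝ W q d) (γ s) :=
    (hW.fderiv_right (m := ∞) (by simp)).clm_apply contDiffAt_const
  exact (h1.differentiableAt (by simp)).hasFDerivAt.comp_hasDerivAt s hγ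

theorem hasDerivAt_slice_t (s x y : ℝ) :
    HasDerivAt (fun σ : ℝ => (σ, x, y)) ((1 : ℝ), (0 : ℝ), (0 : ℝ)) s :=
  (hasDerivAt_id s).prodMk (hasDerivAt_const s (x, y))

theorem hasDerivAt_slice_x (s x y : ℝ) :
    HasDerivAt (fun σ : ℝ => (s, σ, y)) ((0 : ℝ), (1 : ℝ), (0 : ℝ)) x :=
  (hasDerivAt_const x s).prodMk ((hasDerivAt_id x).prodMk (hasDerivAt_const x y))

theorem hasDerivAt_slice_y (s x y : ℝ) :
    HasDerivAt (fun σ : ℝ => (s, x, σ)) ((0 : ℝ), (0 : ℝ), (1 : ℝ)) y :=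
  (hasDerivAt_const y s).prodMk ((hasDerivAt_const y x).prodMk (hasDerivAt_id y))

/-- A space derivative of a smooth evolving field is smooth, and its time derivative is the space
derivative of the time derivative. -/
theorem contDiffOn_fderiv_and_hasDerivAt (hK : IsOpen K)
    (hw : ContDiffOn ℝ ∞ (fun q : ℝ × ℝ × ℝ => w q.1 q.2.1 q.2.2) (K ×ˢ univ))
    (hd : ∀ s ∈ K, ∀ x y, HasDerivAt (fun σ => w σ x y) (w' s x y) s) (d : ℝ × ℝ × ℝ) :
    ContDiffOn ℝ ∞ (fun p => fderiv ℝ (fun q : ℝ × ℝ × ℝ => w q.1 q.2.1 q.2.2) p d) (K ×ˢ univ) ∧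
    ∀ s ∈ K, ∀ x y, ∀ γ : ℝ → ℝ × ℝ, ∀ τ, γ τ = (x, y) →
      HasDerivAt (fun σ => (s, γ σ)) d τ → HasDerivAt (fun σ =>
        fderiv ℝ (fun q : ℝ × ℝ × ℝ => w q.1 q.2.1 q.2.2) (σ, x, y) d)
        (deriv (fun σ => w' s (γ σ).1 (γ σ).2) τ) s := by
  have hopen : IsOpen (K ×ˢ (univ : Set (ℝ × ℝ))) := hK.prod isOpen_univ
  set W : ℝ × ℝ × ℝ → ℂ := fun q => w q.1 q.2.1 q.2.2
  have hat : ∀ p ∈ K ×ˢ (univ : Set (ℝ × ℝ)), ContDiffAt ℝ ∞ W p := fun p hp =>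
    hw.contDiffAt (hopen.mem_nhds hp)
  refine ⟨(hw.fderiv_of_isOpen hopen (m := ∞) (by simp)).clm_apply contDiffOn_const,
    fun s hs x y γ τ hγ hd' => ?_⟩
  have hp : (s, x, y) ∈ K ×ˢ (univ : Set (ℝ × ℝ)) := ⟨hs, trivial⟩
  have h1 := hasDerivAt_fderiv_apply_comp (γ := fun σ : ℝ => (σ, x, y)) (d := d)
    (hat _ hp) (hasDerivAt_slice_t s x y)
  -- The time derivative is itself a directional derivative of the smooth function W, so the claim
  -- reduces to symmetry of second derivatives.
  have e : (fun σ => w' s (γ σ).1 (γ σ).2) = fun σ => fderiv ℝ W (s, γ σ) (1, 0, 0) := by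
    funext σ
    have h2 := ((hat (s, γ σ) ⟨hs, trivial⟩).differentiableAt (by simp)).hasFDerivAt
    exact (hd s hs _ _).unique (h2.comp_hasDerivAt (f := fun ξ : ℝ => (ξ, (γ σ).1, (γ σ).2)) s
      (hasDerivAt_slice_t s _ _))
  have h3 := (hasDerivAt_fderiv_apply_comp (W := W) (γ := fun σ : ℝ => (s, γ σ)) (d := (1, 0, 0))
    (hat _ ⟨hs, trivial⟩) hd').deriv
  rw [e, h3, hγ, fderiv_fderiv_apply_comm (hat _ hp)]
  exact h1

theorem hasDerivAt_dxy_of_contDiffOn (hK : IsOpen K)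
    (hw : ContDiffOn ℝ ∞ (fun q : ℝ × ℝ × ℝ => w q.1 q.2.1 q.2.2) (K ×ˢ univ))
    (hd : ∀ s ∈ K, ∀ x y, HasDerivAt (fun σ => w σ x y) (w' s x y) s) {s : ℝ} (hs : s ∈ K)
    (a b : ℕ) (x y : ℝ) :
    HasDerivAt (fun σ => dxy a b (w σ) x y) (dxy a b (w' s) x y) s := by
  have hopen : IsOpen (K ×ˢ (univ : Set (ℝ × ℝ))) := hK.prod isOpen_univ
  refine C1Tame.hasDerivAt_dxy_of_closed hK (fun w w' =>
    ContDiffOn ℝ ∞ (fun q : ℝ × ℝ × ℝ => w q.1 q.2.1 q.2.2) (K ×ˢ univ) ∧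
    ∀ s ∈ K, ∀ x y, HasDerivAt (fun σ => w σ x y) (w' s x y) s) ?_ ?_ (fun w w' h => h.2)
    ⟨hw, hd⟩ hs a b x y
  · rintro w w' ⟨h1, h2⟩
    obtain ⟨h3, h4⟩ := contDiffOn_fderiv_and_hasDerivAt hK h1 h2 (0, 1, 0)
    have e : ∀ s ∈ K, ∀ x y, dx (w s) x y
        = fderiv ℝ (fun q : ℝ × ℝ × ℝ => w q.1 q.2.1 q.2.2) (s, x, y) (0, 1, 0) := by
      intro s hs x y
      have h5 := ((h1.contDiffAt (hopen.mem_nhds (x := (s, x, y)) ⟨hs, trivial⟩)).differentiableAt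
        (by simp)).hasFDerivAt
      exact (h5.comp_hasDerivAt (f := fun σ : ℝ => (s, σ, y)) x (hasDerivAt_slice_x s x y)).deriv
    refine ⟨_, _, ⟨h3.congr fun p hp => e p.1 hp.1 p.2.1 p.2.2, fun s hs x y => ?_⟩,
      fun s _ => ⟨rfl, rfl⟩⟩
    refine (h4 s hs x y (fun σ => (σ, y)) x rfl (hasDerivAt_slice_x s x y)).congr_of_eventuallyEq ?_
    filter_upwards [hK.mem_nhds hs] with σ hσ using e σ hσ x y
  · rintro w w' ⟨h1, h2⟩
    obtain ⟨h3, h4⟩ := contDiffOn_fderiv_and_hasDerivAt hK h1 h2 (0, 0, 1)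
    have e : ∀ s ∈ K, ∀ x y, dy (w s) x y
        = fderiv ℝ (fun q : ℝ × ℝ × ℝ => w q.1 q.2.1 q.2.2) (s, x, y) (0, 0, 1) := by
      intro s hs x y
      have h5 := ((h1.contDiffAt (hopen.mem_nhds (x := (s, x, y)) ⟨hs, trivial⟩)).differentiableAt
        (by simp)).hasFDerivAt
      exact (h5.comp_hasDerivAt (f := fun σ : ℝ => (s, x, σ)) y (hasDerivAt_slice_y s x y)).deriv
    refine ⟨_, _, ⟨h3.congr fun p hp => e p.1 hp.1 p.2.1 p.2.2, fun s hs x y => ?_⟩,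
      fun s _ => ⟨rfl, rfl⟩⟩
    refine (h4 s hs x y (fun σ => (x, σ)) y rfl (hasDerivAt_slice_y s x y)).congr_of_eventuallyEq ?_
    filter_upwards [hK.mem_nhds hs] with σ hσ using e σ hσ x y

/-- Near each time, a solution is a differentiable tame family, whose time derivative is the
vector field of the flow. -/
theorem IsSolution.c1Tame (hn : 1 ≤ n) (hT : IsOpen T) (hu : IsSolution C n T u) {t : ℝ}
    (ht : t ∈ T) : ∃ r > 0, Metric.ball t r ⊆ T ∧
      C1Tame C univ (Metric.ball t r) u (fun s => flow n (u s)) := by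
  -- Decay is uniform on compact time sets, so a closed ball supplies the bounds for the open ball
  -- inside it.
  obtain ⟨r, hr, hrT⟩ := Metric.nhds_basis_closedBall.mem_iff.1 (hT.mem_nhds ht)
  have hb : Metric.ball t r ⊆ T := Metric.ball_subset_closedBall.trans hrT
  have htame : Tame C univ (Metric.ball t r) u := by
    refine ⟨fun s hs => ?_, fun s hs => hu.periodic s (hb hs), fun j _ k a b => ?_⟩
    · have hopen : IsOpen (T ×ˢ (univ : Set (ℝ × ℝ))) := hT.prod isOpen_univ
      refine contDiff_iff_contDiffAt.2 fun p => ?_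
      have h1 := hu.smooth.contDiffAt (hopen.mem_nhds (x := (s, p)) ⟨hb hs, trivial⟩)
      exact h1.comp (f := fun p : ℝ × ℝ => (s, p)) p (contDiffAt_const.prodMk contDiffAt_id)
    · obtain ⟨M, hM⟩ := hu.decay _ hrT (isCompact_closedBall t r) j k a b
      exact ⟨M, fun s hs => hM s (Metric.ball_subset_closedBall hs)⟩
  refine ⟨r, hr, hb, htame, ?_, fun s hs a b x y => ?_⟩
  · simp only [flow_eq hn]
    exact (htame.hierField true n).smul _
  · exact hasDerivAt_dxy_of_contDiffOn Metric.isOpen_ball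
      (hu.smooth.mono (prod_mono hb Subset.rfl))
      (fun s hs x y => hu.evolution s (hb hs) x y) hs a b x y

theorem Admissible.flow (hn : 1 ≤ n) {v : Field2} (hv : Admissible C v) :
    Admissible C (flow n v) := by
  rw [flow_eq hn]
  exact (hv.hierField true n).smul _

theorem integral_flow_mul_conj_hierField (hn : 1 ≤ n) (b : Bool) (m : ℕ) {v : Field2}
    (hv : Admissible C v) : C.integral (fun x y =>
      (flow n v x y * conj (((-Complex.I) • hierField b m v) x y)).re) = 0 := by
  apply Complex.ofReal_injective
  rw [← YDomain.integral_ofReal]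
  change pairing C (flow n v) ((-Complex.I) • hierField b m v) = _
  rw [flow_eq hn, pairing_neg_left, ← neg_one_mul Complex.I, mul_smul, pairing_comm,
    pairing_neg_left, pairing_I_smul_hierField b m n hv]
  simp

theorem isConstantOfMotion_of_hamValue (hn : 1 ≤ n) {b : Bool} {m : ℕ} {h : Field2 → ℝ}
    (hh : ∀ v, Admissible C v → (h v : ℂ) = hamValue C b m v) : IsConstantOfMotion C n h := by
  refine ⟨fun v hv => ?_, fun T u hT hu t ht => ?_⟩
  · have := (isVariationalDerivative_of_hamValue hh v hv).2 _ (hv.flow hn)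
    rwa [integral_flow_mul_conj_hierField hn b m hv, mul_zero] at this
  · obtain ⟨r, hr, -, hc⟩ := hu.c1Tame hn hT ht
    have htr : t ∈ Metric.ball t r := Metric.mem_ball_self hr
    have := hc.hasDerivAt_ham Metric.isOpen_ball hh htr
    rwa [integral_flow_mul_conj_hierField hn b m (hc.tame.admissible htr), mul_zero] at this

theorem hasDerivAt_flow_line (hn : 1 ≤ n) {v q : Field2} (hv : Admissible C v)
    (hq : Admissible C q) (x y : ℝ) : HasDerivAt (fun ε : ℝ => flow n (v + ε • q) x y)
      (-hierDeriv true n v q x y) 0 := by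
  have := (((C1Tame.line 1 hv hq).hierField Metric.isOpen_ball true n).smul (-1)).hasDerivAt
    (s := 0) (by simp) x y
  simp only [Complex.ofReal_zero, zero_smul, add_zero, Pi.smul_apply, smul_eq_mul,
    neg_one_mul] at this
  simp only [real_smul_field, flow_eq hn, Pi.smul_apply, smul_eq_mul, neg_one_mul]
  exact this

theorem hierDeriv_neg (b : Bool) (m : ℕ) {v h : Field2} :
    hierDeriv b m v ((-1 : ℂ) • h) = (-1 : ℂ) • hierDeriv b m v h := by
  induction m with
  | zero =>
    cases b
    · simp only [hierDeriv, baseField]; rw [smul_comm]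
    · simp only [hierDeriv, baseField, dy_smul]
  | succ m ih =>
    have e : rePair ((-1 : ℂ) • h) (hierField b m v) = (-1 : ℂ) • rePair h (hierField b m v) := by
      funext x y
      simp only [rePair_apply, Pi.smul_apply, smul_eq_mul]
      apply Complex.ext <;> simp
      ring
    simp only [hierDeriv, ih, recOp_neg, recOpDeriv, e, antiDx_smul]
    funext x y
    simp only [Pi.smul_apply, Pi.add_apply, Pi.mul_apply, smul_eq_mul]
    ring

theorem hierDeriv_flow (hn : 1 ≤ n) (b : Bool) (m : ℕ) {v : Field2} (hv : Admissible C v) :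
    hierDeriv b m v (flow n v) = (-1 : ℂ) • hierDeriv true n v (hierField b m v) := by
  rw [flow_eq hn, hierDeriv_neg, hierDeriv_comm b true m n hv]

theorem isSymmetry_hierField (hn : 1 ≤ n) (b : Bool) (m : ℕ) :
    IsSymmetry C n (hierField b m) := by
  refine ⟨fun v hv => ⟨hv.hierField b m, fun x y => ⟨-hierDeriv true n v (hierField b m v) x y,
    hasDerivAt_flow_line hn hv (hv.hierField b m) x y, ?_⟩⟩, fun T u hT hu t ht x y => ?_⟩
  · have := ((C1Tame.line 1 hv (hv.flow hn)).hierField Metric.isOpen_ball b m).hasDerivAt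
      (s := 0) (by simp) x y
    simp only [Complex.ofReal_zero, zero_smul, add_zero, hierDeriv_flow hn b m hv, Pi.smul_apply,
      smul_eq_mul, neg_one_mul] at this
    exact this
  · obtain ⟨r, hr, -, hc⟩ := hu.c1Tame hn hT ht
    have htr : t ∈ Metric.ball t r := Metric.mem_ball_self hr
    have hv := hc.tame.admissible htr
    refine ⟨_, ?_, hasDerivAt_flow_line hn hv (hv.hierField b m) x y⟩
    have := (hc.hierField Metric.isOpen_ball b m).hasDerivAt htr x y
    simp only [hierDeriv_flow hn b m hv, Pi.smul_apply, smul_eq_mul, neg_one_mul] at this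
    exact this

theorem IsSolution.rotate (hn : 1 ≤ n) (φ : ℝ) (hu : IsSolution C n T u) :
    IsSolution C n T (fun t => rotate φ (u t)) := by
  refine ⟨contDiffOn_const.mul hu.smooth, fun t ht => (hu.periodic t ht).map₂ (hu.periodic t ht)
    (fun _ a _ => Complex.exp (Complex.I * φ) * a) fun _ _ => rfl, fun K hKT hK j k a b => ?_,
    fun t ht x y => ?_⟩
  · obtain ⟨M, hM⟩ := hu.decay K hKT hK j k a b
    exact ⟨_, fun t ht => (hM t ht).smul _⟩
  · rw [flow_rotate hn]
    exact (hu.evolution t ht x y).const_mul _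

theorem IsSolution.rescale (hn : 1 ≤ n) {c : ℝ} (hc : 0 < c) (hu : IsSolution C n T u) :
    IsSolution (C.dilate c hc) n ((fun t => t / c ^ (n + 1)) ⁻¹' T)
      (fun t => rescale c (u (t / c ^ (n + 1)))) := by
  refine ⟨?_, fun t ht => ?_, fun K hKT hK j k a b => ?_, fun t ht x y => ?_⟩
  · refine contDiffOn_const.mul (hu.smooth.comp
      (f := fun q : ℝ × ℝ × ℝ => (q.1 / c ^ (n + 1), q.2.1 / c, q.2.2 / c)) ?_ ?_)
    · exact ContDiff.contDiffOn (by fun_prop)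
    · exact fun q hq => ⟨hq.1, trivial⟩
  · have := hu.periodic _ ht
    cases C with
    | line => trivial
    | circle L hL =>
      intro x y
      have e : (y + c * L) / c = y / c + L := by field_simp
      simp only [NLSHierarchy.rescale]
      rw [e, this]
  · obtain ⟨M, hM⟩ := hu.decay ((fun t => t / c ^ (n + 1)) '' K) (image_subset_iff.2 hKT)
      (hK.image (by fun_prop)) j k a b
    -- The y-weight scales by c on the line but stays 1 on the circle, and max 1 c covers both
    -- cases. The negative power of c counts the field and its a + b derivatives.
    refine ⟨c ^ j * (max 1 c) ^ k * ((c ^ (1 + (a + b)))⁻¹ * M), fun t ht x y => ?_⟩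
    have h1 := hM _ (mem_image_of_mem _ ht) (x / c) (y / c)
    have e : (dx^[a] (dy^[b] (NLSHierarchy.rescale c (u (t / c ^ (n + 1)))))) x y
        = ((c : ℂ) ^ (1 + (a + b)))⁻¹ * dxy a b (u (t / c ^ (n + 1))) (x / c) (y / c) := by
      change dxy a b _ x y = _
      rw [rescale_eq_scaled, dxy_scaled]; rfl
    have hx : |x| = c * |x / c| := by
      rw [abs_div, abs_of_pos hc]; field_simp
    have hy : (C.dilate c hc).yWeight y ≤ max 1 c * C.yWeight (y / c) := by
      cases C with
      | line =>
        have : |y| = c * |y / c| := by rw [abs_div, abs_of_pos hc]; field_simp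
        simp only [YDomain.dilate, YDomain.yWeight]
        rw [this]
        exact mul_le_mul_of_nonneg_right (le_max_right _ _) (abs_nonneg _)
      | circle L hL => simp [YDomain.dilate, YDomain.yWeight]
    rw [e, norm_mul, norm_inv, norm_pow, Complex.norm_real, Real.norm_of_nonneg hc.le, hx, mul_pow]
    have h0 := (C.dilate c hc).yWeight_nonneg y
    have h0' := C.yWeight_nonneg (y / c)
    calc c ^ j * |x / c| ^ j * (C.dilate c hc).yWeight y ^ k *
          ((c ^ (1 + (a + b)))⁻¹ * ‖dxy a b (u (t / c ^ (n + 1))) (x / c) (y / c)‖)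
        ≤ c ^ j * |x / c| ^ j * (max 1 c * C.yWeight (y / c)) ^ k *
          ((c ^ (1 + (a + b)))⁻¹ * ‖dxy a b (u (t / c ^ (n + 1))) (x / c) (y / c)‖) := by gcongr
      _ = c ^ j * (max 1 c) ^ k * ((c ^ (1 + (a + b)))⁻¹ * (|x / c| ^ j *
          C.yWeight (y / c) ^ k * ‖dxy a b (u (t / c ^ (n + 1))) (x / c) (y / c)‖)) := by
        rw [mul_pow]; ring
      _ ≤ _ := by
        refine mul_le_mul_of_nonneg_left (mul_le_mul_of_nonneg_left h1 (by positivity)) ?_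
        positivity
  · rw [flow_scaled hc hn]
    have h1 := (hu.evolution _ ht (x / c) (y / c))
    have h2 : HasDerivAt (fun s : ℝ => s / c ^ (n + 1)) (c ^ (n + 1))⁻¹ t := by
      simpa using (hasDerivAt_id t).div_const (c ^ (n + 1))
    have h3 := (h1.scomp t h2).const_mul ((c : ℂ)⁻¹)
    refine h3.congr_deriv ?_
    simp only [scaled, Complex.real_smul, pow_succ]
    push_cast
    rw [mul_inv, mul_inv, mul_inv]
    ring

end

/-! ### The first members of the hierarchies -/

section

variable {C : YDomain} {u v w : Field2}

theorem rePair_real_smul_self (s : ℝ) (v w : Field2) :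
    rePair ((s : ℂ) • v) ((s : ℂ) • w) = ((s : ℂ) ^ 2) • rePair v w := by
  funext x y
  simp only [rePair_apply, Pi.smul_apply, smul_eq_mul, Complex.re_ofReal_mul, Complex.im_ofReal_mul]
  push_cast; ring

theorem hierField_true_one (u : Field2) :
    hierField true 1 u = (-Complex.I) • (dx (dy u) + antiDx (rePair u (dy u)) * u) := by
  change recOp u ((-1 : ℂ) • dy u) = _
  rw [recOp_neg, recOp, smul_smul]
  congr 1
  · ring
  · ring

theorem hierField_false_one (u : Field2) : hierField false 1 u = (-1 : ℂ) • dx u := by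
  change recOp u (Complex.I • u) = _
  have e : rePair u (Complex.I • u) = (0 : ℂ) • u := by
    funext x y
    simp only [rePair_apply, Pi.smul_apply, smul_eq_mul]
    apply Complex.ext <;> simp
    ring
  rw [recOp, e, antiDx_smul, dx_smul, zero_smul, mul_zero, add_zero, smul_smul, Complex.I_mul_I]

/-- The nonlocal term becomes local because Re(u ū_x) = ½ (|u|²)_x. -/
theorem hierField_false_two (hu : Admissible C u) : hierField false 2 u
    = (-Complex.I) • (dx (dx u) + ((1 / 2 : ℂ) • rePair u u) * u) := by
  change recOp u (hierField false 1 u) = _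
  have e : antiDx (rePair u (dx u)) = (1 / 2 : ℂ) • rePair u u := by
    have h : rePair u (dx u) = dx ((1 / 2 : ℂ) • rePair u u) := by
      rw [dx_smul, dx_rePair hu.smoothField hu.smoothField, rePair_comm (dx u)]
      funext x y
      simp only [Pi.smul_apply, Pi.add_apply, smul_eq_mul]
      ring
    rw [h, ((hu.rePair hu).smul _).antiDx_dx]
  rw [hierField_false_one, recOp_neg, recOp, e, smul_smul]
  congr 1
  · ring
  · ring

theorem nu0_eq (hu : Admissible C u) (x y : ℝ) :
    (nu0 u x y : ℂ) = antiDx (rePair u (dy u)) x y := by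
  rw [antiDx_rePair_apply, nu0]
  congr 2
  funext x y
  have h := (hu.smoothField.hasDerivAt_dy x y).norm_sq.deriv
  rw [h, Complex.inner]
  simp
  ring

theorem rePair_self_apply (u : Field2) (x y : ℝ) : rePair u u x y = (‖u x y‖ : ℂ) ^ 2 := by
  rw [rePair_apply, ← Complex.ofReal_pow, Complex.sq_norm, Complex.normSq_apply]

theorem pairing_self_dx (hu : Admissible C u) : pairing C u (dx u) = 0 := by
  have h := pairing_dx_left hu hu
  rw [pairing_comm] at h
  exact self_eq_neg.1 h

theorem pairing_self_dy (hu : Admissible C u) : pairing C u (dy u) = 0 := by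
  have h := pairing_dy_left hu hu
  rw [pairing_comm] at h
  exact self_eq_neg.1 h

/-- Integration by parts in y and in x leads to the same integral with opposite signs. Hence ∬ ū_x
u_y is real. -/
theorem pairing_dy_I_smul_dx (hu : Admissible C u) :
    pairing C (dy u) (Complex.I • dx u) = 0 := by
  have h1 : pairing C (dy u) (Complex.I • dx u) = -pairing C u (Complex.I • dx (dy u)) := by
    rw [pairing_dy_left hu (hu.dx.smul _), dy_smul, hu.smoothField.dx_dy_comm]
  have h2 : pairing C (dy u) (Complex.I • dx u) = pairing C u (Complex.I • dx (dy u)) := by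
    rw [pairing_comm, pairing_I_smul_left, pairing_dx_left hu (hu.dy.smul _), dx_smul, neg_neg]
  have h3 := h1
  rw [← h2] at h3
  exact self_eq_neg.1 h3

/-- The integral of `i ū w` for a field `w` orthogonal to `u`. -/
theorem integral_I_mul_conj_mul (hu : Admissible C u) (hw : Admissible C w)
    (h : pairing C u w = 0) :
    C.integral (fun x y => Complex.I * conj (u x y) * w x y) = pairing C u (Complex.I • w) := by
  have e : (fun x y => Complex.I * conj (u x y) * w x y)
      = rePair u (Complex.I • w) + Complex.I • rePair u w := by
    funext x y
    simp only [rePair_apply, Pi.smul_apply, Pi.add_apply, smul_eq_mul]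
    apply Complex.ext <;> simp <;> ring
  rw [e, (hu.rePair (hw.smul _)).integral_add ((hu.rePair hw).smul _), C.integral_smul]
  change _ + _ * pairing C u w = _
  rw [h, mul_zero, add_zero]; rfl

theorem pairing_real_smul_right (C : YDomain) (c : ℝ) (f g : Field2) :
    pairing C f ((c : ℂ) • g) = c * pairing C f g := by
  rw [pairing_comm, pairing_real_smul_left, pairing_comm]

theorem hasDerivAt_ofReal_pow_mul (A : ℂ) (n : ℕ) (s : ℝ) :
    HasDerivAt (fun s : ℝ => (s : ℂ) ^ n * A) (n * (s : ℂ) ^ (n - 1) * A) s := by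
  have h : HasDerivAt (fun s : ℝ => (s : ℂ)) 1 s := Complex.ofRealCLM.hasDerivAt
  simpa using (h.fun_pow n).mul_const A

theorem hamValue_true_zero (hu : Admissible C u) :
    hamValue C true 0 u = C.integral (fun x y => Complex.I * conj (u x y) * dy u x y) := by
  rw [integral_I_mul_conj_mul hu hu.dy (pairing_self_dy hu)]
  rw [hamValue_eq_of_ray true 0 hu (by simp) (hasDerivAt_ofReal_pow_mul _ 2) fun s => ?_]
  · rw [Complex.ofReal_one, one_pow, one_mul]
  · have e : (-Complex.I) • hierField true 0 ((s : ℂ) • u) = (s : ℂ) • Complex.I • dy u := by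
      simp only [hierField, baseField, dy_smul]
      funext x y
      simp only [Pi.smul_apply, smul_eq_mul]
      ring
    rw [e, pairing_real_smul_right]
    push_cast; ring

theorem hamValue_false_zero (hu : Admissible C u) :
    hamValue C false 0 u = pairing C u u := by
  rw [hamValue_eq_of_ray false 0 hu (by simp) (hasDerivAt_ofReal_pow_mul (pairing C u u) 2)
    fun s => ?_]
  · rw [Complex.ofReal_one, one_pow, one_mul]
  · have e : (-Complex.I) • hierField false 0 ((s : ℂ) • u) = (s : ℂ) • u := by
      simp only [hierField, baseField]
      rw [smul_smul (-Complex.I)]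
      simp
    rw [e, pairing_real_smul_right]
    push_cast; ring

theorem hamValue_false_one (hu : Admissible C u) :
    hamValue C false 1 u = C.integral (fun x y => Complex.I * conj (u x y) * dx u x y) := by
  rw [integral_I_mul_conj_mul hu hu.dx (pairing_self_dx hu)]
  rw [hamValue_eq_of_ray false 1 hu (by simp) (hasDerivAt_ofReal_pow_mul _ 2) fun s => ?_]
  · rw [Complex.ofReal_one, one_pow, one_mul]
  · have e : (-Complex.I) • hierField false 1 ((s : ℂ) • u) = (s : ℂ) • Complex.I • dx u := by
      rw [hierField_false_one, dx_smul]
      funext x y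
      simp only [Pi.smul_apply, smul_eq_mul]
      ring
    rw [e, pairing_real_smul_right]
    push_cast; ring

/-- Along the ray s u the quadratic part grows like s² and the quartic part like s⁴; integrating the
cubic term of the covector produces the factor 1/2. -/
theorem hamValue_true_one (hu : Admissible C u) :
    hamValue C true 1 u = pairing C (dx u) (dy u)
      - 1 / 2 * C.integral (rePair u u * antiDx (rePair u (dy u))) := by
  have hP := hu.mul_antiDx (hu.rePair hu.dy)
  rw [hamValue_eq_of_ray true 1 hu (by simp) (fun s => (hasDerivAt_ofReal_pow_mul
    (pairing C (dx u) (dy u)) 2 s).sub (hasDerivAt_ofReal_pow_mul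
    (1 / 2 * C.integral (rePair u u * antiDx (rePair u (dy u)))) 4 s)) fun s => ?_]
  · simp
  · have e : (-Complex.I) • hierField true 1 ((s : ℂ) • u)
        = ((-s : ℝ) : ℂ) • dx (dy u) + ((-s ^ 3 : ℝ) : ℂ) • (u * antiDx (rePair u (dy u))) := by
      rw [hierField_true_one, dy_smul, rePair_real_smul_self, antiDx_smul, dx_smul]
      funext x y
      simp only [Pi.smul_apply, Pi.add_apply, Pi.mul_apply, smul_eq_mul]
      push_cast
      linear_combination ((s : ℂ) * dx (dy u) x y + (s : ℂ) ^ 3 * u x y *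
        antiDx (rePair u (dy u)) x y) * Complex.I_mul_I
    rw [e, pairing_add_right (hu.dy.dx.smul _) (hP.smul _) hu, pairing_real_smul_right,
      pairing_real_smul_right, pairing_comm C u (u * _), pairing_dx_left hu hu.dy]
    simp only [pairing, rePair_mul_antiDx_left]
    push_cast; ring

theorem Admissible.rePair_mul_rePair (hu : Admissible C u) :
    Admissible C (NLSHierarchy.rePair u u * NLSHierarchy.rePair u u) :=
  (((hu.rePair hu).tame univ).mul (((hu.rePair hu).tame univ).mono (subset_univ _)
    Subset.rfl)).admissible (mem_univ 0)

theorem hamValue_false_two (hu : Admissible C u) :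
    hamValue C false 2 u = pairing C (dx u) (dx u)
      - 1 / 4 * C.integral (rePair u u * rePair u u) := by
  have hQ : Admissible C (rePair u u * u) := by
    have := ((hu.tame univ).mul (((hu.rePair hu).tame univ).mono (subset_univ {0})
      Subset.rfl)).admissible (mem_univ 0)
    rwa [mul_comm] at this
  rw [hamValue_eq_of_ray false 2 hu (by simp) (fun s => (hasDerivAt_ofReal_pow_mul
    (pairing C (dx u) (dx u)) 2 s).sub (hasDerivAt_ofReal_pow_mul
    (1 / 4 * C.integral (rePair u u * rePair u u)) 4 s)) fun s => ?_]
  · simp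
  · have e : (-Complex.I) • hierField false 2 ((s : ℂ) • u)
        = ((-s : ℝ) : ℂ) • dx (dx u) + ((-s ^ 3 / 2 : ℝ) : ℂ) • (rePair u u * u) := by
      rw [hierField_false_two (hu.smul s), rePair_real_smul_self, dx_smul, dx_smul]
      funext x y
      simp only [Pi.smul_apply, Pi.add_apply, Pi.mul_apply, smul_eq_mul]
      push_cast
      linear_combination ((s : ℂ) * dx (dx u) x y + (s : ℂ) ^ 3 / 2 * u x y *
        rePair u u x y) * Complex.I_mul_I
    have e2 : pairing C u (rePair u u * u) = C.integral (rePair u u * rePair u u) := by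
      have : rePair u (rePair u u * u) = rePair u u * rePair u u := by
        funext x y
        simp only [rePair_apply, Pi.mul_apply]
        apply Complex.ext <;> simp
        ring
      rw [pairing, this]
    rw [e, pairing_add_right (hu.dx.dx.smul _) (hQ.smul _) hu, pairing_real_smul_right,
      pairing_real_smul_right, e2, pairing_dx_left hu hu.dx]
    push_cast; ring

theorem ham2_zero (hu : Admissible C u) : (ham2 C 0 u : ℂ)
    = C.integral (fun x y => Complex.I * conj (u x y) * dy u x y) := by
  rw [(hu.iterIntegrable_density2 0).2, hamValue_true_zero hu]

theorem ham2_one (hu : Admissible C u) : (ham2 C 1 u : ℂ)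
    = C.integral (fun x y => conj (dx u x y) * dy u x y
        - 1 / 2 * (nu0 u x y : ℂ) * (‖u x y‖ : ℂ) ^ 2) := by
  have hxy := hu.dx.rePair hu.dy
  have hyx := hu.dy.rePair (hu.dx.smul Complex.I)
  have e : (fun x y => conj (dx u x y) * dy u x y
        - 1 / 2 * (nu0 u x y : ℂ) * (‖u x y‖ : ℂ) ^ 2)
      = (rePair (dx u) (dy u) + Complex.I • rePair (dy u) (Complex.I • dx u))
        + (-(1 / 2) : ℂ) • (rePair u u * antiDx (rePair u (dy u))) := by
    funext x y
    simp only [Pi.smul_apply, Pi.add_apply, Pi.mul_apply, smul_eq_mul]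
    rw [nu0_eq hu, rePair_self_apply]
    have : conj (dx u x y) * dy u x y = rePair (dx u) (dy u) x y
        + Complex.I * rePair (dy u) (Complex.I • dx u) x y := by
      simp only [rePair_apply, Pi.smul_apply, smul_eq_mul]
      apply Complex.ext <;> simp
      ring
    rw [this]
    ring
  rw [(hu.iterIntegrable_density2 1).2, hamValue_true_one hu, e,
    (hxy.add (hyx.smul _)).integral_add (((hu.rePair hu).mul_antiDx (hu.rePair hu.dy)).smul _),
    hxy.integral_add (hyx.smul _), C.integral_smul, C.integral_smul]
  change pairing C _ _ - _ = pairing C _ _ + _ * pairing C _ _ + _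
  rw [pairing_dy_I_smul_dx hu]
  ring

theorem ham1_zero (hu : Admissible C u) :
    ham1 C 0 u = C.integral (fun x y => ‖u x y‖ ^ 2) := by
  apply Complex.ofReal_injective
  rw [(hu.iterIntegrable_density1 0).2, hamValue_false_zero hu, ← YDomain.integral_ofReal, pairing]
  congr 1
  funext x y
  rw [rePair_self_apply]
  push_cast; rfl

theorem ham1_one (hu : Admissible C u) : (ham1 C 1 u : ℂ)
    = C.integral (fun x y => Complex.I * conj (u x y) * dx u x y) := by
  rw [(hu.iterIntegrable_density1 1).2, hamValue_false_one hu]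

theorem ham1_two (hu : Admissible C u) :
    ham1 C 2 u = C.integral (fun x y => ‖dx u x y‖ ^ 2 - 1 / 4 * ‖u x y‖ ^ 4) := by
  apply Complex.ofReal_injective
  have e : (fun x y => ((‖dx u x y‖ ^ 2 - 1 / 4 * ‖u x y‖ ^ 4 : ℝ) : ℂ))
      = rePair (dx u) (dx u) + (-(1 / 4) : ℂ) • (rePair u u * rePair u u) := by
    funext x y
    simp only [Pi.smul_apply, Pi.add_apply, Pi.mul_apply, smul_eq_mul, rePair_self_apply]
    push_cast; ring
  rw [(hu.iterIntegrable_density1 2).2, hamValue_false_two hu, ← YDomain.integral_ofReal, e,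
    (hu.dx.rePair hu.dx).integral_add (hu.rePair_mul_rePair.smul _), C.integral_smul, pairing]
  ring

end

end NLSHierarchy

end

/-! ### Assembly of the proposition. -/

theorem mainTheorem10 (C : NLSHierarchy.YDomain) (n : ℕ) (hn : 1 ≤ n) :
    -- the flow and the Hamiltonians are well defined, and the flow is bi-Hamiltonian
    ((∀ u, NLSHierarchy.Admissible C u →
        NLSHierarchy.Admissible C (NLSHierarchy.flow n u) ∧
        NLSHierarchy.flow n u
          = NLSHierarchy.opH u (NLSHierarchy.covector2 (n - 1) u) ∧
        NLSHierarchy.flow n u = NLSHierarchy.opI (NLSHierarchy.covector2 n u)) ∧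
      ∀ m : ℕ,
        NLSHierarchy.IsVariationalDerivative C (NLSHierarchy.ham2 C m)
          (NLSHierarchy.covector2 m) ∧
        NLSHierarchy.IsVariationalDerivative C (NLSHierarchy.ham1 C m)
          (NLSHierarchy.covector1 m) ∧
        ∀ u, NLSHierarchy.Admissible C u →
          C.IterIntegrable (NLSHierarchy.density2 m u) ∧
          C.IterIntegrable (NLSHierarchy.density1 m u)) ∧
    -- invariance under phase rotations
    (∀ φ : ℝ,
      (∀ u, NLSHierarchy.Admissible C u →
        NLSHierarchy.flow n (NLSHierarchy.rotate φ u)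
          = NLSHierarchy.rotate φ (NLSHierarchy.flow n u) ∧
        ∀ m : ℕ, NLSHierarchy.density2 m (NLSHierarchy.rotate φ u)
          = NLSHierarchy.density2 m u) ∧
      ∀ (T : Set ℝ) (u : ℝ → NLSHierarchy.Field2), IsOpen T →
        NLSHierarchy.IsSolution C n T u →
        NLSHierarchy.IsSolution C n T (fun t => NLSHierarchy.rotate φ (u t))) ∧
    -- homogeneity under scalings
    (∀ (c : ℝ) (hc : 0 < c),
      (∀ u, NLSHierarchy.Admissible C u → ∀ x y : ℝ,
        NLSHierarchy.flow n (NLSHierarchy.rescale c u) (c * x) (c * y)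
          = ((c ^ (n + 2))⁻¹ : ℝ) * NLSHierarchy.flow n u x y ∧
        ∀ m : ℕ, NLSHierarchy.density2 m (NLSHierarchy.rescale c u) (c * x) (c * y)
          = (c ^ (m + 3))⁻¹ * NLSHierarchy.density2 m u x y) ∧
      ∀ (T : Set ℝ) (u : ℝ → NLSHierarchy.Field2), IsOpen T →
        NLSHierarchy.IsSolution C n T u →
        NLSHierarchy.IsSolution (C.dilate c hc) n ((fun t => t / c ^ (n + 1)) ⁻¹' T)
          (fun t => NLSHierarchy.rescale c (u (t / c ^ (n + 1))))) ∧
    -- constants of motion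
    (∀ m : ℕ,
      NLSHierarchy.IsConstantOfMotion C n (NLSHierarchy.ham2 C m) ∧
      NLSHierarchy.IsConstantOfMotion C n (NLSHierarchy.ham1 C m)) ∧
    -- the first constants of motion, explicitly
    (∀ u, NLSHierarchy.Admissible C u →
      (NLSHierarchy.ham2 C 0 u : ℂ)
        = C.integral (fun x y =>
            Complex.I * (starRingEnd ℂ) (u x y) * NLSHierarchy.dy u x y) ∧
      (NLSHierarchy.ham2 C 1 u : ℂ)
        = C.integral (fun x y =>
            (starRingEnd ℂ) (NLSHierarchy.dx u x y) * NLSHierarchy.dy u x y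
              - 1 / 2 * (NLSHierarchy.nu0 u x y : ℂ) * (‖u x y‖ : ℂ) ^ 2) ∧
      NLSHierarchy.ham1 C 0 u = C.integral (fun x y => ‖u x y‖ ^ 2) ∧
      (NLSHierarchy.ham1 C 1 u : ℂ)
        = C.integral (fun x y =>
            Complex.I * (starRingEnd ℂ) (u x y) * NLSHierarchy.dx u x y) ∧
      NLSHierarchy.ham1 C 2 u
        = C.integral (fun x y => ‖NLSHierarchy.dx u x y‖ ^ 2 - 1 / 4 * ‖u x y‖ ^ 4)) ∧
    -- Hamiltonian symmetries
    (∀ m : ℕ,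
      NLSHierarchy.IsSymmetry C n (NLSHierarchy.symmetry2 m) ∧
      NLSHierarchy.IsSymmetry C n (NLSHierarchy.symmetry1 m)) ∧
    -- the first symmetries, explicitly
    (∀ u, NLSHierarchy.Admissible C u → ∀ x y : ℝ,
      NLSHierarchy.symmetry2 0 u x y = -NLSHierarchy.dy u x y ∧
      NLSHierarchy.symmetry2 1 u x y
        = -Complex.I * (NLSHierarchy.dx (NLSHierarchy.dy u) x y
            + (NLSHierarchy.nu0 u x y : ℂ) * u x y) ∧
      NLSHierarchy.symmetry1 0 u x y = Complex.I * u x y ∧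
      NLSHierarchy.symmetry1 1 u x y = -NLSHierarchy.dx u x y ∧
      NLSHierarchy.symmetry1 2 u x y
        = -Complex.I * (NLSHierarchy.dx (NLSHierarchy.dx u) x y
            + 1 / 2 * (‖u x y‖ : ℂ) ^ 2 * u x y)) := by
  open NLSHierarchy in
  have h2 : ∀ m, covector2 m = fun u => (-Complex.I) • hierField true m u :=
    fun m => funext (covector2_eq m)
  have h1 : ∀ m, covector1 m = fun u => (-Complex.I) • hierField false m u :=
    fun m => funext (covector1_eq m)
  have s2 : ∀ m, symmetry2 m = hierField true m := fun m => funext (symmetry2_eq m)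
  have s1 : ∀ m, symmetry1 m = hierField false m := fun m => funext (symmetry1_eq m)
  refine ⟨⟨fun u hu => ⟨hu.flow hn, rfl, ?_⟩, fun m => ⟨?_, ?_, fun u hu =>
    ⟨(hu.iterIntegrable_density2 m).1, (hu.iterIntegrable_density1 m).1⟩⟩⟩,
    fun φ => ⟨fun u _ => ⟨flow_rotate hn φ u, fun m => density2_rotate m φ u⟩,
      fun T u _ hu => hu.rotate hn φ⟩,
    fun c hc => ⟨fun u _ x y => ⟨?_, fun m => density2_rescale hc m u x y⟩,
      fun T u _ hu => hu.rescale hn hc⟩,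
    fun m => ⟨isConstantOfMotion_of_hamValue hn fun v hv => (hv.iterIntegrable_density2 m).2,
      isConstantOfMotion_of_hamValue hn fun v hv => (hv.iterIntegrable_density1 m).2⟩,
    fun u hu => ⟨ham2_zero hu, ham2_one hu, ham1_zero hu, ham1_one hu, ham1_two hu⟩,
    fun m => ⟨?_, ?_⟩, fun u hu x y => ⟨?_, ?_, ?_, ?_, ?_⟩⟩
  · change flow n u = (-Complex.I) • covector2 n u
    rw [flow_eq hn, covector2_eq, smul_smul]
    simp
  · rw [h2]
    exact isVariationalDerivative_of_hamValue fun v hv => (hv.iterIntegrable_density2 m).2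
  · rw [h1]
    exact isVariationalDerivative_of_hamValue fun v hv => (hv.iterIntegrable_density1 m).2
  · rw [flow_scaled hc hn]
    simp only [scaled]
    rw [mul_div_cancel_left₀ x hc.ne', mul_div_cancel_left₀ y hc.ne']
    push_cast; rfl
  · rw [s2]; exact isSymmetry_hierField hn true m
  · rw [s1]; exact isSymmetry_hierField hn false m
  · simp [s2, hierField, baseField]
  · rw [s2, hierField_true_one, nu0_eq hu]; rfl
  · rw [s1]; rfl
  · rw [s1, hierField_false_one]
    simp
  · rw [s1, hierField_false_two hu, ← rePair_self_apply]; rfl
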